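/- Let $n$ be a natural number and consider an open chain of $2n$ qubits, with computational basis $\{0,1\}^{2n}$. A state $\psi$ of $n$ logical qubits is mirror-encoded as $E(\psi)=\psi_{1\ldots n}\otimes\psi_{2n\ldots n+1}$ (a second copy, in reversed order, on the second half of the chain), and the logical operator of an operator $U$ on $n$ qubits is $\overline U=U_{1\ldots n}\otimes U_{2n\ldots n+1}$, so that $\overline U E(\psi)=E(U\psi)$. On a chain of $2n$ qubits let $$\sigma^{z}_{\rm tot}(\theta)=\prod_{j=1}^{2n}e^{i\frac{\theta}{2}\sigma^z_j},\qquad \mathsf{CP}_{\rm tot}=\prod_{j=1}^{2n-1}\mathsf{CP}_{j,j+1},\qquad \mathsf{Had}_{\rm tot}=\prod_{j=1}^{2n}\mathsf{Had}_j,$$ where $\mathsf{Had}=e^{i\frac{\pi}{2\sqrt2}(\sigma^x+\sigma^z)}$ and $\mathsf{CP}=e^{i\pi|11\rangle\langle 11|}$, and let $\mathfrak G=\{\mathsf{CP}_{\rm tot},\sigma^z_{\rm tot}(\pi/8),\mathsf{Had}_{\rm tot}\}$. Then $\mathfrak G$ is universal for quantum computation in the mirror encoding, in the following sense. (1) There is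 an absolute constant $C$ such that for every $n$ and each of the following operators $U$ on $n$ qubits there is a product $L$ of at most $Cn$ elements of $\mathfrak G$ and a phase $c$, $|c|=1$, with $L=c\,\overline U$, and hence $L\,E(\psi)=c\,E(U\psi)$ for all $\psi$: the rotations $e^{i\frac{\alpha}{2}\sigma^z_k}$ and $e^{i\frac{\alpha}{2}\sigma^x_k}$, $\alpha\in\frac{\pi}{4}\mathbb Z$, the gate $T_k$, with $T={\rm diag}(1,e^{i\pi/4})$, and the Hadamard gate $H_k$, with $H=(\sigma^x+\sigma^z)/\sqrt2$, for $1\le k\le n$; the entangling gates $e^{i\alpha\sigma^z_k\otimes\sigma^x_{k+1}}$, $\alpha\in\frac{\pi}{8}\mathbb Z$, and the gates $\mathrm{CNOT}_{k,k+1}$, for $1\le k\le n-1$. (2) For every $n$, every unitary $U$ on $n$ qubits and every $\epsilon>0$ there are a finite product $L$ of elements of $\mathfrak G$ and a phase $c$, $|c|=1$, such that $\|L-c\,\overline U\|\le\epsilon$ in operator norm and $\|L\,E(\psi)-c\,E(U\psi)\|\le\epsilon$ for all unit vectors $\psi$. (3) The simulation of circuits is efficient: there are absolute constants $C,d\in\mathbb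 N$ such that for every $n$, every $0<\epsilon<1$ and every circuit on $n$ qubits, with product $U$, of $m$ gates, each an arbitrary one-qubit unitary on some qubit or a $\mathrm{CNOT}$ on some ordered pair of distinct qubits, there is a product $L$ of at most $C\,(n+m+\log(1/\epsilon))^d$ elements of $\mathfrak G$ that approximates $U$ within $\epsilon$ in the sense of (2). -/

import Mathlib

noncomputable section

namespace GlobalIsing

open Matrix

/-- Computational basis configurations of `N` qubits. -/
abbrev Config (N : ℕ) : Type := Fin N → Fin 2

/-- Operators on `N` qubits, written in the computational basis. -/
abbrev Op (N : ℕ) : Type := Matrix (Config N) (Config N) ℂ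

/-! ### One- and two-qubit matrices -/

/-- The Pauli matrix `σ^x`. -/
def sigmaX : Matrix (Fin 2) (Fin 2) ℂ := !![0, 1; 1, 0]

/-- The Pauli matrix `σ^y`. -/
def sigmaY : Matrix (Fin 2) (Fin 2) ℂ := !![0, -Complex.I; Complex.I, 0]

/-- The Pauli matrix `σ^z`. -/
def sigmaZ : Matrix (Fin 2) (Fin 2) ℂ := !![1, 0; 0, -1]

/-- The rotation `exp (i (θ/2) σ)`, for a Pauli matrix `σ`. -/
def rot (σ : Matrix (Fin 2) (Fin 2) ℂ) (θ : ℝ) : Matrix (Fin 2) (Fin 2) ℂ :=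
  NormedSpace.exp ((Complex.I * ((θ / 2 : ℝ) : ℂ)) • σ)

/-- The single-qubit Hadamard pulse `exp (i π/(2√2) (σ^x + σ^z))`. -/
def hadPulse : Matrix (Fin 2) (Fin 2) ℂ :=
  NormedSpace.exp
    ((Complex.I * ((Real.pi / (2 * Real.sqrt 2) : ℝ) : ℂ)) • (sigmaX + sigmaZ))

/-- The two-qubit controlled-phase gate `exp (i π |11⟩⟨11|)`. -/
def cphase : Matrix (Fin 2 × Fin 2) (Fin 2 × Fin 2) ℂ :=
  NormedSpace.exp
    ((Complex.I * ((Real.pi : ℝ) : ℂ)) • Matrix.single ((1 : Fin 2), (1 : Fin 2)) (1, 1) (1 : ℂ))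

/-- The two-qubit entangling gate `exp (i α σ^z ⊗ σ^x)`. -/
def entangler (α : ℝ) : Matrix (Fin 2 × Fin 2) (Fin 2 × Fin 2) ℂ :=
  NormedSpace.exp ((Complex.I * (α : ℂ)) • Matrix.kronecker sigmaZ sigmaX)

/-- The `T` gate `diag (1, exp (i π/4))`. -/
def tGate : Matrix (Fin 2) (Fin 2) ℂ :=
  !![1, 0; 0, Complex.exp (Complex.I * ((Real.pi / 4 : ℝ) : ℂ))]

/-- The standard Hadamard gate `(σ^x + σ^z) / √2`. -/
def hGate : Matrix (Fin 2) (Fin 2) ℂ :=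
  ((1 / Real.sqrt 2 : ℝ) : ℂ) • (sigmaX + sigmaZ)

/-- The controlled-NOT gate: the first qubit is the control, the second one the target. -/
def cnot : Matrix (Fin 2 × Fin 2) (Fin 2 × Fin 2) ℂ :=
  fun a b => if a = (b.1, b.1 + b.2) then 1 else 0

/-! ### Gates placed on a register -/

/-- The one-qubit operator `A` acting on qubit `j` of an `N`-qubit register, the identity on the
other qubits. -/
def onSite {N : ℕ} (j : Fin N) (A : Matrix (Fin 2) (Fin 2) ℂ) : Op N :=
  fun s t => if ∀ l, l ≠ j → s l = t l then A (s j) (t j) else 0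

/-- The two-qubit operator `A` acting on the ordered pair of distinct qubits `(i, j)`, the identity
on the other qubits. -/
def onPair {N : ℕ} (i j : Fin N) (A : Matrix (Fin 2 × Fin 2) (Fin 2 × Fin 2) ℂ) : Op N :=
  fun s t => if ∀ l, l ≠ i → l ≠ j → s l = t l then A (s i, s j) (t i, t j) else 0

/-! ### Global operations on an open chain -/

/-- The same one-qubit operator applied to every qubit of the chain. -/
def uniform (N : ℕ) (A : Matrix (Fin 2) (Fin 2) ℂ) : Op N :=
  (List.ofFn fun j : Fin N => onSite j A).prod

/-- `σ^α_tot (θ) = ∏_j exp (i (θ/2) σ^α_j)`. -/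
def sigmaTot (N : ℕ) (σ : Matrix (Fin 2) (Fin 2) ℂ) (θ : ℝ) : Op N :=
  uniform N (rot σ θ)

/-- `Had_tot`, the product of the Hadamard pulses on all qubits. -/
def hadTot (N : ℕ) : Op N := uniform N hadPulse

/-- `CP_tot`, the product of the controlled-phase gates on all nearest-neighbour pairs. -/
def cpTot (N : ℕ) : Op N :=
  (List.ofFn fun j : Fin (N - 1) =>
    onPair (⟨j.1, by have := j.2; omega⟩ : Fin N) ⟨j.1 + 1, by have := j.2; omega⟩ cphase).prod

/-- The set of global gates `{CP_tot, σ^z_tot (π/8), Had_tot}` on a chain of `N` qubits. -/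
def globalGates (N : ℕ) : Set (Op N) :=
  {cpTot N, sigmaTot N sigmaZ (Real.pi / 8), hadTot N}

/-- `GlobalWord N m L`: the operator `L` is a product of `m` global gates. -/
def GlobalWord (N m : ℕ) (L : Op N) : Prop :=
  ∃ w : List (Op N), (∀ g ∈ w, g ∈ globalGates N) ∧ w.length = m ∧ w.prod = L

/-! ### The mirror encoding -/

/-- The bits on the first `n` qubits of a chain of `2n` qubits, read from the left end. -/
def leftHalf {n : ℕ} (s : Config (2 * n)) : Config n :=
  fun j => s (Fin.castLE (by omega) j)

/-- The bits on the last `n` qubits of a chain of `2n` qubits, read from the right end. -/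
def rightHalf {n : ℕ} (s : Config (2 * n)) : Config n :=
  fun j => s (Fin.rev (Fin.castLE (by omega) j))

/-- The mirror-encoded wave function `ψ_{1 … n} ⊗ ψ_{2n … n+1}`. -/
def encode {n : ℕ} (ψ : Config n → ℂ) : Config (2 * n) → ℂ :=
  fun s => ψ (leftHalf s) * ψ (rightHalf s)

/-- The logical operator `U_{1 … n} ⊗ U_{2n … n+1}` on the chain. -/
def logical {n : ℕ} (U : Op n) : Op (2 * n) :=
  fun s t => U (leftHalf s) (leftHalf t) * U (rightHalf s) (rightHalf t)

/-- Up to a global phase, `L` is the logical operator of `U`; in particular it maps the encoding of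
each `ψ` to the encoding of `U ψ`. -/
def Realises {n : ℕ} (L : Op (2 * n)) (U : Op n) : Prop :=
  ∃ c : ℂ, ‖c‖ = 1 ∧ L = c • logical U ∧
    ∀ ψ : Config n → ℂ, L *ᵥ encode ψ = c • encode (U *ᵥ ψ)

/-- Up to a global phase, `L` is within `ε`, in operator norm, of the logical operator of `U`, and
maps the encoding of each unit vector `ψ` to within `ε` of the encoding of `U ψ`. -/
def Approximates {n : ℕ} (L : Op (2 * n)) (U : Op n) (ε : ℝ) : Prop :=
  ∃ c : ℂ, ‖c‖ = 1 ∧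
    ‖Matrix.toEuclideanCLM (n := Config (2 * n)) (𝕜 := ℂ) (L - c • logical U)‖ ≤ ε ∧
    ∀ ψ : Config n → ℂ, ‖WithLp.toLp 2 ψ‖ = 1 →
      ‖WithLp.toLp 2 (L *ᵥ encode ψ - c • encode (U *ᵥ ψ))‖ ≤ ε

/-! ### Gates and circuits on the logical register -/

/-- The gates on `n` logical qubits: `Z`- and `X`-rotations by multiples of `π/4`, `T` and Hadamard
gates on any qubit, and the entangling gates `exp (i α σ^z_k σ^x_{k+1})`, for `α` a multiple of
`π/8`, and controlled-NOT gates on neighbouring qubits. -/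
inductive ElementaryLogical (n : ℕ) : Op n → Prop
  | zRot (k : Fin n) (m : ℤ) : ElementaryLogical n (onSite k (rot sigmaZ (m * (Real.pi / 4))))
  | xRot (k : Fin n) (m : ℤ) : ElementaryLogical n (onSite k (rot sigmaX (m * (Real.pi / 4))))
  | t (k : Fin n) : ElementaryLogical n (onSite k tGate)
  | had (k : Fin n) : ElementaryLogical n (onSite k hGate)
  | ent (k l : Fin n) (h : l.1 = k.1 + 1) (m : ℤ) :
      ElementaryLogical n (onPair k l (entangler (m * (Real.pi / 8))))
  | cnot (k l : Fin n) (h : l.1 = k.1 + 1) : ElementaryLogical n (onPair k l cnot)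

/-- The gates of a general quantum circuit on `n` qubits: arbitrary one-qubit unitaries on any
qubit, and controlled-NOT gates on any ordered pair of distinct qubits. -/
inductive CircuitGate (n : ℕ) : Op n → Prop
  | single (k : Fin n) (A : Matrix (Fin 2) (Fin 2) ℂ) (hA : A ∈ Matrix.unitaryGroup (Fin 2) ℂ) :
      CircuitGate n (onSite k A)
  | cnot (i j : Fin n) (h : i ≠ j) : CircuitGate n (onPair i j cnot)

end GlobalIsing

end

/-! The Hadamard layer following `cpTot`, called `shift`, is a Clifford cellular automaton.
Conjugation by it turns `X` at an end of the chain into `Z X` on the two outermost sites, and a pair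
`Z X` in the interior into the same pair one site further in. To address the ends at all, note that
conjugating `cpTot` by `X` on every site and multiplying by `cpTot` again leaves only `Z` on the
first and last site, because the interior signs telescope. Conjugating a uniform `X` rotation by
this pair reverses the angle at the ends only, which isolates an `X` rotation there. The two ends
are the two copies of the first logical qubit, and the mirror order lets one power of `shift` carry
both copies inwards together. Thus every logical `exp (i α Z_k X_{k+1})` is reached with `O(n)`
gates (`logReach_zx`). Uniform `Z` rotations turn it into a `Z Y` rotation, and conjugating one by
the other cancels `Z_k` and leaves a rotation of a single qubit (`logReach_zRot`). Hadamard, `T` and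
CNOT are products of such rotations up to a phase; this is part (1).

For one qubit, `e^{iπZ/8} e^{iπX/8}` is a rotation by an irrational multiple of `2π`. Its powers
therefore fill a one-parameter group, and conjugates and Lie sums of its generator give all of
`SU(2)` (`su2_subset_qubitClosure`). Compactness makes the word length uniform at any fixed
accuracy, and the Solovay–Kitaev recursion with group commutators improves the length to a power of
`log (1/δ)` (`solovay_kitaev`). CNOT between distant qubits costs quadratically many global gates.
Errors add along a circuit and at most double when passing to the two copies; this gives part (3).

For part (2), the Hermitian generators of the closure of the circuits form a real vector space by
the Lie product formula. CNOT conjugation produces all `Z` strings in it, and local unitaries turn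
these into all Pauli strings, hence into every Hermitian matrix. A unitary is a phase times `exp (i
H)`, so circuits are dense up to phase. -/

noncomputable section

namespace GlobalIsing

open Matrix

open scoped Matrix.Norms.L2Operator

/-! ### Exponentials of involutions -/

section Involutions

variable {R S : Type*} [Ring R] [Algebra ℂ R] [Ring S] [Algebra ℂ S]

/-- `cos θ + i sin θ A`, the exponential of `i θ A` when `A` is an involution. -/
def cis (θ : ℝ) (A : R) : R :=
  (Real.cos θ : ℂ) • 1 + (Complex.I * (Real.sin θ : ℂ)) • A

theorem cis_zero (A : R) : cis 0 A = 1 := by simp [cis]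

theorem cis_pi_div_two (A : R) : cis (Real.pi / 2) A = Complex.I • A := by
  simp [cis, -Complex.ofReal_cos, -Complex.ofReal_sin]

theorem cis_neg_right (θ : ℝ) (A : R) : cis θ (-A) = cis (-θ) A := by
  simp [cis, -Complex.ofReal_cos, -Complex.ofReal_sin]

theorem cis_add_two_pi (θ : ℝ) (A : R) (k : ℤ) : cis (θ + k * (2 * Real.pi)) A = cis θ A := by
  simp only [cis, Real.cos_add_int_mul_two_pi, Real.sin_add_int_mul_two_pi]

theorem cis_mul {A : R} (hA : A * A = 1) (θ φ : ℝ) : cis θ A * cis φ A = cis (θ + φ) A := by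
  simp only [cis, add_mul, mul_add, smul_mul_smul_comm, hA, mul_one, one_mul, Real.cos_add,
    Real.sin_add, Complex.ofReal_sub, Complex.ofReal_add, Complex.ofReal_mul]
  have : Complex.I * (Real.sin θ : ℂ) * (Complex.I * (Real.sin φ : ℂ))
      = -(Real.sin θ * Real.sin φ : ℂ) := by
    linear_combination (Real.sin θ * Real.sin φ : ℂ) * Complex.I_mul_I
  rw [this]
  module

theorem cis_mul_cis_neg {A : R} (hA : A * A = 1) (θ : ℝ) : cis θ A * cis (-θ) A = 1 := by
  rw [cis_mul hA, add_neg_cancel, cis_zero]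

theorem cis_neg_mul_cis {A : R} (hA : A * A = 1) (θ : ℝ) : cis (-θ) A * cis θ A = 1 := by
  rw [cis_mul hA, neg_add_cancel, cis_zero]

theorem cis_pow {A : R} (hA : A * A = 1) (θ : ℝ) (k : ℕ) : cis θ A ^ k = cis (k * θ) A := by
  induction k with
  | zero => simp [cis_zero]
  | succ k ih =>
    rw [pow_succ, ih, cis_mul hA]
    push_cast
    ring_nf

theorem mul_cis {U A B : R} (h : U * A = B * U) (θ : ℝ) : U * cis θ A = cis θ B * U := by
  simp only [cis, mul_add, add_mul, mul_smul_comm, smul_mul_assoc, h, mul_one, one_mul]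

theorem Commute.cis_right {U A : R} (h : Commute U A) (θ : ℝ) : Commute U (cis θ A) :=
  mul_cis h θ

theorem conj_cis {U V A B : R} (h : U * A = B * U) (hU : U * V = 1) (θ : ℝ) :
    U * cis θ A * V = cis θ B := by
  rw [mul_cis h, mul_assoc, hU, mul_one]

theorem map_cis (f : R →ₐ[ℂ] S) (θ : ℝ) (A : R) : f (cis θ A) = cis θ (f A) := by
  simp [cis]

theorem star_cis [StarRing R] [StarModule ℂ R] {A : R} (hA : star A = A) (θ : ℝ) :
    star (cis θ A) = cis (-θ) A := by
  simp [cis, hA, -Complex.ofReal_cos, -Complex.ofReal_sin]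

theorem cis_mem_unitary [StarRing R] [StarModule ℂ R] {A : R} (hA : A * A = 1)
    (hs : star A = A) (θ : ℝ) : cis θ A ∈ unitary R := by
  rw [Unitary.mem_iff, star_cis hs]
  exact ⟨cis_neg_mul_cis hA θ, cis_mul_cis_neg hA θ⟩

/-- Conjugation by a quarter rotation about `A` turns an anticommuting `B` into `i A B`. -/
theorem cis_pi_div_four_mul {A B : R} (hA : A * A = 1) (hAB : A * B = -(B * A)) :
    cis (Real.pi / 4) A * B = (Complex.I • (A * B)) * cis (Real.pi / 4) A := by
  have h : A * B * A = -B := by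
    rw [hAB, neg_mul, mul_assoc, hA, mul_one]
  have h2 : (Real.sin (Real.pi / 4) : ℂ) = Real.cos (Real.pi / 4) := by
    rw [Real.sin_pi_div_four, Real.cos_pi_div_four]
  have h3 := Complex.I_mul_I
  simp only [cis, add_mul, mul_add, smul_mul_assoc, mul_smul_comm, one_mul, mul_one, h, h2]
  rw [add_comm]
  congr 1
  · rw [smul_smul, mul_comm]
  · rw [smul_neg, smul_neg, smul_smul, ← neg_smul]
    congr 1
    linear_combination (Real.cos (Real.pi / 4) : ℂ) * h3

end Involutions

/-- The spectral projections `(1 ± A) / 2` define a continuous algebra homomorphism from `ℂ × ℂ`. It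
commutes with `exp`, so the claim reduces to Euler's formula in each coordinate. -/
theorem exp_eq_cis {ι : Type*} [Fintype ι] [DecidableEq ι] {A : Matrix ι ι ℂ} (hA : A * A = 1)
    (θ : ℝ) : NormedSpace.exp ((Complex.I * (θ : ℂ)) • A) = cis θ A := by
  let f : ℂ × ℂ →ₐ[ℂ] Matrix ι ι ℂ := AlgHom.ofLinearMap
    { toFun := fun z => z.1 • ((1 / 2 : ℂ) • (1 + A)) + z.2 • ((1 / 2 : ℂ) • (1 - A))
      map_add' := fun x y => by simp only [Prod.fst_add, Prod.snd_add]; module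
      map_smul' := fun c x => by
        simp only [Prod.smul_fst, Prod.smul_snd, RingHom.id_apply, smul_eq_mul]; module }
    (by simp only [LinearMap.coe_mk, AddHom.coe_mk, Prod.fst_one, Prod.snd_one]; module)
    (fun x y => by
      have h1 : (1 + A) * (1 + A) = (2 : ℂ) • (1 + A) := by
        simp only [add_mul, mul_add, hA, mul_one, one_mul]; module
      have h2 : (1 - A) * (1 - A) = (2 : ℂ) • (1 - A) := by
        simp only [sub_mul, mul_sub, hA, mul_one, one_mul]; module
      have h3 : (1 + A) * (1 - A) = 0 := by
        simp only [add_mul, mul_sub, hA, mul_one, one_mul]; abel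
      have h4 : (1 - A) * (1 + A) = 0 := by
        simp only [sub_mul, mul_add, hA, mul_one, one_mul]; abel
      simp only [LinearMap.coe_mk, AddHom.coe_mk, Prod.fst_mul, Prod.snd_mul, add_mul (_ • _),
        mul_add (_ • _), smul_mul_smul_comm, h1, h2, h3, h4]
      module)
  have hf : Continuous f := by
    change Continuous fun z : ℂ × ℂ =>
      z.1 • ((1 / 2 : ℂ) • (1 + A)) + z.2 • ((1 / 2 : ℂ) • (1 - A))
    fun_prop
  have hz : f (Complex.I * θ, -(Complex.I * θ)) = (Complex.I * (θ : ℂ)) • A := by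
    change (Complex.I * (θ : ℂ)) • ((1 / 2 : ℂ) • (1 + A))
      + (-(Complex.I * (θ : ℂ))) • ((1 / 2 : ℂ) • (1 - A)) = _
    module
  rw [← hz, ← NormedSpace.map_exp f hf]
  have h1 : NormedSpace.exp ((Complex.I * θ, -(Complex.I * θ)) : ℂ × ℂ)
      = (Real.cos θ + Complex.I * Real.sin θ, Real.cos θ - Complex.I * Real.sin θ) := by
    ext1
    · rw [Prod.fst_exp, ← Complex.exp_eq_exp_ℂ, mul_comm, Complex.exp_mul_I]
      push_cast; ring
    · rw [Prod.snd_exp, ← Complex.exp_eq_exp_ℂ]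
      change Complex.exp (-(Complex.I * θ)) = Real.cos θ - Complex.I * Real.sin θ
      rw [← mul_neg, mul_comm, Complex.exp_mul_I, Complex.cos_neg, Complex.sin_neg]
      push_cast; ring
  rw [h1]
  change (_ : ℂ) • ((1 / 2 : ℂ) • (1 + A)) + (_ : ℂ) • ((1 / 2 : ℂ) • (1 - A)) = _
  simp only [cis]
  module

/-! ### One-qubit matrices -/

theorem sigmaX_mul_self : sigmaX * sigmaX = 1 := by
  simp [sigmaX, Matrix.one_fin_two]

theorem sigmaY_mul_self : sigmaY * sigmaY = 1 := by
  simp [sigmaY, Matrix.one_fin_two]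

theorem sigmaZ_mul_self : sigmaZ * sigmaZ = 1 := by
  simp [sigmaZ, Matrix.one_fin_two]

theorem sigmaX_mul_sigmaZ : sigmaX * sigmaZ = -(sigmaZ * sigmaX) := by
  simp [sigmaZ, sigmaX]

theorem sigmaZ_mul_sigmaX : sigmaZ * sigmaX = Complex.I • sigmaY := by
  simp [sigmaZ, sigmaX, sigmaY]

theorem sigmaX_mul_sigmaY : sigmaX * sigmaY = Complex.I • sigmaZ := by
  simp [sigmaZ, sigmaX, sigmaY]

theorem sigmaY_mul_sigmaX : sigmaY * sigmaX = -(Complex.I • sigmaZ) := by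
  simp [sigmaZ, sigmaX, sigmaY]

theorem sigmaX_conjTranspose : sigmaXᴴ = sigmaX := by
  ext i j; fin_cases i <;> fin_cases j <;> simp [sigmaX]

theorem sigmaY_conjTranspose : sigmaYᴴ = sigmaY := by
  ext i j; fin_cases i <;> fin_cases j <;> simp [sigmaY]

theorem sigmaZ_conjTranspose : sigmaZᴴ = sigmaZ := by
  ext i j; fin_cases i <;> fin_cases j <;> simp [sigmaZ]

theorem sqrt_two_inv_sq : ((1 / Real.sqrt 2 : ℝ) : ℂ) * ((1 / Real.sqrt 2 : ℝ) : ℂ) = 1 / 2 := by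
  rw [← Complex.ofReal_mul, div_mul_div_comm, Real.mul_self_sqrt (by norm_num)]
  norm_num

theorem hGate_mul_self : hGate * hGate = 1 := by
  rw [hGate, smul_mul_smul_comm, sqrt_two_inv_sq, add_mul, mul_add, mul_add, sigmaX_mul_self,
    sigmaZ_mul_self, sigmaX_mul_sigmaZ]
  module

theorem hGate_mul_sigmaX : hGate * sigmaX = sigmaZ * hGate := by
  rw [hGate, smul_mul_assoc, mul_smul_comm, add_mul, mul_add, sigmaX_mul_self, sigmaZ_mul_self,
    add_comm]

theorem hGate_mul_sigmaZ : hGate * sigmaZ = sigmaX * hGate := by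
  rw [hGate, smul_mul_assoc, mul_smul_comm, add_mul, mul_add, sigmaX_mul_self, sigmaZ_mul_self,
    add_comm]

theorem rot_eq_cis {σ : Matrix (Fin 2) (Fin 2) ℂ} (hσ : σ * σ = 1) (θ : ℝ) :
    rot σ θ = cis (θ / 2) σ := exp_eq_cis hσ _

theorem hadPulse_eq : hadPulse = Complex.I • hGate := by
  rw [← cis_pi_div_two, ← exp_eq_cis hGate_mul_self, hadPulse, hGate, smul_smul, mul_assoc,
    ← Complex.ofReal_mul]
  congr 5
  field_simp

/-- An Euler decomposition: `X` moved through a `Z` rotation reverses its angle, so the outer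
rotations cancel on the `X` term and add up to `i Z` on the identity term. -/
theorem hGate_eq_cis :
    Complex.I • hGate = cis (Real.pi / 4) sigmaZ * cis (Real.pi / 4) sigmaX *
      cis (Real.pi / 4) sigmaZ := by
  have h : cis (Real.pi / 4) sigmaZ * sigmaX = sigmaX * cis (-(Real.pi / 4)) sigmaZ := by
    rw [← cis_neg_right]
    refine (mul_cis ?_ _).symm
    rw [mul_neg, sigmaX_mul_sigmaZ, neg_neg]
  have h2 : (Real.sin (Real.pi / 4) : ℂ) = ((1 / Real.sqrt 2 : ℝ) : ℂ) := by
    rw [Real.sin_pi_div_four]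
    norm_cast
    field_simp
    norm_num
  have h3 : (Real.cos (Real.pi / 4) : ℂ) = ((1 / Real.sqrt 2 : ℝ) : ℂ) := by
    rw [Real.cos_pi_div_four, ← h2, Real.sin_pi_div_four]
  conv_rhs => rw [cis.eq_1 (Real.pi / 4) sigmaX]
  rw [mul_add, mul_smul_comm, mul_smul_comm, mul_one, h, add_mul, smul_mul_assoc,
    smul_mul_assoc, mul_assoc, cis_neg_mul_cis sigmaZ_mul_self, mul_one,
    cis_mul sigmaZ_mul_self, h2, h3]
  rw [show Real.pi / 4 + Real.pi / 4 = Real.pi / 2 by ring, cis_pi_div_two, hGate]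
  module

theorem tGate_eq_cis :
    Complex.exp (Complex.I * ((-(Real.pi / 8) : ℝ) : ℂ)) • tGate = cis (-(Real.pi / 8)) sigmaZ := by
  have h1 : Complex.exp (Complex.I * ((-(Real.pi / 8) : ℝ) : ℂ))
      = Real.cos (-(Real.pi / 8)) + Complex.I * Real.sin (-(Real.pi / 8)) := by
    rw [mul_comm, Complex.exp_mul_I, mul_comm Complex.I, Complex.ofReal_cos, Complex.ofReal_sin]
  have h2 : Complex.exp (Complex.I * ((-(Real.pi / 8) : ℝ) : ℂ)) *
      Complex.exp (Complex.I * ((Real.pi / 4 : ℝ) : ℂ))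
      = Real.cos (-(Real.pi / 8)) - Complex.I * Real.sin (-(Real.pi / 8)) := by
    rw [← Complex.exp_add, ← mul_add, ← Complex.ofReal_add, mul_comm,
      show -(Real.pi / 8) + Real.pi / 4 = Real.pi / 8 by ring, Complex.exp_mul_I,
      Real.cos_neg, Real.sin_neg, Complex.ofReal_cos, Complex.ofReal_neg, Complex.ofReal_sin]
    ring
  ext i j
  rw [Matrix.smul_apply, smul_eq_mul]
  fin_cases i <;> fin_cases j
  · change _ * (1 : ℂ) = _ * (1 : ℂ) + _ * (1 : ℂ)
    rw [mul_one, mul_one, mul_one, h1]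
  · change _ * (0 : ℂ) = _ * (0 : ℂ) + _ * (0 : ℂ)
    ring
  · change _ * (0 : ℂ) = _ * (0 : ℂ) + _ * (0 : ℂ)
    ring
  · change _ * _ = _ * (1 : ℂ) + _ * (-1 : ℂ)
    rw [mul_one, mul_neg_one, ← sub_eq_add_neg]
    exact h2

theorem cphase_apply (a b : Fin 2 × Fin 2) :
    cphase a b = if a = b then (if a = (1, 1) then -1 else 1) else 0 := by
  have h : (Complex.I * ((Real.pi : ℝ) : ℂ)) •
      Matrix.single ((1 : Fin 2), (1 : Fin 2)) (1, 1) (1 : ℂ)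
      = diagonal (fun a => if a = (1, 1) then Complex.I * Real.pi else 0) := by
    ext a b
    simp only [Matrix.smul_apply, Matrix.single_apply, diagonal_apply, smul_eq_mul]
    by_cases ha : a = (1, 1) <;> by_cases hab : a = b
    · subst hab; simp [ha]
    · have : ¬ ((1, 1) = a ∧ (1, 1) = b) := fun h => hab (h.1.symm.trans h.2)
      simp [this, hab]
    · have : ¬ ((1, 1) = a ∧ (1, 1) = b) := fun h => ha h.1.symm
      simp [this, ha]
    · simp [hab, Ne.symm ha]
  rw [cphase, h, Matrix.exp_diagonal, diagonal_apply]
  congr 1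
  rw [Pi.coe_exp, ← Complex.exp_eq_exp_ℂ]
  split_ifs
  · rw [mul_comm, Complex.exp_pi_mul_I]
  · simp

/-! ### Product operators -/

/-- The tensor product of one-qubit operators, as a multiplicative homomorphism. -/
def tens {N : ℕ} : (Fin N → Matrix (Fin 2) (Fin 2) ℂ) →* Op N where
  toFun f := fun s t => ∏ j, f j (s j) (t j)
  map_one' := by
    ext s t
    simp only [Pi.one_apply, Matrix.one_apply, Finset.prod_ite_zero, Finset.prod_const_one,
      Finset.mem_univ, true_imp_iff, funext_iff]
  map_mul' f g := by
    ext s t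
    change ∏ j, (f j * g j) (s j) (t j)
      = ∑ u : Config N, (∏ j, f j (s j) (u j)) * ∏ j, g j (u j) (t j)
    simp only [Matrix.mul_apply, ← Finset.prod_mul_distrib]
    rw [Finset.prod_univ_sum, Fintype.piFinset_univ]

theorem tens_apply {N : ℕ} (f : Fin N → Matrix (Fin 2) (Fin 2) ℂ) (s t : Config N) :
    tens f s t = ∏ j, f j (s j) (t j) := rfl

theorem tens_conjTranspose {N : ℕ} (f : Fin N → Matrix (Fin 2) (Fin 2) ℂ) :
    (tens f)ᴴ = tens fun j => (f j)ᴴ := by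
  ext s t
  simp [tens_apply, conjTranspose_apply]

theorem tens_smul {N : ℕ} (c : Fin N → ℂ) (f : Fin N → Matrix (Fin 2) (Fin 2) ℂ) :
    tens (fun j => c j • f j) = (∏ j, c j) • tens f := by
  ext s t
  simp [tens_apply, Finset.prod_mul_distrib]

theorem onSite_eq_tens {N : ℕ} (j : Fin N) (A : Matrix (Fin 2) (Fin 2) ℂ) :
    onSite j A = tens (Pi.mulSingle j A) := by
  ext s t
  rw [tens_apply, ← Finset.mul_prod_erase _ _ (Finset.mem_univ j), Pi.mulSingle_eq_same, onSite]
  have : ∏ x ∈ Finset.univ.erase j, (Pi.mulSingle j A : Fin N → Matrix (Fin 2) (Fin 2) ℂ) x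
      (s x) (t x) = ∏ x ∈ Finset.univ.erase j, if s x = t x then (1 : ℂ) else 0 := by
    refine Finset.prod_congr rfl fun x hx => ?_
    rw [Pi.mulSingle_eq_of_ne (Finset.ne_of_mem_erase hx), Matrix.one_apply]
  rw [this, Finset.prod_ite_zero]
  simp only [Finset.mem_erase, Finset.mem_univ, and_true, Finset.prod_const_one, mul_ite, mul_one,
    mul_zero]

theorem onSite_mul {N : ℕ} (j : Fin N) (A B : Matrix (Fin 2) (Fin 2) ℂ) :
    onSite j A * onSite j B = onSite j (A * B) := by
  rw [onSite_eq_tens, onSite_eq_tens, onSite_eq_tens, ← map_mul, Pi.mulSingle_mul]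

theorem onSite_one {N : ℕ} (j : Fin N) : onSite j 1 = 1 := by
  rw [onSite_eq_tens, Pi.mulSingle_one, map_one]

theorem onSite_commute {N : ℕ} {i j : Fin N} (h : i ≠ j) (A B : Matrix (Fin 2) (Fin 2) ℂ) :
    Commute (onSite i A) (onSite j B) := by
  have h1 : Commute (Pi.mulSingle i A : Fin N → Matrix (Fin 2) (Fin 2) ℂ) (Pi.mulSingle j B) :=
    Pi.mulSingle_commute (f := fun _ : Fin N => Matrix (Fin 2) (Fin 2) ℂ) h A B
  rw [onSite_eq_tens, onSite_eq_tens, commute_iff_eq, ← map_mul, ← map_mul, h1.eq]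

theorem onSite_add {N : ℕ} (j : Fin N) (A B : Matrix (Fin 2) (Fin 2) ℂ) :
    onSite j (A + B) = onSite j A + onSite j B := by
  ext s t
  simp only [onSite, Matrix.add_apply]
  split_ifs <;> simp

theorem onSite_smul {N : ℕ} (j : Fin N) (c : ℂ) (A : Matrix (Fin 2) (Fin 2) ℂ) :
    onSite j (c • A) = c • onSite j A := by
  ext s t
  simp only [onSite, Matrix.smul_apply]
  split_ifs <;> simp

theorem onSite_conjTranspose {N : ℕ} (j : Fin N) (A : Matrix (Fin 2) (Fin 2) ℂ) :
    (onSite j A)ᴴ = onSite j Aᴴ := by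
  ext s t
  simp only [onSite, conjTranspose_apply, eq_comm (a := t _)]
  split_ifs <;> simp

/-- A one-qubit operator on a given site, as a homomorphism of star algebras. -/
def siteHom {N : ℕ} (j : Fin N) : Matrix (Fin 2) (Fin 2) ℂ →⋆ₐ[ℂ] Op N where
  toFun := onSite j
  map_one' := onSite_one j
  map_mul' A B := (onSite_mul j A B).symm
  map_zero' := by simpa using onSite_smul j 0 0
  map_add' := onSite_add j
  commutes' c := by
    rw [Algebra.algebraMap_eq_smul_one, Algebra.algebraMap_eq_smul_one, onSite_smul, onSite_one]
  map_star' A := (onSite_conjTranspose j A).symm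

theorem siteHom_apply {N : ℕ} (j : Fin N) (A : Matrix (Fin 2) (Fin 2) ℂ) :
    siteHom j A = onSite j A := rfl

theorem onSite_cis {N : ℕ} (j : Fin N) (θ : ℝ) (A : Matrix (Fin 2) (Fin 2) ℂ) :
    onSite j (cis θ A) = cis θ (onSite j A) :=
  map_cis (siteHom j).toAlgHom θ A

theorem onSite_neg {N : ℕ} (j : Fin N) (A : Matrix (Fin 2) (Fin 2) ℂ) :
    onSite j (-A) = -onSite j A := map_neg (siteHom j) A

theorem norm_onSite_le {N : ℕ} (j : Fin N) (A : Matrix (Fin 2) (Fin 2) ℂ) :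
    ‖onSite j A‖ ≤ ‖A‖ :=
  NonUnitalStarAlgHom.norm_apply_le (siteHom j) A

/-- Each coordinate sees a single nontrivial factor, so the order is immaterial although `M` need
not be commutative. The induction runs over duplicate-free lists. -/
theorem ofFn_prod_mulSingle {N : ℕ} {M : Type*} [Monoid M] (f : Fin N → M) :
    (List.ofFn fun j => (Pi.mulSingle j (f j) : Fin N → M)).prod = f := by
  ext k
  have h : ∀ l : List (Fin N), l.Nodup →
      ((l.map fun j => (Pi.mulSingle j (f j) : Fin N → M)).prod) k
        = if k ∈ l then f k else 1 := by
    intro l hl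
    induction l with
    | nil => simp
    | cons a l ih =>
      rw [List.nodup_cons] at hl
      rw [List.map_cons, List.prod_cons, Pi.mul_apply, ih hl.2]
      by_cases hka : k = a
      · subst hka
        simp [hl.1]
      · rw [Pi.mulSingle_eq_of_ne hka, one_mul]
        simp [hka]
  have h2 := h (List.finRange N) (List.nodup_finRange N)
  rw [List.ofFn_eq_map, h2]
  simp

theorem ofFn_prod_onSite {N : ℕ} (f : Fin N → Matrix (Fin 2) (Fin 2) ℂ) :
    (List.ofFn fun j => onSite j (f j)).prod = tens f := by
  conv_rhs => rw [← ofFn_prod_mulSingle f]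
  rw [map_list_prod, List.map_ofFn]
  congr 2
  ext1 j
  exact onSite_eq_tens j (f j)

theorem uniform_eq_tens (N : ℕ) (A : Matrix (Fin 2) (Fin 2) ℂ) :
    uniform N A = tens fun _ => A := ofFn_prod_onSite _

theorem uniform_mul (N : ℕ) (A B : Matrix (Fin 2) (Fin 2) ℂ) :
    uniform N A * uniform N B = uniform N (A * B) := by
  rw [uniform_eq_tens, uniform_eq_tens, uniform_eq_tens, ← map_mul]
  rfl

theorem uniform_one (N : ℕ) : uniform N 1 = 1 := by
  rw [uniform_eq_tens]
  exact map_one tens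

theorem uniform_smul (N : ℕ) (c : ℂ) (A : Matrix (Fin 2) (Fin 2) ℂ) :
    uniform N (c • A) = c ^ N • uniform N A := by
  rw [uniform_eq_tens, uniform_eq_tens, tens_smul]
  simp

theorem uniform_mul_onSite {N : ℕ} {A B B' : Matrix (Fin 2) (Fin 2) ℂ} (h : A * B = B' * A)
    (j : Fin N) : uniform N A * onSite j B = onSite j B' * uniform N A := by
  rw [uniform_eq_tens, onSite_eq_tens, onSite_eq_tens, ← map_mul, ← map_mul]
  congr 1
  ext1 k
  by_cases hk : k = j
  · subst hk; simpa using h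
  · simp [Pi.mulSingle_eq_of_ne hk]

/-! ### Two-qubit operators -/

/-- With linearity of `onPair`, this reduces every two-qubit gate to a polynomial in one-site Pauli
operators. -/
theorem onPair_kronecker {N : ℕ} {i j : Fin N} (h : i ≠ j) (A B : Matrix (Fin 2) (Fin 2) ℂ) :
    onPair i j (kronecker A B) = onSite i A * onSite j B := by
  ext s t
  rw [onSite_eq_tens, onSite_eq_tens, ← map_mul, tens_apply,
    ← Finset.mul_prod_erase _ _ (Finset.mem_univ i),
    ← Finset.mul_prod_erase _ _ (Finset.mem_erase.2 ⟨h.symm, Finset.mem_univ j⟩), onPair]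
  have : ∏ x ∈ (Finset.univ.erase i).erase j,
      ((Pi.mulSingle i A : Fin N → Matrix (Fin 2) (Fin 2) ℂ) *
        (Pi.mulSingle j B : Fin N → Matrix (Fin 2) (Fin 2) ℂ)) x (s x) (t x)
      = ∏ x ∈ (Finset.univ.erase i).erase j, if s x = t x then (1 : ℂ) else 0 := by
    refine Finset.prod_congr rfl fun x hx => ?_
    rw [Finset.mem_erase, Finset.mem_erase] at hx
    rw [Pi.mul_apply, Pi.mulSingle_eq_of_ne hx.1, Pi.mulSingle_eq_of_ne hx.2.1, mul_one,
      Matrix.one_apply]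
  rw [this, Finset.prod_ite_zero]
  have h1 : (∀ x ∈ (Finset.univ.erase i).erase j, s x = t x) ↔ ∀ l, l ≠ i → l ≠ j → s l = t l := by
    simp only [Finset.mem_erase, Finset.mem_univ, and_true]
    exact ⟨fun h l hi hj => h l ⟨hj, hi⟩, fun h l hl => h l hl.2 hl.1⟩
  simp only [h1, Pi.mul_apply, Pi.mulSingle_eq_same, Pi.mulSingle_eq_of_ne h,
    Pi.mulSingle_eq_of_ne h.symm, mul_one, one_mul, Finset.prod_const_one]
  split_ifs
  · simp [kronecker]
  · simp

theorem onPair_add {N : ℕ} (i j : Fin N) (A B : Matrix (Fin 2 × Fin 2) (Fin 2 × Fin 2) ℂ) :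
    onPair i j (A + B) = onPair i j A + onPair i j B := by
  ext s t
  simp only [onPair, Matrix.add_apply]
  split_ifs <;> simp

theorem onPair_smul {N : ℕ} (i j : Fin N) (c : ℂ)
    (A : Matrix (Fin 2 × Fin 2) (Fin 2 × Fin 2) ℂ) :
    onPair i j (c • A) = c • onPair i j A := by
  ext s t
  simp only [onPair, Matrix.smul_apply]
  split_ifs <;> simp

/-- The Pauli operators on a register. -/
abbrev opX {N : ℕ} (j : Fin N) : Op N := onSite j sigmaX
abbrev opZ {N : ℕ} (j : Fin N) : Op N := onSite j sigmaZ

theorem opX_mul_self {N : ℕ} (j : Fin N) : opX j * opX j = 1 := by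
  rw [onSite_mul, sigmaX_mul_self, onSite_one]

theorem opZ_mul_self {N : ℕ} (j : Fin N) : opZ j * opZ j = 1 := by
  rw [onSite_mul, sigmaZ_mul_self, onSite_one]

theorem opX_mul_opZ {N : ℕ} (j : Fin N) : opX j * opZ j = -(opZ j * opX j) := by
  rw [onSite_mul, sigmaX_mul_sigmaZ, onSite_neg, onSite_mul]

theorem mul_self_of_commute {R : Type*} [Ring R] {A B : R} (hA : A * A = 1) (hB : B * B = 1)
    (h : Commute A B) : A * B * (A * B) = 1 := by
  rw [h.symm.mul_mul_mul_comm, hA, hB, one_mul]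

theorem opZ_mul_opX_mul_self {N : ℕ} {i j : Fin N} (h : i ≠ j) :
    opZ i * opX j * (opZ i * opX j) = 1 :=
  mul_self_of_commute (opZ_mul_self i) (opX_mul_self j) (onSite_commute h _ _)

theorem onPair_entangler {N : ℕ} {i j : Fin N} (h : i ≠ j) (α : ℝ) :
    onPair i j (entangler α) = cis α (opZ i * opX j) := by
  have h1 : kronecker sigmaZ sigmaX * kronecker sigmaZ sigmaX = 1 := by
    rw [kronecker, ← mul_kronecker_mul, sigmaZ_mul_self, sigmaX_mul_self, one_kronecker_one]
  have h2 : (1 : Matrix (Fin 2 × Fin 2) (Fin 2 × Fin 2) ℂ) = kronecker 1 1 :=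
    one_kronecker_one.symm
  rw [entangler, exp_eq_cis h1, cis, onPair_add, onPair_smul, onPair_smul, onPair_kronecker h, h2,
    onPair_kronecker h, onSite_one, onSite_one, one_mul, cis]

/-- The controlled-NOT gate as a polynomial in Pauli operators. -/
def cnotOp {N : ℕ} (i j : Fin N) : Op N :=
  (1 / 2 : ℂ) • (1 + opZ i + opX j - opZ i * opX j)

theorem onPair_cnot {N : ℕ} {i j : Fin N} (h : i ≠ j) : onPair i j cnot = cnotOp i j := by
  -- Expansion of `(1 + Z)/2 ⊗ 1 + (1 - Z)/2 ⊗ X`.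
  have h1 : cnot = (1 / 2 : ℂ) • kronecker 1 1 + (1 / 2 : ℂ) • kronecker sigmaZ 1
      + (1 / 2 : ℂ) • kronecker 1 sigmaX + (-(1 / 2) : ℂ) • kronecker sigmaZ sigmaX := by
    ext ⟨a, b⟩ ⟨c, d⟩
    fin_cases a <;> fin_cases b <;> fin_cases c <;> fin_cases d <;>
      norm_num [cnot, kronecker, sigmaZ, sigmaX]
    decide
  rw [h1, onPair_add, onPair_add, onPair_add, onPair_smul, onPair_smul, onPair_smul, onPair_smul,
    onPair_kronecker h, onPair_kronecker h, onPair_kronecker h, onPair_kronecker h, onSite_one,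
    onSite_one, cnotOp, one_mul, one_mul, mul_one]
  module

/-- The phase relating CNOT and its Pauli rotations. -/
theorem cnotOp_eq_cis {N : ℕ} {i j : Fin N} (h : i ≠ j) :
    Complex.exp (-(Real.pi / 4 : ℝ) * Complex.I) • cnotOp i j =
      cis (-(Real.pi / 4)) (opZ i) * cis (-(Real.pi / 4)) (opX j) *
        cis (Real.pi / 4) (opZ i * opX j) := by
  -- `(1 - Z)(1 - X)/4` is a projection, and CNOT is the exponential of `iπ` times it. The constant
  -- term of the exponent is the phase, the other three terms are the rotations.
  have hc : Commute (opZ i) (opX j) := onSite_commute h _ _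
  have hz := opZ_mul_self i
  have hx := opX_mul_self j
  have h2 : (Real.sin (Real.pi / 4) : ℂ) = ((1 / Real.sqrt 2 : ℝ) : ℂ) := by
    rw [Real.sin_pi_div_four]
    norm_cast
    field_simp
    norm_num
  have h3 : (Real.cos (Real.pi / 4) : ℂ) = ((1 / Real.sqrt 2 : ℝ) : ℂ) := by
    rw [Real.cos_pi_div_four, ← h2, Real.sin_pi_div_four]
  have h4 : Complex.exp (-(Real.pi / 4 : ℝ) * Complex.I)
      = ((1 / Real.sqrt 2 : ℝ) : ℂ) * (1 - Complex.I) := by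
    rw [← Complex.ofReal_neg, Complex.exp_mul_I, ← Complex.ofReal_cos, ← Complex.ofReal_sin, Real.cos_neg, Real.sin_neg,
      Complex.ofReal_neg, h2, h3]
    ring
  have hr := sqrt_two_inv_sq
  set r : ℂ := ((1 / Real.sqrt 2 : ℝ) : ℂ)
  set P := opZ i
  set Q := opX j
  have hQP : Q * P = P * Q := hc.eq.symm
  have e1 : P * Q * P = Q := by rw [mul_assoc, hQP, ← mul_assoc, hz, one_mul]
  have e2 : P * (P * Q) = Q := by rw [← mul_assoc, hz, one_mul]
  have e3 : Q * (P * Q) = P := by rw [hc.eq, ← mul_assoc, hx, one_mul]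
  have e4 : P * Q * (P * Q) = 1 := mul_self_of_commute hz hx hc
  have hi := Complex.I_mul_I
  simp only [cis, Real.cos_neg, Real.sin_neg, Complex.ofReal_neg, h2, h3, h4, cnotOp]
  simp only [add_mul, mul_add, smul_mul_smul_comm, one_mul, mul_one, e2, e3, e4, smul_add, smul_sub,
    smul_smul]
  have c1 : r * r * r = r * (1 / 2) := by rw [← hr]; ring
  match_scalars
  all_goals grind

/-! ### Logical operators -/

/-- The position of a logical qubit in the first half of the chain. -/
def leftPos {n : ℕ} (j : Fin n) : Fin (2 * n) := Fin.castLE (by omega) j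

/-- The position of a logical qubit in the second half of the chain. -/
def rightPos {n : ℕ} (j : Fin n) : Fin (2 * n) := Fin.rev (Fin.castLE (by omega) j)

theorem leftPos_val {n : ℕ} (j : Fin n) : (leftPos j).1 = j.1 := rfl

theorem rightPos_val {n : ℕ} (j : Fin n) : (rightPos j).1 = 2 * n - (j.1 + 1) := rfl

theorem leftPos_injective {n : ℕ} : Function.Injective (leftPos (n := n)) :=
  Fin.castLE_injective (by omega)

theorem rightPos_injective {n : ℕ} : Function.Injective (rightPos (n := n)) :=
  Fin.rev_injective.comp (Fin.castLE_injective (by omega))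

theorem leftPos_ne_rightPos {n : ℕ} (i j : Fin n) : leftPos i ≠ rightPos j := by
  intro h
  have := congrArg Fin.val h
  rw [leftPos_val, rightPos_val] at this
  omega

theorem halves_bijective (n : ℕ) :
    Function.Bijective (Sum.elim leftPos rightPos : Fin n ⊕ Fin n → Fin (2 * n)) := by
  rw [Fintype.bijective_iff_injective_and_card]
  refine ⟨?_, by simp [two_mul]⟩
  rintro (a | a) (b | b) h
  · exact congrArg _ (leftPos_injective h)
  · exact absurd h (leftPos_ne_rightPos a b)
  · exact absurd h.symm (leftPos_ne_rightPos b a)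
  · exact congrArg _ (rightPos_injective h)

/-- A configuration of the chain as a pair of logical configurations. -/
def halves (n : ℕ) : Config (2 * n) ≃ Config n × Config n :=
  (Equiv.arrowCongr (Equiv.ofBijective _ (halves_bijective n)).symm (Equiv.refl _)).trans
    (Equiv.sumArrowEquivProdArrow _ _ _)

theorem halves_apply {n : ℕ} (s : Config (2 * n)) : halves n s = (leftHalf s, rightHalf s) := rfl

/-- An operator acting on the first half of the chain. -/
def leftHom (n : ℕ) : Op n →⋆ₐ[ℂ] Op (2 * n) where
  toFun U := (kronecker U 1).submatrix (halves n) (halves n)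
  map_one' := by
    rw [kronecker, kroneckerMap_one_one _ (by simp) (by simp) (by simp), submatrix_one_equiv]
  map_mul' A B := by
    rw [submatrix_mul_equiv, kronecker, ← mul_kronecker_mul, one_mul]
  map_zero' := by simp [kronecker]
  map_add' A B := by rw [kronecker, add_kronecker]; rfl
  commutes' c := by
    rw [Algebra.algebraMap_eq_smul_one, Algebra.algebraMap_eq_smul_one, kronecker, smul_kronecker,
      one_kronecker_one, submatrix_smul]
    change c • (1 : Matrix _ _ ℂ).submatrix (halves n) (halves n) = _
    rw [submatrix_one_equiv]
  map_star' A := by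
    rw [star_eq_conjTranspose, star_eq_conjTranspose, conjTranspose_submatrix, kronecker,
      conjTranspose_kronecker, conjTranspose_one]

/-- An operator acting on the second half of the chain, in reversed order. -/
def rightHom (n : ℕ) : Op n →⋆ₐ[ℂ] Op (2 * n) where
  toFun U := (kronecker 1 U).submatrix (halves n) (halves n)
  map_one' := by
    rw [kronecker, kroneckerMap_one_one _ (by simp) (by simp) (by simp), submatrix_one_equiv]
  map_mul' A B := by
    rw [submatrix_mul_equiv, kronecker, ← mul_kronecker_mul, one_mul]
  map_zero' := by simp [kronecker]
  map_add' A B := by rw [kronecker, kronecker_add]; rfl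
  commutes' c := by
    rw [Algebra.algebraMap_eq_smul_one, Algebra.algebraMap_eq_smul_one, kronecker, kronecker_smul,
      one_kronecker_one, submatrix_smul]
    change c • (1 : Matrix _ _ ℂ).submatrix (halves n) (halves n) = _
    rw [submatrix_one_equiv]
  map_star' A := by
    rw [star_eq_conjTranspose, star_eq_conjTranspose, conjTranspose_submatrix, kronecker,
      conjTranspose_kronecker, conjTranspose_one]

theorem leftHom_apply {n : ℕ} (U : Op n) (s t : Config (2 * n)) :
    leftHom n U s t = U (leftHalf s) (leftHalf t) *
      (1 : Op n) (rightHalf s) (rightHalf t) := rfl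

theorem rightHom_apply {n : ℕ} (U : Op n) (s t : Config (2 * n)) :
    rightHom n U s t = (1 : Op n) (leftHalf s) (leftHalf t) *
      U (rightHalf s) (rightHalf t) := rfl

theorem leftHom_mul_rightHom {n : ℕ} (U V : Op n) :
    leftHom n U * rightHom n V = (kronecker U V).submatrix (halves n) (halves n) := by
  change (kronecker U 1).submatrix (halves n) (halves n) *
    (kronecker 1 V).submatrix (halves n) (halves n) = _
  rw [submatrix_mul_equiv, kronecker, ← mul_kronecker_mul, one_mul, mul_one]

theorem leftHom_commute_rightHom {n : ℕ} (U V : Op n) :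
    Commute (leftHom n U) (rightHom n V) := by
  rw [commute_iff_eq, leftHom_mul_rightHom]
  change _ = (kronecker 1 V).submatrix (halves n) (halves n) *
    (kronecker U 1).submatrix (halves n) (halves n)
  rw [submatrix_mul_equiv, kronecker, ← mul_kronecker_mul, one_mul, mul_one]

/-- The logical operator factors through two star homomorphisms with commuting images.
Multiplicativity and all norm estimates for the encoding come from this form. -/
theorem logical_eq {n : ℕ} (U : Op n) : logical U = leftHom n U * rightHom n U := by
  rw [leftHom_mul_rightHom]
  rfl

theorem logical_mul {n : ℕ} (U V : Op n) : logical (U * V) = logical U * logical V := by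
  rw [logical_eq, logical_eq, logical_eq, map_mul, map_mul,
    (leftHom_commute_rightHom V U).symm.mul_mul_mul_comm]

theorem logical_one {n : ℕ} : logical (1 : Op n) = 1 := by
  rw [logical_eq, map_one, map_one, one_mul]

theorem logical_smul {n : ℕ} (c : ℂ) (U : Op n) : logical (c • U) = c ^ 2 • logical U := by
  rw [logical_eq, logical_eq, map_smul, map_smul, smul_mul_smul_comm, sq]

/-! ### One-site operators on the two halves of the chain -/

theorem config_eq_off_left {n : ℕ} (j : Fin n) (s t : Config (2 * n)) :
    (∀ l, l ≠ leftPos j → s l = t l) ↔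
      (∀ l, l ≠ j → leftHalf s l = leftHalf t l) ∧ rightHalf s = rightHalf t := by
  constructor
  · intro h
    exact ⟨fun l hl => h _ (leftPos_injective.ne hl),
      funext fun l => h _ (leftPos_ne_rightPos j l).symm⟩
  · rintro ⟨h1, h2⟩ l hl
    obtain ⟨a | a, rfl⟩ := (halves_bijective n).2 l
    · exact h1 a fun h => hl (by rw [h]; rfl)
    · exact congrFun h2 a

theorem config_eq_off_right {n : ℕ} (j : Fin n) (s t : Config (2 * n)) :
    (∀ l, l ≠ rightPos j → s l = t l) ↔
      leftHalf s = leftHalf t ∧ ∀ l, l ≠ j → rightHalf s l = rightHalf t l := by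
  constructor
  · intro h
    exact ⟨funext fun l => h _ (leftPos_ne_rightPos l j),
      fun l hl => h _ (rightPos_injective.ne hl)⟩
  · rintro ⟨h1, h2⟩ l hl
    obtain ⟨a | a, rfl⟩ := (halves_bijective n).2 l
    · exact congrFun h1 a
    · exact h2 a fun h => hl (by rw [h]; rfl)

theorem leftHom_onSite {n : ℕ} (j : Fin n) (A : Matrix (Fin 2) (Fin 2) ℂ) :
    leftHom n (onSite j A) = onSite (leftPos j) A := by
  ext s t
  rw [leftHom_apply, onSite, onSite, Matrix.one_apply]
  simp only [config_eq_off_left, ite_and, mul_ite, mul_one, mul_zero]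
  split_ifs <;> rfl

theorem rightHom_onSite {n : ℕ} (j : Fin n) (A : Matrix (Fin 2) (Fin 2) ℂ) :
    rightHom n (onSite j A) = onSite (rightPos j) A := by
  ext s t
  rw [rightHom_apply, onSite, onSite, Matrix.one_apply]
  simp only [config_eq_off_right, ite_and, mul_ite, mul_zero, ite_mul, zero_mul, one_mul]
  split_ifs <;> rfl

theorem logical_uniform (n : ℕ) (A : Matrix (Fin 2) (Fin 2) ℂ) :
    logical (uniform n A) = uniform (2 * n) A := by
  ext s t
  rw [uniform_eq_tens, uniform_eq_tens, tens_apply,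
    ← Function.Bijective.prod_comp (halves_bijective n) fun j => A (s j) (t j),
    Fintype.prod_sum_type]
  rfl

theorem logical_cis {n : ℕ} (θ : ℝ) (P : Op n) :
    logical (cis θ P) = cis θ (leftHom n P) * cis θ (rightHom n P) := by
  rw [logical_eq]
  congr 1
  · exact map_cis (leftHom n).toAlgHom θ P
  · exact map_cis (rightHom n).toAlgHom θ P

theorem mulVec_encode {n : ℕ} (U : Op n) (ψ : Config n → ℂ) :
    logical U *ᵥ encode ψ = encode (U *ᵥ ψ) := by
  ext s
  simp only [mulVec, dotProduct, encode, logical]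
  rw [Finset.sum_mul_sum, ← Fintype.sum_prod_type', ← Equiv.sum_comp (halves n)]
  refine Finset.sum_congr rfl fun t _ => ?_
  rw [halves_apply]
  ring

/-! ### The controlled-phase evolution of Pauli operators -/

/-- The eigenvalue of `σ^z` on a bit. -/
def sgn (a : Fin 2) : ℂ := if a = 0 then 1 else -1

/-- The controlled phase of two bits. -/
def chi (a b : Fin 2) : ℂ := if (a, b) = (1, 1) then -1 else 1

theorem sgn_mul_self (a : Fin 2) : sgn a * sgn a = 1 := by
  fin_cases a <;> simp [sgn]

theorem chi_add_one_left (a b : Fin 2) : chi (a + 1) b = chi a b * sgn b := by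
  fin_cases a <;> fin_cases b <;> simp [chi, sgn]

theorem chi_add_one_right (a b : Fin 2) : chi a (b + 1) = chi a b * sgn a := by
  fin_cases a <;> fin_cases b <;> simp [chi, sgn]

theorem chi_flip (a b : Fin 2) : chi (a + 1) (b + 1) * chi a b = -(sgn a * sgn b) := by
  fin_cases a <;> fin_cases b <;> simp [chi, sgn]

theorem opZ_eq_diagonal {N : ℕ} (j : Fin N) : opZ j = diagonal fun s => sgn (s j) := by
  have h : sigmaZ = diagonal sgn := by
    ext a b
    fin_cases a <;> fin_cases b <;> simp [sigmaZ, sgn]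
  ext s t
  rw [diagonal_apply]
  by_cases hst : s = t
  · subst hst
    simp [onSite, h]
  · simp only [onSite, h, diagonal_apply, hst, if_false, ite_eq_right_iff]
    intro h1 h2
    refine absurd (funext fun l => ?_) hst
    by_cases hl : l = j
    · rw [hl, h2]
    · exact h1 l hl

theorem onPair_cphase {N : ℕ} (i j : Fin N) :
    onPair i j cphase = diagonal fun s => chi (s i) (s j) := by
  ext s t
  rw [diagonal_apply, onPair, cphase_apply]
  by_cases hst : s = t
  · subst hst
    simp [chi]
  · rw [if_neg hst]
    simp only [ite_eq_right_iff]
    intro h1 h2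
    rw [Prod.mk.injEq] at h2
    refine absurd (funext fun l => ?_) hst
    by_cases hl : l = i
    · rw [hl, h2.1]
    · by_cases hl' : l = j
      · rw [hl', h2.2]
      · exact h1 l hl hl'

/-- The diagonal of `CP_tot`. -/
def cpDiag (N : ℕ) (s : Config N) : ℂ :=
  ∏ i : Fin (N - 1), chi (s ⟨i.1, by omega⟩) (s ⟨i.1 + 1, by omega⟩)

theorem cpTot_eq (N : ℕ) : cpTot N = diagonal (cpDiag N) := by
  have h : cpTot N = (List.ofFn fun i : Fin (N - 1) => Matrix.diagonalRingHom (Config N) ℂ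
      fun s => chi (s ⟨i.1, by omega⟩) (s ⟨i.1 + 1, by omega⟩)).prod := by
    rw [cpTot]
    congr 2
    ext1 i
    exact onPair_cphase _ _
  have h2 := List.map_ofFn (n := N - 1) (f := fun i : Fin (N - 1) => fun s : Config N =>
    chi (s ⟨i.1, by omega⟩) (s ⟨i.1 + 1, by omega⟩)) (g := Matrix.diagonalRingHom (Config N) ℂ)
  rw [h]
  change (List.ofFn (Matrix.diagonalRingHom (Config N) ℂ ∘ _)).prod = _
  rw [← h2, ← map_list_prod, List.prod_ofFn]
  change diagonal _ = _
  congr 1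
  ext s
  rw [Finset.prod_apply]
  rfl

theorem cpDiag_mul_self (N : ℕ) (s : Config N) : cpDiag N s * cpDiag N s = 1 := by
  rw [cpDiag, ← Finset.prod_mul_distrib]
  refine Finset.prod_eq_one fun i _ => ?_
  rw [chi]
  split_ifs <;> norm_num

theorem cpTot_mul_self (N : ℕ) : cpTot N * cpTot N = 1 := by
  rw [cpTot_eq, diagonal_mul_diagonal, ← diagonal_one]
  congr 1
  ext s
  exact cpDiag_mul_self N s

theorem cpTot_commute_opZ {N : ℕ} (j : Fin N) : Commute (cpTot N) (opZ j) := by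
  rw [cpTot_eq, opZ_eq_diagonal]
  exact commute_diagonal _ _

/-- The product of `σ^z` over the neighbours of a site. -/
def nbOp {N : ℕ} (k : Fin N) : Op N :=
  diagonal fun s => (if h : k.1 + 1 < N then sgn (s ⟨k.1 + 1, h⟩) else 1) *
    if 1 ≤ k.1 then sgn (s ⟨k.1 - 1, by omega⟩) else 1

/-- Only the bonds touching `k` change, each by the `σ^z` sign of the other endpoint. At an end of
the chain one of the two bonds is missing. -/
theorem cpDiag_flip {N : ℕ} (k : Fin N) {s t : Config N} (h : ∀ l, l ≠ k → s l = t l)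
    (hk : s k = t k + 1) : cpDiag N s = ((if h : k.1 + 1 < N then sgn (t ⟨k.1 + 1, h⟩) else 1) *
    if 1 ≤ k.1 then sgn (t ⟨k.1 - 1, by omega⟩) else 1) * cpDiag N t := by
  have h1 : ∀ i : Fin (N - 1), chi (s ⟨i.1, by omega⟩) (s ⟨i.1 + 1, by omega⟩)
      = ((if i.1 = k.1 then sgn (t ⟨i.1 + 1, by omega⟩) else 1) *
        (if i.1 + 1 = k.1 then sgn (t ⟨i.1, by omega⟩) else 1)) *
        chi (t ⟨i.1, by omega⟩) (t ⟨i.1 + 1, by omega⟩) := by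
    intro i
    by_cases hi : i.1 = k.1
    · have e1 : (⟨i.1, by omega⟩ : Fin N) = k := Fin.ext hi
      rw [if_pos hi, if_neg (by omega), e1, hk, h ⟨i.1 + 1, by omega⟩ (by
        intro h; have := congrArg Fin.val h; simp at this; omega), chi_add_one_left]
      ring
    · rw [if_neg hi, h ⟨i.1, by omega⟩ (fun h => hi (congrArg Fin.val h))]
      by_cases hi' : i.1 + 1 = k.1
      · have e1 : (⟨i.1 + 1, by omega⟩ : Fin N) = k := Fin.ext hi'
        rw [if_pos hi', e1, hk, chi_add_one_right]
        ring
      · rw [if_neg hi', h ⟨i.1 + 1, by omega⟩ (fun h => hi' (congrArg Fin.val h))]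
        ring
  rw [cpDiag, Finset.prod_congr rfl fun i _ => h1 i, Finset.prod_mul_distrib,
    Finset.prod_mul_distrib]
  congr 2
  · by_cases hN : k.1 + 1 < N
    · rw [dif_pos hN, Finset.prod_eq_single ⟨k.1, by omega⟩]
      · simp
      · intro b _ hb
        rw [if_neg fun h => hb (Fin.ext h)]
      · simp
    · rw [dif_neg hN]
      refine Finset.prod_eq_one fun i _ => if_neg ?_
      have := i.2
      omega
  · by_cases hN : 1 ≤ k.1
    · have := k.2
      rw [if_pos hN, Finset.prod_eq_single ⟨k.1 - 1, by omega⟩]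
      · rw [if_pos (by change k.1 - 1 + 1 = k.1; omega)]
      · intro b _ hb
        refine if_neg fun h => hb (Fin.ext ?_)
        change b.1 = k.1 - 1
        omega
      · simp
    · rw [if_neg hN]
      refine Finset.prod_eq_one fun i _ => if_neg ?_
      omega

/-- The Heisenberg action of `cpTot` on `X`: a bit flip passed through the controlled phases leaves
the signs of `cpDiag_flip`. -/
theorem cpTot_mul_opX {N : ℕ} (k : Fin N) : cpTot N * opX k = nbOp k * opX k * cpTot N := by
  rw [cpTot_eq, nbOp]
  ext s t
  rw [diagonal_mul, mul_diagonal, diagonal_mul]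
  by_cases h : ∀ l, l ≠ k → s l = t l
  · by_cases hk : s k = t k + 1
    · rw [cpDiag_flip k h hk]
      have e1 : ∀ h' : k.1 + 1 < N, s ⟨k.1 + 1, h'⟩ = t ⟨k.1 + 1, h'⟩ := fun h' =>
        h _ fun h2 => by have := congrArg Fin.val h2; simp at this
      have e2 : 1 ≤ k.1 → s ⟨k.1 - 1, by omega⟩ = t ⟨k.1 - 1, by omega⟩ := fun h' =>
        h _ fun h2 => by have := congrArg Fin.val h2; simp at this; omega
      have e3 : (if 1 ≤ k.1 then sgn (s ⟨k.1 - 1, by omega⟩) else 1)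
          = if 1 ≤ k.1 then sgn (t ⟨k.1 - 1, by omega⟩) else 1 := by
        split_ifs with h'
        · rw [e2 h']
        · rfl
      simp only [e1, e3]
      ring
    · have : sigmaX (s k) (t k) = 0 := by
        generalize s k = a at hk
        generalize t k = b at hk
        revert hk
        fin_cases a <;> fin_cases b <;> simp [sigmaX]
      simp [onSite, this]
  · simp [onSite, h]

/-- The two alternatives, here and in `nbOp_of_mid`, serve the copy travelling from the left end and
its mirror image travelling from the right end. -/
theorem nbOp_of_end {N : ℕ} {k l : Fin N}
    (h : k.1 = 0 ∧ l.1 = 1 ∨ k.1 + 1 = N ∧ l.1 + 1 = k.1) : nbOp k = opZ l := by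
  rw [nbOp, opZ_eq_diagonal]
  congr 1
  ext s
  have hl := l.2
  rcases h with h | h
  · rw [dif_pos (by omega), if_neg (by omega), mul_one]
    congr 2
    ext
    change k.1 + 1 = l.1
    omega
  · rw [dif_neg (by omega), if_pos (by omega), one_mul]
    congr 2
    ext
    change k.1 - 1 = l.1
    omega

theorem nbOp_of_mid {N : ℕ} {a k b : Fin N}
    (h : a.1 + 1 = k.1 ∧ k.1 + 1 = b.1 ∨ b.1 + 1 = k.1 ∧ k.1 + 1 = a.1) :
    nbOp k = opZ a * opZ b := by
  rw [nbOp, opZ_eq_diagonal, opZ_eq_diagonal, diagonal_mul_diagonal]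
  congr 1
  ext s
  have ha := a.2
  have hb := b.2
  rw [dif_pos (by omega), if_pos (by omega)]
  rcases h with h | h
  · rw [mul_comm]
    congr 3 <;> ext <;> simp <;> omega
  · congr 3 <;> ext <;> simp <;> omega

theorem prod_telescope (f : ℕ → ℂ) (hf : ∀ i, f i * f i = 1) (m : ℕ) :
    ∏ i ∈ Finset.range m, f i * f (i + 1) = f 0 * f m := by
  induction m with
  | zero => simp [hf]
  | succ m ih =>
    rw [Finset.prod_range_succ, ih]
    linear_combination f 0 * f (m + 1) * hf m

/-- By `chi_flip` each bond contributes minus the product of the signs at its endpoints. Every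
interior sign occurs twice and cancels, so only the two ends and the `N - 1` minus signs survive. -/
theorem cpDiag_flip_all {N : ℕ} (s : Config N) (a b : Fin N) (ha : a.1 = 0) (hb : b.1 + 1 = N) :
    cpDiag N (fun j => s j + 1) * cpDiag N s = (-1) ^ (N - 1) * (sgn (s a) * sgn (s b)) := by
  let f : ℕ → ℂ := fun i => if h : i < N then sgn (s ⟨i, h⟩) else 1
  have hf : ∀ i, f i * f i = 1 := by
    intro i
    simp only [f]
    split_ifs
    · exact sgn_mul_self _
    · norm_num
  have h1 : sgn (s a) = f 0 := by
    have : a = ⟨0, by omega⟩ := Fin.ext ha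
    simp only [f, this]
    rw [dif_pos]
  have h2 : sgn (s b) = f (N - 1) := by
    have hb' : b = ⟨N - 1, by omega⟩ := Fin.ext (by change b.1 = N - 1; omega)
    simp only [f]
    rw [dif_pos (by omega)]
    exact congrArg (fun j => sgn (s j)) hb'
  rw [h1, h2, ← prod_telescope f hf, ← Fin.prod_univ_eq_prod_range (fun i => f i * f (i + 1)),
    cpDiag, cpDiag, ← Finset.prod_mul_distrib]
  have h3 : ∀ i : Fin (N - 1), chi (s ⟨i.1, by omega⟩ + 1) (s ⟨i.1 + 1, by omega⟩ + 1) *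
      chi (s ⟨i.1, by omega⟩) (s ⟨i.1 + 1, by omega⟩) = (-1) * (f i * f (i + 1)) := by
    intro i
    have := i.2
    simp only [f]
    rw [chi_flip, dif_pos (by omega), dif_pos (by omega)]
    ring
  rw [Finset.prod_congr rfl fun i _ => h3 i, Finset.prod_mul_distrib]
  simp

/-- Conjugating `CP_tot` by `σ^x` on all qubits produces `σ^z` at the two ends. -/
theorem uniform_sigmaX_cpTot {N : ℕ} (a b : Fin N) (ha : a.1 = 0) (hb : b.1 + 1 = N) :
    uniform N sigmaX * cpTot N * uniform N sigmaX * cpTot N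
      = ((-1 : ℂ) ^ (N - 1)) • (opZ a * opZ b) := by
  -- Flipping all bits permutes the basis, so it carries the diagonal of `cpTot` to its values at
  -- the flipped configurations.
  have h : uniform N sigmaX * cpTot N
      = diagonal (fun s => cpDiag N fun j => s j + 1) * uniform N sigmaX := by
    ext s t
    rw [cpTot_eq, diagonal_mul, mul_diagonal, uniform_eq_tens, tens_apply]
    by_cases hst : t = fun j => s j + 1
    · rw [hst, mul_comm]
    · obtain ⟨j, hj⟩ : ∃ j, t j ≠ s j + 1 := by
        by_contra hc
        push Not at hc
        exact hst (funext hc)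
      have : sigmaX (s j) (t j) = 0 := by
        generalize s j = x at hj
        generalize t j = y at hj
        revert hj
        fin_cases x <;> fin_cases y <;> simp [sigmaX]
      rw [Finset.prod_eq_zero (Finset.mem_univ j) this]
      simp
  rw [h, mul_assoc (diagonal _), uniform_mul, sigmaX_mul_self, uniform_one, mul_one, cpTot_eq,
    opZ_eq_diagonal, opZ_eq_diagonal, diagonal_mul_diagonal, diagonal_mul_diagonal]
  ext s t
  rw [Matrix.smul_apply, diagonal_apply, diagonal_apply]
  split_ifs
  · rw [cpDiag_flip_all s a b ha hb, smul_eq_mul]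
  · simp

/-! ### Operators generated by the global gates -/

/-- Up to a phase, `L` is a product of at most `m` global gates. -/
def Reach (N m : ℕ) (L : Op N) : Prop :=
  ∃ m' ≤ m, ∃ c : ℂ, ‖c‖ = 1 ∧ GlobalWord N m' (c • L)

theorem Reach.mono {N m m' : ℕ} {L : Op N} (h : Reach N m L) (hm : m ≤ m') : Reach N m' L := by
  obtain ⟨k, hk, c, hc, hw⟩ := h
  exact ⟨k, hk.trans hm, c, hc, hw⟩

theorem Reach.smul {N m : ℕ} {L : Op N} (h : Reach N m L) {c : ℂ} (hc : ‖c‖ = 1) :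
    Reach N m (c • L) := by
  obtain ⟨k, hk, d, hd, hw⟩ := h
  have hc0 : c ≠ 0 := fun h0 => by simp [h0] at hc
  refine ⟨k, hk, d * c⁻¹, by simp [hd, hc], ?_⟩
  rwa [smul_smul, mul_assoc, inv_mul_cancel₀ hc0, mul_one]

theorem Reach.of_smul {N m : ℕ} {L : Op N} {c : ℂ} (h : Reach N m (c • L)) (hc : ‖c‖ = 1) :
    Reach N m L := by
  have hc0 : c ≠ 0 := fun h0 => by simp [h0] at hc
  have := h.smul (c := c⁻¹) (by simp [hc])
  rwa [smul_smul, inv_mul_cancel₀ hc0, one_smul] at this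

theorem Reach.one (N : ℕ) : Reach N 0 1 :=
  ⟨0, le_rfl, 1, norm_one, [], by simp, rfl, by simp⟩

theorem Reach.mul {N a b : ℕ} {A B : Op N} (hA : Reach N a A) (hB : Reach N b B) :
    Reach N (a + b) (A * B) := by
  obtain ⟨k, hk, c, hc, w, hw, hl, hp⟩ := hA
  obtain ⟨k', hk', c', hc', w', hw', hl', hp'⟩ := hB
  refine ⟨k + k', add_le_add hk hk', c * c', by simp [hc, hc'], w ++ w', ?_, by simp [hl, hl'], ?_⟩
  · intro g hg
    rcases List.mem_append.1 hg with h | h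
    · exact hw g h
    · exact hw' g h
  · rw [List.prod_append, hp, hp', smul_mul_smul_comm]

theorem Reach.pow {N a : ℕ} {A : Op N} (hA : Reach N a A) (k : ℕ) : Reach N (k * a) (A ^ k) := by
  induction k with
  | zero => simpa using Reach.one N
  | succ k ih =>
    rw [pow_succ, Nat.succ_mul]
    exact ih.mul hA

theorem Reach.of_mem {N : ℕ} {A : Op N} (hA : A ∈ globalGates N) : Reach N 1 A :=
  ⟨1, le_rfl, 1, norm_one, [A], by simpa using hA, rfl, by simp⟩

theorem reach_cpTot (N : ℕ) : Reach N 1 (cpTot N) :=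
  Reach.of_mem (by simp [globalGates])

theorem reach_had (N : ℕ) : Reach N 1 (uniform N hGate) := by
  have h : Reach N 1 (hadTot N) := Reach.of_mem (by simp [globalGates])
  rw [hadTot, hadPulse_eq, uniform_smul] at h
  exact h.of_smul (by simp)

theorem uniform_pow (N : ℕ) (A : Matrix (Fin 2) (Fin 2) ℂ) (k : ℕ) :
    uniform N A ^ k = uniform N (A ^ k) := by
  induction k with
  | zero => simp [uniform_one]
  | succ k ih => rw [pow_succ, pow_succ, ih, uniform_mul]

/-- Since `rot` halves the angle, the available pulse is `cis (π/16)`, of period `32`. Reducing the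
exponent modulo `32` provides negative angles without inverse gates, at a cost independent of `m`.
-/
theorem reach_zRot (N : ℕ) (m : ℤ) : Reach N 32 (uniform N (cis (m * (Real.pi / 16)) sigmaZ)) := by
  have h : Reach N 1 (sigmaTot N sigmaZ (Real.pi / 8)) := Reach.of_mem (by simp [globalGates])
  rw [sigmaTot, rot_eq_cis sigmaZ_mul_self] at h
  have h2 := h.pow (m % 32).toNat
  rw [uniform_pow, cis_pow sigmaZ_mul_self] at h2
  have h0 := Int.emod_nonneg m (show (32 : ℤ) ≠ 0 by norm_num)
  have h1 := Int.emod_lt_of_pos m (show (0 : ℤ) < 32 by norm_num)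
  have h3 : (((m % 32).toNat : ℕ) : ℝ) * (Real.pi / 8 / 2) + ((m / 32 : ℤ) : ℝ) * (2 * Real.pi)
      = m * (Real.pi / 16) := by
    have e1 : (((m % 32).toNat : ℕ) : ℝ) = ((m % 32 : ℤ) : ℝ) := by
      rw [← Int.cast_natCast, Int.toNat_of_nonneg h0]
    have e2 : (m : ℝ) = ((m % 32 : ℤ) : ℝ) + 32 * ((m / 32 : ℤ) : ℝ) := by
      have := Int.emod_add_mul_ediv m 32
      exact_mod_cast this.symm
    rw [e1, e2]
    ring
  rw [← cis_add_two_pi _ _ (m / 32), h3] at h2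
  exact h2.mono (by omega)

theorem had_conj_uniform (N : ℕ) {A B : Matrix (Fin 2) (Fin 2) ℂ} (h : hGate * A = B * hGate) :
    uniform N hGate * uniform N A * uniform N hGate = uniform N B := by
  rw [uniform_mul, uniform_mul, h, mul_assoc, hGate_mul_self, mul_one]

theorem reach_xRot (N : ℕ) (m : ℤ) : Reach N 34 (uniform N (cis (m * (Real.pi / 16)) sigmaX)) := by
  rw [← had_conj_uniform N (mul_cis hGate_mul_sigmaZ _)]
  exact ((reach_had N).mul (reach_zRot N m)).mul (reach_had N)

theorem reach_sigmaX (N : ℕ) : Reach N 34 (uniform N sigmaX) := by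
  have h := reach_xRot N 8
  rw [show ((8 : ℤ) : ℝ) * (Real.pi / 16) = Real.pi / 2 by push_cast; ring, cis_pi_div_two,
    uniform_smul] at h
  exact h.of_smul (by simp)

/-- The count is `34 + 1 + 34 + 1`; the sign from the bonds is absorbed in the phase. -/
theorem reach_ends {N : ℕ} (a b : Fin N) (ha : a.1 = 0) (hb : b.1 + 1 = N) :
    Reach N 70 (opZ a * opZ b) := by
  have h := (((reach_sigmaX N).mul (reach_cpTot N)).mul (reach_sigmaX N)).mul (reach_cpTot N)
  rw [uniform_sigmaX_cpTot a b ha hb] at h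
  exact h.of_smul (by simp)

/-- Global rotations and the `σ^z` pair at the ends give rotations of the ends alone. -/
theorem uniform_cis_conj_ends {N : ℕ} {a b : Fin N} (hab : a ≠ b) (θ : ℝ) :
    uniform N (cis θ sigmaX) * (opZ a * opZ b) * uniform N (cis (-θ) sigmaX) * (opZ a * opZ b)
      = onSite a (cis (2 * θ) sigmaX) * onSite b (cis (2 * θ) sigmaX) := by
  -- Conjugation by `Z` reverses an `X` rotation, so at the ends the two angles add. On every other
  -- site they cancel, which is `h2`.
  have h1 : cis θ sigmaX * sigmaZ * cis (-θ) sigmaX * sigmaZ = cis (2 * θ) sigmaX := by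
    have : sigmaZ * cis (-θ) sigmaX = cis θ sigmaX * sigmaZ := by
      rw [← neg_neg θ, ← cis_neg_right (-θ), neg_neg]
      refine mul_cis ?_ _
      rw [neg_mul, sigmaX_mul_sigmaZ, neg_neg]
    rw [mul_assoc (cis θ sigmaX), this, mul_assoc, mul_assoc, sigmaZ_mul_self, mul_one,
      cis_mul sigmaX_mul_self, two_mul]
  have h2 := cis_mul_cis_neg sigmaX_mul_self θ
  simp only [uniform_eq_tens, onSite_eq_tens, ← map_mul]
  congr 1
  ext1 k
  simp only [Pi.mul_apply]
  by_cases hka : k = a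
  · subst hka
    simpa [Pi.mulSingle_eq_of_ne hab] using h1
  · by_cases hkb : k = b
    · subst hkb
      simpa [Pi.mulSingle_eq_of_ne hka] using h1
    · simpa [Pi.mulSingle_eq_of_ne hka, Pi.mulSingle_eq_of_ne hkb] using h2

/-- The operator on `n` logical qubits is generated, up to a phase, by at most `m` global gates. -/
def LogReach (n m : ℕ) (U : Op n) : Prop := Reach (2 * n) m (logical U)

/-! ### Generated operators on the logical register -/

theorem LogReach.mono {n m m' : ℕ} {U : Op n} (h : LogReach n m U) (hm : m ≤ m') :
    LogReach n m' U := Reach.mono h hm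

theorem LogReach.one (n : ℕ) : LogReach n 0 1 := by
  rw [LogReach, logical_one]
  exact Reach.one _

theorem LogReach.mul {n a b : ℕ} {U V : Op n} (hU : LogReach n a U) (hV : LogReach n b V) :
    LogReach n (a + b) (U * V) := by
  rw [LogReach, logical_mul]
  exact Reach.mul hU hV

theorem LogReach.of_smul {n m : ℕ} {U : Op n} {c : ℂ} (h : LogReach n m (c • U)) (hc : ‖c‖ = 1) :
    LogReach n m U := by
  rw [LogReach, logical_smul] at h
  exact Reach.of_smul h (by simp [hc])

theorem logReach_had (n : ℕ) : LogReach n 1 (uniform n hGate) := by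
  rw [LogReach, logical_uniform]
  exact reach_had _

theorem logReach_uniform_zRot (n : ℕ) (m : ℤ) :
    LogReach n 32 (uniform n (cis (m * (Real.pi / 16)) sigmaZ)) := by
  rw [LogReach, logical_uniform]
  exact reach_zRot _ m

/-- The two ends of the chain carry the two copies of the first logical qubit. The angle `mπ/16` is
doubled by `uniform_cis_conj_ends`, and the cost is `34 + 70 + 34 + 70`. -/
theorem logReach_firstX {n : ℕ} (k : Fin n) (hk : k.1 = 0) (m : ℤ) :
    LogReach n 208 (cis (m * (Real.pi / 8)) (opX k)) := by
  have ha : (leftPos k).1 = 0 := hk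
  have hb : (rightPos k).1 + 1 = 2 * n := by
    rw [rightPos_val]
    have := k.2
    omega
  have h := (((reach_xRot _ m).mul (reach_ends _ _ ha hb)).mul (reach_xRot _ (-m))).mul
    (reach_ends _ _ ha hb)
  rw [Int.cast_neg, neg_mul, uniform_cis_conj_ends (leftPos_ne_rightPos k k)] at h
  rw [LogReach, logical_cis, leftHom_onSite, rightHom_onSite, ← onSite_cis, ← onSite_cis]
  convert h using 3 <;> ring_nf

/-! ### Transport along the chain -/

/-- The transport step, a Clifford cellular automaton. -/
def shift (N : ℕ) : Op N := uniform N hGate * cpTot N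

theorem shift_mul_inverse (N : ℕ) : shift N * (cpTot N * uniform N hGate) = 1 := by
  rw [shift, mul_assoc, ← mul_assoc (cpTot N), cpTot_mul_self, one_mul, uniform_mul,
    hGate_mul_self, uniform_one]

theorem had_mul_opZ_mul_opX {N : ℕ} {p q : Fin N} (h : p ≠ q) :
    uniform N hGate * (opZ q * opX p) = opZ p * opX q * uniform N hGate := by
  rw [← mul_assoc, uniform_mul_onSite hGate_mul_sigmaZ, mul_assoc,
    uniform_mul_onSite hGate_mul_sigmaX, ← mul_assoc, (onSite_commute h.symm _ _).eq]

/-- Launching the travelling pair: `cpTot` attaches `Z` on the only neighbour of the end site, and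
the Hadamard layer exchanges `X` and `Z`. -/
theorem shift_mul_opX {N : ℕ} {p q : Fin N}
    (h : p.1 = 0 ∧ q.1 = 1 ∨ p.1 + 1 = N ∧ q.1 + 1 = p.1) :
    shift N * opX p = opZ p * opX q * shift N := by
  have hpq : p ≠ q := fun h' => by
    rw [h'] at h
    omega
  rw [shift, mul_assoc, cpTot_mul_opX, nbOp_of_end h, ← mul_assoc, had_mul_opZ_mul_opX hpq,
    mul_assoc]

/-- The pair moves one site: `cpTot` attaches `Z` on both neighbours of `p`, the one at `o` cancels
the trailing `Z`, and the Hadamard layer exchanges the roles of `p` and `q`. -/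
theorem shift_mul_opZ_mul_opX {N : ℕ} {o p q : Fin N}
    (h : o.1 + 1 = p.1 ∧ p.1 + 1 = q.1 ∨ q.1 + 1 = p.1 ∧ p.1 + 1 = o.1) :
    shift N * (opZ o * opX p) = opZ p * opX q * shift N := by
  have hpq : p ≠ q := fun h' => by
    rw [h'] at h
    omega
  have h1 : cpTot N * (opZ o * opX p) = opZ q * opX p * cpTot N := by
    rw [← mul_assoc, (cpTot_commute_opZ o).eq, mul_assoc, cpTot_mul_opX, nbOp_of_mid h,
      ← mul_assoc, ← mul_assoc, ← mul_assoc, opZ_mul_self, one_mul]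
  rw [shift, mul_assoc, h1, ← mul_assoc, had_mul_opZ_mul_opX hpq, mul_assoc]

/-- One conjugation must transport both copies, hence a hypothesis for each half. The four extra
gates are `shift` and its inverse. -/
theorem LogReach.shift_conj {n a : ℕ} {A B : Op n} {θ : ℝ} (h : LogReach n a (cis θ A))
    (hl : shift (2 * n) * leftHom n A = leftHom n B * shift (2 * n))
    (hr : shift (2 * n) * rightHom n A = rightHom n B * shift (2 * n)) :
    LogReach n (a + 4) (cis θ B) := by
  have hs : Reach (2 * n) 2 (shift (2 * n)) := (reach_had _).mul (reach_cpTot _)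
  have hs' : Reach (2 * n) 2 (cpTot (2 * n) * uniform (2 * n) hGate) :=
    (reach_cpTot _).mul (reach_had _)
  have h2 := (hs.mul h).mul hs'
  have h3 : shift (2 * n) * logical (cis θ A) * (cpTot (2 * n) * uniform (2 * n) hGate)
      = logical (cis θ B) := by
    rw [logical_cis, ← mul_assoc (shift _), mul_cis hl, mul_assoc (cis θ _), mul_cis hr,
      ← mul_assoc (cis θ _), mul_assoc _ (shift _), shift_mul_inverse, mul_one, logical_cis]
  rw [h3] at h2
  exact Reach.mono h2 (by omega)

/-- The first step launches pairs from the two ends and each further step moves them one site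
inwards, so the cost is linear in the distance travelled. -/
theorem logReach_zx {n : ℕ} (m : ℤ) (t : ℕ) : ∀ k l : Fin n, k.1 = t → l.1 = k.1 + 1 →
    LogReach n (212 + 4 * t) (cis (m * (Real.pi / 8)) (opZ k * opX l)) := by
  induction t with
  | zero =>
    intro k l hk hl
    refine (logReach_firstX k hk m).shift_conj ?_ ?_
    · rw [map_mul, leftHom_onSite, leftHom_onSite, leftHom_onSite]
      refine shift_mul_opX (Or.inl ?_)
      rw [leftPos_val, leftPos_val]
      omega
    · rw [map_mul, rightHom_onSite, rightHom_onSite, rightHom_onSite]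
      refine shift_mul_opX (Or.inr ?_)
      rw [rightPos_val, rightPos_val]
      omega
  | succ t ih =>
    intro k l hk hl
    have hn := l.2
    have h := ih ⟨t, by omega⟩ k rfl hk
    refine (h.shift_conj (B := opZ k * opX l) ?_ ?_).mono (by omega)
    · rw [map_mul, map_mul, leftHom_onSite, leftHom_onSite, leftHom_onSite, leftHom_onSite]
      refine shift_mul_opZ_mul_opX (Or.inl ?_)
      rw [leftPos_val, leftPos_val, leftPos_val]
      dsimp only
      omega
    · rw [map_mul, map_mul, rightHom_onSite, rightHom_onSite, rightHom_onSite, rightHom_onSite]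
      refine shift_mul_opZ_mul_opX (Or.inr ?_)
      rw [rightPos_val, rightPos_val, rightPos_val]
      dsimp only
      omega

/-! ### Exact realisation of the elementary gates -/

theorem logReach_zxRot {n : ℕ} {k l : Fin n} (h : l.1 = k.1 + 1) (m : ℤ) :
    LogReach n (212 * n) (cis (m * (Real.pi / 8)) (opZ k * opX l)) := by
  refine (logReach_zx m k.1 k l rfl h).mono ?_
  have := l.2
  omega

theorem LogReach.had_conj {n a : ℕ} {A B : Op n} {θ : ℝ} (h : LogReach n a (cis θ A))
    (hAB : uniform n hGate * A = B * uniform n hGate) : LogReach n (a + 2) (cis θ B) := by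
  have h2 := ((logReach_had n).mul h).mul (logReach_had n)
  rw [conj_cis hAB (by rw [uniform_mul, hGate_mul_self, uniform_one])] at h2
  exact h2.mono (by omega)

/-- A uniform `Z` rotation fixes `Z_k` and turns `X_l` into `-Y_l`. It costs 32 gates on each side.
-/
theorem logReach_zy {n : ℕ} {k l : Fin n} (h : l.1 = k.1 + 1) (m : ℤ) :
    LogReach n (276 * n) (cis (m * (Real.pi / 8)) (opZ k * onSite l (-sigmaY))) := by
  have hkl : k ≠ l := fun h' => by rw [h'] at h; omega
  have h1 : cis (Real.pi / 4) sigmaZ * sigmaX = (-sigmaY) * cis (Real.pi / 4) sigmaZ := by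
    rw [cis_pi_div_four_mul sigmaZ_mul_self (by rw [sigmaX_mul_sigmaZ, neg_neg]),
      sigmaZ_mul_sigmaX, smul_smul, Complex.I_mul_I, neg_one_smul]
  have h2 : cis (Real.pi / 4) sigmaZ * sigmaZ = sigmaZ * cis (Real.pi / 4) sigmaZ :=
    (Commute.cis_right (Commute.refl sigmaZ) _).eq.symm
  have h3 := ((logReach_uniform_zRot n 4).mul (logReach_zxRot h m)).mul
    (logReach_uniform_zRot n (-4))
  rw [show ((4 : ℤ) : ℝ) * (Real.pi / 16) = Real.pi / 4 by push_cast; ring,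
    show ((-4 : ℤ) : ℝ) * (Real.pi / 16) = -(Real.pi / 4) by push_cast; ring] at h3
  rw [conj_cis (B := opZ k * onSite l (-sigmaY)) ?_
    (by rw [uniform_mul, cis_mul_cis_neg sigmaZ_mul_self, uniform_one])] at h3
  · have := l.2
    exact h3.mono (by omega)
  · rw [← mul_assoc, uniform_mul_onSite h2, mul_assoc, uniform_mul_onSite h1, mul_assoc]

/-- `Z_k X_l` and `Z_k Y_l` anticommute and their product is proportional to `Z_l`, the neighbour's
`Z` cancelling. Conjugating one rotation by a quarter rotation of the other therefore acts on `l`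
alone. The first qubit has no left neighbour and uses `logReach_firstX` with a Hadamard layer. -/
theorem logReach_zRot {n : ℕ} (l : Fin n) (m : ℤ) :
    LogReach n (800 * n) (cis (m * (Real.pi / 8)) (opZ l)) := by
  have hn := l.2
  by_cases hl : l.1 = 0
  · exact ((logReach_firstX l hl m).had_conj (uniform_mul_onSite hGate_mul_sigmaX l)).mono
      (by omega)
  · have h : l.1 = (⟨l.1 - 1, by omega⟩ : Fin n).1 + 1 := by dsimp only; omega
    generalize (⟨l.1 - 1, by omega⟩ : Fin n) = k at h
    have hkl : k ≠ l := fun h' => by rw [h'] at h; omega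
    have hc : ∀ A B, Commute (onSite k A) (onSite l B) := fun A B => onSite_commute hkl A B
    have h3 := ((logReach_zxRot h 2).mul (logReach_zy h m)).mul (logReach_zxRot h (-2))
    rw [show ((2 : ℤ) : ℝ) * (Real.pi / 8) = Real.pi / 4 by push_cast; ring,
      show ((-2 : ℤ) : ℝ) * (Real.pi / 8) = -(Real.pi / 4) by push_cast; ring] at h3
    have e1 : opZ k * opX l * (opZ k * onSite l (-sigmaY)) = -(Complex.I • opZ l) := by
      rw [(hc _ _).symm.mul_mul_mul_comm, opZ_mul_self, one_mul, onSite_mul, mul_neg,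
        sigmaX_mul_sigmaY, onSite_neg, onSite_smul]
    have e2 : opZ k * onSite l (-sigmaY) * (opZ k * opX l) = Complex.I • opZ l := by
      rw [(hc _ _).symm.mul_mul_mul_comm, opZ_mul_self, one_mul, onSite_mul, neg_mul,
        sigmaY_mul_sigmaX, neg_neg, onSite_smul]
    have e3 := cis_pi_div_four_mul (opZ_mul_opX_mul_self hkl) (B := opZ k * onSite l (-sigmaY))
      (by rw [e1, e2])
    rw [e1, smul_neg, smul_smul, Complex.I_mul_I, neg_one_smul, neg_neg] at e3
    rw [conj_cis e3 (cis_mul_cis_neg (opZ_mul_opX_mul_self hkl) _)] at h3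
    exact h3.mono (by omega)

theorem logReach_xRot {n : ℕ} (l : Fin n) (m : ℤ) :
    LogReach n (802 * n) (cis (m * (Real.pi / 8)) (opX l)) := by
  have hn := l.2
  exact ((logReach_zRot l m).had_conj (uniform_mul_onSite hGate_mul_sigmaZ l)).mono (by omega)

theorem logReach_cnotOp {n : ℕ} {k l : Fin n} (h : l.1 = k.1 + 1) :
    LogReach n (1814 * n) (cnotOp k l) := by
  have hkl : k ≠ l := fun h' => by rw [h'] at h; omega
  have h3 := ((logReach_zRot k (-2)).mul (logReach_xRot l (-2))).mul (logReach_zxRot h 2)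
  rw [show ((2 : ℤ) : ℝ) * (Real.pi / 8) = Real.pi / 4 by push_cast; ring,
    show ((-2 : ℤ) : ℝ) * (Real.pi / 8) = -(Real.pi / 4) by push_cast; ring,
    ← cnotOp_eq_cis hkl] at h3
  refine (h3.of_smul ?_).mono (by omega)
  rw [← Complex.ofReal_neg, Complex.norm_exp_ofReal_mul_I]

theorem logReach_hGate {n : ℕ} (k : Fin n) : LogReach n (2402 * n) (onSite k hGate) := by
  have h3 := ((logReach_zRot k 2).mul (logReach_xRot k 2)).mul (logReach_zRot k 2)
  rw [show ((2 : ℤ) : ℝ) * (Real.pi / 8) = Real.pi / 4 by push_cast; ring, ← onSite_cis,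
    ← onSite_cis, onSite_mul, onSite_mul, ← hGate_eq_cis, onSite_smul] at h3
  exact (h3.of_smul (by simp)).mono (by omega)

theorem logReach_elementary {n : ℕ} {U : Op n} (h : ElementaryLogical n U) :
    LogReach n (2402 * n) U := by
  cases h with
  | zRot k m =>
    rw [rot_eq_cis sigmaZ_mul_self, onSite_cis,
      show (m : ℝ) * (Real.pi / 4) / 2 = m * (Real.pi / 8) by ring]
    exact (logReach_zRot k m).mono (by omega)
  | xRot k m =>
    rw [rot_eq_cis sigmaX_mul_self, onSite_cis,
      show (m : ℝ) * (Real.pi / 4) / 2 = m * (Real.pi / 8) by ring]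
    exact (logReach_xRot k m).mono (by omega)
  | t k =>
    have h := logReach_zRot k (-1)
    rw [show ((-1 : ℤ) : ℝ) * (Real.pi / 8) = -(Real.pi / 8) by push_cast; ring, ← onSite_cis,
      ← tGate_eq_cis, onSite_smul] at h
    refine (h.of_smul ?_).mono (by omega)
    rw [mul_comm, Complex.norm_exp_ofReal_mul_I]
  | had k => exact logReach_hGate k
  | ent k l h m =>
    have hkl : k ≠ l := fun h' => by rw [h'] at h; omega
    rw [onPair_entangler hkl]
    exact (logReach_zxRot h m).mono (by omega)
  | cnot k l h =>
    have hkl : k ≠ l := fun h' => by rw [h'] at h; omega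
    rw [onPair_cnot hkl]
    exact (logReach_cnotOp h).mono (by omega)

theorem LogReach.exists_realises {n m : ℕ} {U : Op n} (h : LogReach n m U) :
    ∃ (m' : ℕ) (L : Op (2 * n)), m' ≤ m ∧ GlobalWord (2 * n) m' L ∧ Realises L U := by
  obtain ⟨k, hk, c, hc, hw⟩ := h
  refine ⟨k, c • logical U, hk, hw, c, hc, rfl, fun ψ => ?_⟩
  rw [smul_mulVec, mulVec_encode]

theorem exact_realisation : ∃ C : ℕ, ∀ (n : ℕ) (U : Op n), ElementaryLogical n U →
    ∃ (m : ℕ) (L : Op (2 * n)), m ≤ C * n ∧ GlobalWord (2 * n) m L ∧ Realises L U :=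
  ⟨2402, fun _ _ h => (logReach_elementary h).exists_realises⟩

/-! ### Closed monoids of matrices and their generators -/

section Trotter

open Filter Topology

variable {ι : Type*} [Fintype ι] [DecidableEq ι]

theorem norm_pow_sub_pow_le {R : Type*} [NormedRing R] [NormOneClass R] {X Y : R} (hX : ‖X‖ ≤ 1)
    (hY : ‖Y‖ ≤ 1) (k : ℕ) : ‖X ^ k - Y ^ k‖ ≤ k * ‖X - Y‖ := by
  induction k with
  | zero => simp
  | succ k ih =>
    have h : X ^ (k + 1) - Y ^ (k + 1) = (X ^ k - Y ^ k) * X + Y ^ k * (X - Y) := by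
      rw [pow_succ, pow_succ]
      noncomm_ring
    have hYk : ‖Y ^ k‖ ≤ 1 := (norm_pow_le Y k).trans (pow_le_one₀ (norm_nonneg _) hY)
    rw [h]
    calc ‖(X ^ k - Y ^ k) * X + Y ^ k * (X - Y)‖
        ≤ ‖X ^ k - Y ^ k‖ * ‖X‖ + ‖Y ^ k‖ * ‖X - Y‖ :=
          (norm_add_le _ _).trans (add_le_add (norm_mul_le _ _) (norm_mul_le _ _))
      _ ≤ (k * ‖X - Y‖) * 1 + 1 * ‖X - Y‖ := by gcongr
      _ = ((k + 1 : ℕ) : ℝ) * ‖X - Y‖ := by push_cast; ring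

theorem exp_mem_unitary {H : Matrix ι ι ℂ} (hH : H.IsHermitian) (t : ℝ) :
    NormedSpace.exp ((Complex.I * (t : ℂ)) • H) ∈ unitary (Matrix ι ι ℂ) := by
  have h : IsSelfAdjoint ((t : ℂ) • H) :=
    IsSelfAdjoint.smul (by simp [IsSelfAdjoint]) hH
  have := (selfAdjoint.expUnitary (⟨(t : ℂ) • H, h⟩ : selfAdjoint (Matrix ι ι ℂ))).2
  rwa [selfAdjoint.expUnitary_coe, smul_smul] at this

/-- The Lie product formula, for exponentials of norm at most one. -/
theorem tendsto_trotter {A B : Matrix ι ι ℂ} [Nonempty ι]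
    (hA : ∀ t : ℝ, ‖NormedSpace.exp (t • A)‖ ≤ 1) (hB : ∀ t : ℝ, ‖NormedSpace.exp (t • B)‖ ≤ 1)
    (hAB : ∀ t : ℝ, ‖NormedSpace.exp (t • (A + B))‖ ≤ 1) :
    Tendsto (fun k : ℕ => (NormedSpace.exp ((1 / ((k : ℝ) + 1)) • A) *
      NormedSpace.exp ((1 / ((k : ℝ) + 1)) • B)) ^ (k + 1)) atTop
      (𝓝 (NormedSpace.exp (A + B))) := by
  -- `f` vanishes to second order in the sense `f(t)/t → 0`. For contractions the error of the
  -- `(k+1)`-st power is at most `(k+1)‖f(1/(k+1))‖`, which is the norm of that difference quotient.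
  let f : ℝ → Matrix ι ι ℂ := fun t =>
    NormedSpace.exp (t • A) * NormedSpace.exp (t • B) - NormedSpace.exp (t • (A + B))
  have hf : HasDerivAt f 0 0 := by
    have hd : ∀ L : Matrix ι ι ℂ, HasDerivAt (fun u : ℝ => NormedSpace.exp (u • L)) L 0 := by
      intro L
      have e : NormedSpace.exp ((0 : ℝ) • L) * L = L := by
        rw [zero_smul, NormedSpace.exp_zero, one_mul]
      exact (hasDerivAt_exp_smul_const (𝕂 := ℝ) L 0).congr_deriv e
    refine (((hd A).mul (hd B)).sub (hd (A + B))).congr_deriv ?_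
    rw [zero_smul, zero_smul, NormedSpace.exp_zero, one_mul, mul_one, sub_self]
  have hf0 : f 0 = 0 := by simp [f]
  rw [hasDerivAt_iff_tendsto_slope_zero] at hf
  simp only [zero_add, hf0, sub_zero] at hf
  have hs : Tendsto (fun k : ℕ => 1 / ((k : ℝ) + 1)) atTop (𝓝[≠] 0) := by
    rw [tendsto_nhdsWithin_iff]
    exact ⟨tendsto_one_div_add_atTop_nhds_zero_nat,
      Eventually.of_forall fun k => (Nat.one_div_pos_of_nat (n := k)).ne'⟩
  have h := (hf.comp hs).norm
  rw [norm_zero] at h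
  rw [tendsto_iff_norm_sub_tendsto_zero]
  refine squeeze_zero (fun _ => norm_nonneg _) (fun k => ?_) h
  have hk : (0 : ℝ) < (k : ℝ) + 1 := by positivity
  have e : NormedSpace.exp (A + B) = NormedSpace.exp ((1 / ((k : ℝ) + 1)) • (A + B)) ^ (k + 1) := by
    rw [← Matrix.exp_nsmul, ← Nat.cast_smul_eq_nsmul ℝ, smul_smul]
    push_cast
    rw [mul_one_div_cancel hk.ne', one_smul]
  rw [e]
  refine (norm_pow_sub_pow_le ?_ (hAB _) (k + 1)).trans (le_of_eq ?_)
  · exact (norm_mul_le _ _).trans (mul_le_one₀ (hA _) (norm_nonneg _) (hB _))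
  · rw [Function.comp_apply, norm_smul, norm_inv, one_div, norm_inv, inv_inv,
      Real.norm_of_nonneg hk.le]
    push_cast
    rfl

/-- The Hermitian generators of the one-parameter groups inside a set of matrices. -/
def generators (G : Set (Matrix ι ι ℂ)) : Set (Matrix ι ι ℂ) :=
  {H | H.IsHermitian ∧ ∀ t : ℝ, NormedSpace.exp ((Complex.I * (t : ℂ)) • H) ∈ G}

theorem mem_generators_of_cis {G : Set (Matrix ι ι ℂ)} {A : Matrix ι ι ℂ} (hA : A * A = 1)
    (hH : A.IsHermitian) (h : ∀ t : ℝ, cis t A ∈ G) : A ∈ generators G :=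
  ⟨hH, fun t => by rw [exp_eq_cis hA]; exact h t⟩

theorem smul_mem_generators {G : Set (Matrix ι ι ℂ)} {H : Matrix ι ι ℂ} (h : H ∈ generators G)
    (r : ℝ) : (r : ℂ) • H ∈ generators G := by
  refine ⟨IsSelfAdjoint.smul (by simp [IsSelfAdjoint]) h.1, fun t => ?_⟩
  have := h.2 (t * r)
  rwa [smul_smul, mul_assoc, ← Complex.ofReal_mul]

/-- `G` is only a monoid, so membership of the inverse `star u` has to be assumed. -/
theorem conj_mem_generators {G : Submonoid (Matrix ι ι ℂ)} {H u : Matrix ι ι ℂ}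
    (h : H ∈ generators (G : Set (Matrix ι ι ℂ))) (hu : u ∈ G) (hu' : star u ∈ G)
    (huu : u ∈ unitary (Matrix ι ι ℂ)) :
    u * H * star u ∈ generators (G : Set (Matrix ι ι ℂ)) := by
  refine ⟨?_, fun t => ?_⟩
  · exact Matrix.isHermitian_mul_mul_conjTranspose u h.1
  · have e := Matrix.exp_units_conj (Unitary.toUnits ⟨u, huu⟩) ((Complex.I * (t : ℂ)) • H)
    have e2 : ((Unitary.toUnits ⟨u, huu⟩ : (Matrix ι ι ℂ)ˣ) : Matrix ι ι ℂ) = u := rfl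
    have e3 : (((Unitary.toUnits ⟨u, huu⟩)⁻¹ : (Matrix ι ι ℂ)ˣ) : Matrix ι ι ℂ) = star u := rfl
    rw [e2, e3, mul_smul_comm, smul_mul_assoc] at e
    rw [e]
    exact G.mul_mem (G.mul_mem hu (h.2 t)) hu'

/-- The Lie product formula writes the exponential of a sum as a limit of products in `G`. Hermitian
generators make all factors unitary, which supplies its norm hypotheses. -/
theorem add_mem_generators {G : Submonoid (Matrix ι ι ℂ)} [Nonempty ι]
    (hG : IsClosed (G : Set (Matrix ι ι ℂ))) {H K : Matrix ι ι ℂ}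
    (hH : H ∈ generators (G : Set (Matrix ι ι ℂ))) (hK : K ∈ generators (G : Set (Matrix ι ι ℂ))) :
    H + K ∈ generators (G : Set (Matrix ι ι ℂ)) := by
  refine ⟨hH.1.add hK.1, fun t => ?_⟩
  have e : ∀ (L : Matrix ι ι ℂ) (s : ℝ), s • ((Complex.I * (t : ℂ)) • L)
      = (Complex.I * ((s * t : ℝ) : ℂ)) • L := by
    intro L s
    rw [← Complex.coe_smul, smul_smul]
    congr 1
    push_cast
    ring
  have hn : ∀ {L : Matrix ι ι ℂ}, L.IsHermitian → ∀ s : ℝ,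
      ‖NormedSpace.exp (s • ((Complex.I * (t : ℂ)) • L))‖ ≤ 1 := by
    intro L hL s
    rw [e]
    exact (CStarRing.norm_of_mem_unitary (exp_mem_unitary hL _)).le
  rw [smul_add]
  refine hG.mem_of_tendsto (tendsto_trotter (hn hH.1) (hn hK.1) ?_) (Eventually.of_forall fun k => ?_)
  · intro s
    rw [← smul_add]
    exact hn (hH.1.add hK.1) s
  · rw [e, e]
    exact G.pow_mem (G.mul_mem (hH.2 _) (hK.2 _)) _

theorem zero_mem_generators (G : Submonoid (Matrix ι ι ℂ)) :
    (0 : Matrix ι ι ℂ) ∈ generators (G : Set (Matrix ι ι ℂ)) :=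
  ⟨isHermitian_zero, fun t => by rw [smul_zero, NormedSpace.exp_zero]; exact G.one_mem⟩

theorem sum_mem_generators {G : Submonoid (Matrix ι ι ℂ)} [Nonempty ι]
    (hG : IsClosed (G : Set (Matrix ι ι ℂ))) {κ : Type*} (s : Finset κ) (H : κ → Matrix ι ι ℂ)
    (h : ∀ i ∈ s, H i ∈ generators (G : Set (Matrix ι ι ℂ))) :
    ∑ i ∈ s, H i ∈ generators (G : Set (Matrix ι ι ℂ)) := by
  classical
  induction s using Finset.induction_on with
  | empty => simpa using zero_mem_generators G
  | insert a s ha ih =>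
    rw [Finset.sum_insert ha]
    exact add_mem_generators hG (h a (Finset.mem_insert_self a s))
      (ih fun i hi => h i (Finset.mem_insert_of_mem hi))

/-- Every unitary matrix is a phase times the exponential of a Hermitian matrix. -/
theorem exists_exp_of_unitary {U : Matrix ι ι ℂ} (hU : U ∈ unitary (Matrix ι ι ℂ)) :
    ∃ (c : ℂ) (H : Matrix ι ι ℂ), ‖c‖ = 1 ∧ H.IsHermitian ∧
      c • U = NormedSpace.exp (Complex.I • H) := by
  have hfin : (spectrum ℂ U).Finite := Matrix.finite_spectrum U
  -- The spectrum is finite and the circle infinite, so some phase `c` moves every eigenvalue away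
  -- from `-1`. Then `c • U` is at distance less than two from `1` and has a principal logarithm.
  have hinf : (Metric.sphere (0 : ℂ) 1).Infinite := by
    refine (isPreconnected_sphere (by simp [Complex.rank_real_complex]) _ _).infinite_of_nontrivial
      ⟨1, by simp, -1, by simp, by norm_num⟩
  obtain ⟨c, hc, hcs⟩ : ∃ c ∈ Metric.sphere (0 : ℂ) 1, c ∉ (fun z => -z⁻¹) '' spectrum ℂ U :=
    (hinf.sdiff (hfin.image _)).nonempty
  have hc1 : ‖c‖ = 1 := by simpa using hc
  have hc0 : c ≠ 0 := fun h0 => by simp [h0] at hc1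
  have hcu : c • U ∈ unitary (Matrix ι ι ℂ) := by
    have := Complex.mul_conj c
    rw [Complex.normSq_eq_norm_sq, hc1] at this
    have h2 : star c * c = 1 := by rw [mul_comm]; simpa using this
    rw [Unitary.mem_iff] at hU ⊢
    rw [star_smul, smul_mul_smul_comm, smul_mul_smul_comm, hU.1, hU.2, mul_comm c, h2, one_smul]
    exact ⟨rfl, rfl⟩
  have hs : -1 ∉ spectrum ℂ (c • U) := by
    intro h
    refine hcs ⟨-c⁻¹, ?_, by simp⟩
    have := spectrum.unit_smul_eq_smul U (Units.mk0 c hc0)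
    rw [show (Units.mk0 c hc0) • U = c • U from rfl] at this
    rw [this] at h
    obtain ⟨z, hz, hz2⟩ := h
    have hz3 : c * z = -1 := hz2
    have : z = -c⁻¹ := by field_simp; linear_combination hz3
    rwa [← this]
  have hlt := (Unitary.norm_sub_one_lt_two_iff hcu).2 hs
  have he := expUnitary_argSelfAdjoint (u := ⟨c • U, hcu⟩) hlt
  refine ⟨c, _, hc1, (Unitary.argSelfAdjoint (⟨c • U, hcu⟩ : unitary (Matrix ι ι ℂ))).2, ?_⟩
  exact (congrArg Subtype.val he).symm

end Trotter

/-! ### Density of the one-qubit gates -/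

/-- The one-qubit gates: `Z`- and `X`-rotations by multiples of `π/4`. -/
def qubitGates : Set (Matrix (Fin 2) (Fin 2) ℂ) :=
  {A | ∃ m : ℤ, A = cis (m * (Real.pi / 8)) sigmaZ ∨ A = cis (m * (Real.pi / 8)) sigmaX}

/-- `A` is a product of at most `l` one-qubit gates. -/
def QubitWord (l : ℕ) (A : Matrix (Fin 2) (Fin 2) ℂ) : Prop :=
  ∃ w : List (Matrix (Fin 2) (Fin 2) ℂ), (∀ g ∈ w, g ∈ qubitGates) ∧ w.length ≤ l ∧ w.prod = A

/-- The special unitary matrices of size two. -/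
def su2 : Set (Matrix (Fin 2) (Fin 2) ℂ) :=
  {U | U ∈ unitary (Matrix (Fin 2) (Fin 2) ℂ) ∧ U.det = 1}

theorem det_cis_sigmaZ (θ : ℝ) : (cis θ sigmaZ).det = 1 := by
  rw [det_fin_two]
  change (_ * (1 : ℂ) + _ * (1 : ℂ)) * (_ * (1 : ℂ) + _ * (-1 : ℂ))
    - (_ * (0 : ℂ) + _ * (0 : ℂ)) * (_ * (0 : ℂ) + _ * (0 : ℂ)) = 1
  have h : (Real.sin θ : ℂ) ^ 2 + (Real.cos θ : ℂ) ^ 2 = 1 := by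
    exact_mod_cast Real.sin_sq_add_cos_sq θ
  linear_combination h - (Real.sin θ : ℂ) ^ 2 * Complex.I_sq

theorem det_hGate_mul_self : hGate.det * hGate.det = 1 := by
  rw [← det_mul, hGate_mul_self, det_one]

theorem cis_sigmaX_eq (θ : ℝ) : cis θ sigmaX = hGate * cis θ sigmaZ * hGate := by
  rw [mul_cis hGate_mul_sigmaZ, mul_assoc, hGate_mul_self, mul_one]

theorem det_cis_sigmaX (θ : ℝ) : (cis θ sigmaX).det = 1 := by
  rw [cis_sigmaX_eq, det_mul, det_mul, det_cis_sigmaZ, mul_one, det_hGate_mul_self]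

theorem mul_mem_su2 {U V : Matrix (Fin 2) (Fin 2) ℂ} (hU : U ∈ su2) (hV : V ∈ su2) :
    U * V ∈ su2 :=
  ⟨mul_mem hU.1 hV.1, by rw [det_mul, hU.2, hV.2, one_mul]⟩

theorem star_mem_su2 {U : Matrix (Fin 2) (Fin 2) ℂ} (hU : U ∈ su2) : star U ∈ su2 :=
  ⟨Unitary.star_mem hU.1, by rw [star_eq_conjTranspose, det_conjTranspose, hU.2, star_one]⟩

theorem cis_sigmaZ_mem_su2 (θ : ℝ) : cis θ sigmaZ ∈ su2 :=
  ⟨cis_mem_unitary sigmaZ_mul_self sigmaZ_conjTranspose θ, det_cis_sigmaZ θ⟩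

theorem cis_sigmaX_mem_su2 (θ : ℝ) : cis θ sigmaX ∈ su2 :=
  ⟨cis_mem_unitary sigmaX_mul_self sigmaX_conjTranspose θ, det_cis_sigmaX θ⟩

theorem qubitGates_subset_su2 : qubitGates ⊆ su2 := by
  rintro A ⟨m, rfl | rfl⟩
  · exact cis_sigmaZ_mem_su2 _
  · exact cis_sigmaX_mem_su2 _

theorem star_mem_qubitGates {A : Matrix (Fin 2) (Fin 2) ℂ} (hA : A ∈ qubitGates) :
    star A ∈ qubitGates := by
  obtain ⟨m, rfl | rfl⟩ := hA
  · refine ⟨-m, Or.inl ?_⟩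
    rw [star_cis sigmaZ_conjTranspose, Int.cast_neg, neg_mul]
  · refine ⟨-m, Or.inr ?_⟩
    rw [star_cis sigmaX_conjTranspose, Int.cast_neg, neg_mul]

theorem QubitWord.mul {a b : ℕ} {A B : Matrix (Fin 2) (Fin 2) ℂ} (hA : QubitWord a A)
    (hB : QubitWord b B) : QubitWord (a + b) (A * B) := by
  obtain ⟨w, hw, hl, rfl⟩ := hA
  obtain ⟨w', hw', hl', rfl⟩ := hB
  refine ⟨w ++ w', fun g hg => ?_, ?_, List.prod_append⟩
  · rcases List.mem_append.1 hg with h | h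
    · exact hw g h
    · exact hw' g h
  · rw [List.length_append]
    exact add_le_add hl hl'

theorem QubitWord.star {a : ℕ} {A : Matrix (Fin 2) (Fin 2) ℂ} (hA : QubitWord a A) :
    QubitWord a (star A) := by
  obtain ⟨w, hw, hl, rfl⟩ := hA
  refine ⟨(w.map Star.star).reverse, fun g hg => ?_, by simpa using hl, ?_⟩
  · rw [List.mem_reverse, List.mem_map] at hg
    obtain ⟨h, hh, rfl⟩ := hg
    exact star_mem_qubitGates (hw h hh)
  · clear hw hl
    induction w with
    | nil => simp
    | cons x w ih =>
      rw [List.map_cons, List.reverse_cons, List.prod_append, ih, List.prod_singleton,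
        List.prod_cons, star_mul]

theorem QubitWord.mono {a b : ℕ} {A : Matrix (Fin 2) (Fin 2) ℂ} (hA : QubitWord a A)
    (h : a ≤ b) : QubitWord b A := by
  obtain ⟨w, hw, hl, hp⟩ := hA
  exact ⟨w, hw, hl.trans h, hp⟩

theorem QubitWord.mem_su2 {a : ℕ} {A : Matrix (Fin 2) (Fin 2) ℂ} (hA : QubitWord a A) :
    A ∈ su2 := by
  obtain ⟨w, hw, -, rfl⟩ := hA
  induction w with
  | nil => exact ⟨one_mem _, det_one⟩
  | cons x w ih =>
    rw [List.prod_cons]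
    exact mul_mem_su2 (qubitGates_subset_su2 (hw x List.mem_cons_self))
      (ih fun g hg => hw g (List.mem_cons_of_mem x hg))

/-- The angle of the rotation `e^{iπZ/8} e^{iπX/8}`. -/
def irrAngle : ℝ := Real.arccos (Real.cos (Real.pi / 8) ^ 2)

theorem cos_irrAngle : Real.cos irrAngle = Real.cos (Real.pi / 8) ^ 2 :=
  Real.cos_arccos (by nlinarith [sq_nonneg (Real.cos (Real.pi / 8))]) (Real.cos_sq_le_one _)

theorem two_mul_cos_irrAngle : 2 * Real.cos irrAngle = 1 + Real.sqrt 2 / 2 := by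
  rw [cos_irrAngle, Real.cos_sq, show 2 * (Real.pi / 8) = Real.pi / 4 by ring,
    Real.cos_pi_div_four]
  ring

/-- For a rational multiple of `2π`, both `e^{±iθ}` would be roots of unity, so `2 cos θ - 1 = √2/2`
would be an algebraic integer. Its square is `1/2`, which is not. -/
theorem irrational_irrAngle : Irrational (irrAngle / (2 * Real.pi)) := by
  rintro ⟨r, hr⟩
  have hpi : (2 * Real.pi) ≠ 0 := by positivity
  have h1 : (r.den : ℝ) * irrAngle = r.num * (2 * Real.pi) := by
    have h2 : irrAngle = r * (2 * Real.pi) := by rw [hr]; field_simp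
    have h3 : (r.den : ℝ) * r = r.num := by exact_mod_cast Rat.den_mul_eq_num r
    rw [h2, ← mul_assoc, h3]
  have hint : ∀ z : ℂ, z ^ r.den = 1 → IsIntegral ℤ z := by
    intro z hz
    refine IsIntegral.of_pow r.den_pos ?_
    rw [hz]
    exact isIntegral_one
  have e1 : IsIntegral ℤ (Complex.exp (irrAngle * Complex.I)) := by
    refine hint _ ?_
    rw [← Complex.exp_nat_mul, Complex.exp_eq_one_iff]
    refine ⟨r.num, ?_⟩
    have h2 : ((r.den : ℂ)) * irrAngle = r.num * (2 * Real.pi) := by exact_mod_cast h1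
    linear_combination Complex.I * h2
  have e2 : IsIntegral ℤ (Complex.exp (-irrAngle * Complex.I)) := by
    refine hint _ ?_
    rw [← Complex.exp_nat_mul, Complex.exp_eq_one_iff]
    refine ⟨-r.num, ?_⟩
    have h2 : ((r.den : ℂ)) * irrAngle = r.num * (2 * Real.pi) := by exact_mod_cast h1
    push_cast
    linear_combination -Complex.I * h2
  have e3 : Complex.exp (irrAngle * Complex.I) + Complex.exp (-irrAngle * Complex.I) - 1
      = ((Real.sqrt 2 / 2 : ℝ) : ℂ) := by
    rw [← Complex.two_cos, ← Complex.ofReal_cos]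
    have := two_mul_cos_irrAngle
    rw [show Real.sqrt 2 / 2 = 2 * Real.cos irrAngle - 1 by linarith]
    push_cast
    ring
  have e4 : IsIntegral ℤ (((Real.sqrt 2 / 2 : ℝ) : ℂ) ^ 2) := by
    rw [← e3]
    exact ((e1.add e2).sub isIntegral_one).pow 2
  have e5 : ((Real.sqrt 2 / 2 : ℝ) : ℂ) ^ 2 = algebraMap ℚ ℂ (1 / 2) := by
    rw [← Complex.ofReal_pow, div_pow, Real.sq_sqrt (by norm_num)]
    norm_num
  rw [e5, isIntegral_algebraMap_iff (algebraMap ℚ ℂ).injective,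
    IsIntegrallyClosed.isIntegral_iff] at e4
  obtain ⟨y, hy⟩ := e4
  have h2 : (2 * y : ℤ) = 1 := by
    have : (2 * (y : ℚ)) = 1 := by
      rw [show (y : ℚ) = algebraMap ℤ ℚ y from rfl, hy]
      norm_num
    exact_mod_cast this
  omega

/-- The closure of the group generated by the one-qubit gates. -/
def qubitClosure : Submonoid (Matrix (Fin 2) (Fin 2) ℂ) :=
  (Submonoid.closure qubitGates).topologicalClosure

theorem isClosed_qubitClosure : IsClosed (qubitClosure : Set (Matrix (Fin 2) (Fin 2) ℂ)) :=
  Submonoid.isClosed_topologicalClosure _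

theorem subset_qubitClosure {A : Matrix (Fin 2) (Fin 2) ℂ} (hA : A ∈ qubitGates) :
    A ∈ qubitClosure :=
  Submonoid.le_topologicalClosure _ (Submonoid.subset_closure hA)

theorem smul_sigmaZ_mem : Complex.I • sigmaZ ∈ qubitClosure ∧
    star (Complex.I • sigmaZ) ∈ qubitClosure ∧
    Complex.I • sigmaZ ∈ unitary (Matrix (Fin 2) (Fin 2) ℂ) := by
  have h : Complex.I • sigmaZ ∈ qubitGates := by
    refine ⟨4, Or.inl ?_⟩
    rw [← cis_pi_div_two]
    congr 1
    push_cast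
    ring
  exact ⟨subset_qubitClosure h, subset_qubitClosure (star_mem_qubitGates h),
    (qubitGates_subset_su2 h).1⟩

theorem smul_sigmaX_mem : Complex.I • sigmaX ∈ qubitClosure ∧
    star (Complex.I • sigmaX) ∈ qubitClosure ∧
    Complex.I • sigmaX ∈ unitary (Matrix (Fin 2) (Fin 2) ℂ) := by
  have h : Complex.I • sigmaX ∈ qubitGates := by
    refine ⟨4, Or.inr ?_⟩
    rw [← cis_pi_div_two]
    congr 1
    push_cast
    ring
  exact ⟨subset_qubitClosure h, subset_qubitClosure (star_mem_qubitGates h),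
    (qubitGates_subset_su2 h).1⟩

/-- The unnormalised axis of the rotation `e^{iπZ/8} e^{iπX/8}`. -/
def irrAxis : Matrix (Fin 2) (Fin 2) ℂ :=
  ((Real.cos (Real.pi / 8) * Real.sin (Real.pi / 8) : ℝ) : ℂ) • sigmaZ
    + ((Real.cos (Real.pi / 8) * Real.sin (Real.pi / 8) : ℝ) : ℂ) • sigmaX
    + ((-(Real.sin (Real.pi / 8) ^ 2) : ℝ) : ℂ) • sigmaY

theorem irrAxis_eq (x y : ℝ) : ((x : ℝ) : ℂ) • sigmaZ + ((x : ℝ) : ℂ) • sigmaX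
    + ((y : ℝ) : ℂ) • sigmaY = !![(x : ℂ), x - y * Complex.I; x + y * Complex.I, -x] := by
  ext i j
  fin_cases i <;> fin_cases j <;> simp [sigmaX, sigmaY, sigmaZ, sub_eq_add_neg]

theorem sin_irrAngle_pos : 0 < Real.sin irrAngle := by
  rw [irrAngle, Real.sin_arccos]
  refine Real.sqrt_pos.2 ?_
  have h1 : Real.cos (Real.pi / 8) ^ 2 < 1 := by
    have := Real.sin_pos_of_pos_of_lt_pi (x := Real.pi / 8) (by positivity)
      (by linarith [Real.pi_pos])
    nlinarith [Real.sin_sq_add_cos_sq (Real.pi / 8)]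
  nlinarith [sq_nonneg (Real.cos (Real.pi / 8))]

theorem irrAxis_mul_self : irrAxis * irrAxis = ((Real.sin irrAngle ^ 2 : ℝ) : ℂ) • 1 := by
  have h : Real.sin irrAngle ^ 2 = 1 - (Real.cos (Real.pi / 8) ^ 2) ^ 2 := by
    rw [Real.sin_sq, cos_irrAngle]
  have h2 := Real.sin_sq_add_cos_sq (Real.pi / 8)
  rw [irrAxis, irrAxis_eq, Matrix.one_fin_two]
  set c := Real.cos (Real.pi / 8)
  set s := Real.sin (Real.pi / 8)
  have h3 : ((Real.sin irrAngle ^ 2 : ℝ) : ℂ) = ((2 * (c * s) ^ 2 + (s ^ 2) ^ 2 : ℝ) : ℂ) := by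
    rw [h]
    congr 1
    rw [show s ^ 2 = 1 - c ^ 2 by linarith, mul_pow, show s ^ 2 = 1 - c ^ 2 by linarith]
    ring
  rw [h3]
  have hi := Complex.I_sq
  clear_value c s
  ext i j
  fin_cases i <;> fin_cases j <;> simp
  · linear_combination (-(s : ℂ) ^ 4) * hi
  · ring
  · ring
  · linear_combination (-(s : ℂ) ^ 4) * hi

/-- The product expands to `cos² + i cos sin (Z + X) - sin² Z X`, and `Z X = i Y` identifies angle
and axis. -/
theorem cis_mul_cis_eq :
    cis (Real.pi / 8) sigmaZ * cis (Real.pi / 8) sigmaX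
      = cis irrAngle (((Real.sin irrAngle)⁻¹ : ℂ) • irrAxis) := by
  have hs : (Real.sin irrAngle : ℂ) ≠ 0 := by exact_mod_cast sin_irrAngle_pos.ne'
  rw [cis.eq_1 irrAngle, smul_smul, mul_assoc, mul_inv_cancel₀ hs, mul_one, cos_irrAngle, irrAxis]
  simp only [cis, add_mul, mul_add, smul_mul_smul_comm, one_mul, mul_one, sigmaZ_mul_sigmaX]
  push_cast
  have hi := Complex.I_sq
  match_scalars <;> grind

theorem axis_mul_self : ((Real.sin irrAngle : ℂ)⁻¹ • irrAxis) *
    ((Real.sin irrAngle : ℂ)⁻¹ • irrAxis) = 1 := by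
  have hs : (Real.sin irrAngle : ℂ) ≠ 0 := by exact_mod_cast sin_irrAngle_pos.ne'
  rw [smul_mul_smul_comm, irrAxis_mul_self, smul_smul, Complex.ofReal_pow]
  rw [show (Real.sin irrAngle : ℂ)⁻¹ * (Real.sin irrAngle : ℂ)⁻¹ * (Real.sin irrAngle : ℂ) ^ 2 = 1 by
    field_simp, one_smul]

theorem isHermitian_smul {ι : Type*} {A : Matrix ι ι ℂ} (hA : A.IsHermitian) (r : ℝ) :
    ((r : ℂ) • A).IsHermitian := by
  rw [IsHermitian, conjTranspose_smul, hA.eq]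
  simp

theorem irrAxis_isHermitian : irrAxis.IsHermitian :=
  ((isHermitian_smul sigmaZ_conjTranspose _).add (isHermitian_smul sigmaX_conjTranspose _)).add
    (isHermitian_smul sigmaY_conjTranspose _)

/-- Integer combinations of an irrational multiple of `2π` and `2π` itself are dense in `ℝ`, so a
closed set containing these rotations contains the whole one-parameter group. -/
theorem cis_axis_mem (t : ℝ) : cis t ((Real.sin irrAngle : ℂ)⁻¹ • irrAxis) ∈ qubitClosure := by
  set P := (Real.sin irrAngle : ℂ)⁻¹ • irrAxis with hP
  have hPP : P * P = 1 := axis_mul_self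
  have hPs : star P = P := by
    rw [hP, ← Complex.ofReal_inv]
    exact isHermitian_smul irrAxis_isHermitian _
  have hz : cis (Real.pi / 8) sigmaZ ∈ qubitGates := ⟨1, Or.inl (by simp)⟩
  have hx : cis (Real.pi / 8) sigmaX ∈ qubitGates := ⟨1, Or.inr (by simp)⟩
  have hg : cis irrAngle P ∈ qubitClosure := by
    rw [hP, ← cis_mul_cis_eq]
    exact mul_mem (subset_qubitClosure hz) (subset_qubitClosure hx)
  have hg' : cis (-irrAngle) P ∈ qubitClosure := by
    rw [← star_cis hPs, hP, ← cis_mul_cis_eq, star_mul]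
    exact mul_mem (subset_qubitClosure (star_mem_qubitGates hx))
      (subset_qubitClosure (star_mem_qubitGates hz))
  have h2pi : cis (2 * Real.pi) P = 1 := by
    have := cis_add_two_pi 0 P 1
    rwa [zero_add, Int.cast_one, one_mul, cis_zero] at this
  have h2pi' : cis (-(2 * Real.pi)) P = 1 := by
    have := cis_add_two_pi 0 P (-1)
    rwa [zero_add, Int.cast_neg, Int.cast_one, neg_one_mul, cis_zero] at this
  -- Both signs are carried along, since the target is a monoid and the case of negation needs the
  -- inverse rotation.
  have hcl : ∀ x ∈ AddSubgroup.closure {irrAngle, 2 * Real.pi},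
      cis x P ∈ qubitClosure ∧ cis (-x) P ∈ qubitClosure := by
    intro x hx
    induction hx using AddSubgroup.closure_induction with
    | mem x hx =>
      rcases hx with rfl | hx
      · exact ⟨hg, hg'⟩
      · rw [Set.mem_singleton_iff] at hx
        rw [hx, h2pi, h2pi']
        exact ⟨one_mem _, one_mem _⟩
    | zero => rw [neg_zero, cis_zero]; exact ⟨one_mem _, one_mem _⟩
    | add x y _ _ hx hy =>
      rw [neg_add, ← cis_mul hPP, ← cis_mul hPP]
      exact ⟨mul_mem hx.1 hy.1, mul_mem hx.2 hy.2⟩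
    | neg x _ hx => rw [neg_neg]; exact ⟨hx.2, hx.1⟩
  have hd := dense_addSubgroupClosure_pair_iff.2 irrational_irrAngle
  have hcont : Continuous fun t : ℝ => cis t P := by
    unfold cis
    fun_prop
  have hc : IsClosed ((fun t : ℝ => cis t P) ⁻¹' (qubitClosure : Set (Matrix (Fin 2) (Fin 2) ℂ))) :=
    isClosed_qubitClosure.preimage hcont
  exact hc.closure_subset_iff.2 (fun x hx => (hcl x hx).1) (hd t)

theorem irrAxis_mem_generators : irrAxis ∈ generators (qubitClosure : Set _) := by
  have h := mem_generators_of_cis (G := (qubitClosure : Set _)) axis_mul_self ?_ cis_axis_mem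
  · have h2 := smul_mem_generators h (Real.sin irrAngle)
    have hs : (Real.sin irrAngle : ℂ) ≠ 0 := by exact_mod_cast sin_irrAngle_pos.ne'
    rwa [smul_smul, mul_inv_cancel₀ hs, one_smul] at h2
  · rw [← Complex.ofReal_inv]
    exact isHermitian_smul irrAxis_isHermitian _

theorem conj_smul_I (σ A : Matrix (Fin 2) (Fin 2) ℂ) (hσ : σᴴ = σ) :
    (Complex.I • σ) * A * star (Complex.I • σ) = σ * A * σ := by
  rw [star_smul, star_eq_conjTranspose σ, hσ, smul_mul_assoc, mul_smul_comm, smul_mul_assoc,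
    smul_smul]
  simp

/-- Conjugation by `Z` negates the `X` and `Y` components, so averaging isolates the `Z` component.
No second irrational rotation is needed. -/
theorem irrAxis_add_conj_sigmaZ : irrAxis + sigmaZ * irrAxis * sigmaZ
    = ((2 * (Real.cos (Real.pi / 8) * Real.sin (Real.pi / 8)) : ℝ) : ℂ) • sigmaZ := by
  rw [irrAxis, irrAxis_eq]
  generalize Real.cos (Real.pi / 8) = c
  generalize Real.sin (Real.pi / 8) = s
  ext i j
  fin_cases i <;> fin_cases j <;> simp [sigmaZ] <;> ring

theorem irrAxis_add_conj_sigmaX : irrAxis + sigmaX * irrAxis * sigmaX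
    = ((2 * (Real.cos (Real.pi / 8) * Real.sin (Real.pi / 8)) : ℝ) : ℂ) • sigmaX := by
  rw [irrAxis, irrAxis_eq]
  generalize Real.cos (Real.pi / 8) = c
  generalize Real.sin (Real.pi / 8) = s
  ext i j
  fin_cases i <;> fin_cases j <;> simp [sigmaX] <;> ring

theorem mem_generators_of_smul {G : Set (Matrix (Fin 2) (Fin 2) ℂ)} {A : Matrix (Fin 2) (Fin 2) ℂ}
    {r : ℝ} (hr : r ≠ 0) (h : (r : ℂ) • A ∈ generators G) : A ∈ generators G := by
  have h2 := smul_mem_generators h r⁻¹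
  have hr' : (r : ℂ) ≠ 0 := by exact_mod_cast hr
  rwa [smul_smul, Complex.ofReal_inv, inv_mul_cancel₀ hr', one_smul] at h2

/-- The `Z` and `X` components of `irrAxis` are isolated by averaging over conjugates. Subtracting
them leaves a nonzero multiple of `Y`. -/
theorem pauli_mem_generators : sigmaX ∈ generators (qubitClosure : Set _) ∧
    sigmaY ∈ generators (qubitClosure : Set _) ∧ sigmaZ ∈ generators (qubitClosure : Set _) := by
  have hcl := isClosed_qubitClosure
  have hM := irrAxis_mem_generators
  have hz := conj_mem_generators hM smul_sigmaZ_mem.1 smul_sigmaZ_mem.2.1 smul_sigmaZ_mem.2.2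
  have hx := conj_mem_generators hM smul_sigmaX_mem.1 smul_sigmaX_mem.2.1 smul_sigmaX_mem.2.2
  rw [conj_smul_I _ _ sigmaZ_conjTranspose] at hz
  rw [conj_smul_I _ _ sigmaX_conjTranspose] at hx
  have h1 := add_mem_generators hcl hM hz
  have h2 := add_mem_generators hcl hM hx
  rw [irrAxis_add_conj_sigmaZ] at h1
  rw [irrAxis_add_conj_sigmaX] at h2
  have hs : 0 < Real.sin (Real.pi / 8) :=
    Real.sin_pos_of_pos_of_lt_pi (by positivity) (by linarith [Real.pi_pos])
  have hc : 0 < Real.cos (Real.pi / 8) :=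
    Real.cos_pos_of_mem_Ioo ⟨by linarith [Real.pi_pos], by linarith [Real.pi_pos]⟩
  have eZ := mem_generators_of_smul (by positivity) h1
  have eX := mem_generators_of_smul (by positivity) h2
  refine ⟨eX, mem_generators_of_smul (r := -(Real.sin (Real.pi / 8) ^ 2))
    (neg_ne_zero.2 (by positivity)) ?_, eZ⟩
  have h3 := add_mem_generators hcl (add_mem_generators hcl hM
    (smul_mem_generators eZ (-(Real.cos (Real.pi / 8) * Real.sin (Real.pi / 8)))))
    (smul_mem_generators eX (-(Real.cos (Real.pi / 8) * Real.sin (Real.pi / 8))))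
  convert h3 using 1
  rw [irrAxis, Complex.ofReal_neg (_ * _)]
  module

theorem traceless_mem_generators {A : Matrix (Fin 2) (Fin 2) ℂ} (hA : A.IsHermitian)
    (h0 : A 0 0 + A 1 1 = 0) : A ∈ generators (qubitClosure : Set _) := by
  obtain ⟨hx, hy, hz⟩ := pauli_mem_generators
  have hcl := isClosed_qubitClosure
  have h := add_mem_generators hcl (add_mem_generators hcl
    (smul_mem_generators hz (A 0 0).re) (smul_mem_generators hx (A 0 1).re))
    (smul_mem_generators hy (-(A 0 1).im))
  convert h using 1
  have e0 : A 0 0 = ((A 0 0).re : ℂ) := (Complex.conj_eq_iff_re.1 (hA.apply 0 0)).symm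
  have e1 : A 1 0 = star (A 0 1) := (hA.apply 1 0).symm
  have e2 : A 1 1 = -A 0 0 := by linear_combination h0
  rw [Matrix.eta_fin_two A, e1, e2, e0, sigmaX, sigmaY, sigmaZ]
  generalize A 0 1 = b
  have hb : star b = b.re - b.im * Complex.I := by
    apply Complex.ext <;> simp
  rw [hb]
  nth_rewrite 1 [← Complex.re_add_im b]
  ext i j
  fin_cases i <;> fin_cases j <;> simp
  ring

/-! ### Normal form of special unitaries -/

theorem exists_cos_sin {x y : ℝ} (h : x ^ 2 + y ^ 2 = 1) :
    ∃ t : ℝ, x = Real.cos t ∧ y = Real.sin t := by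
  have hn : ‖(⟨x, y⟩ : ℂ)‖ = 1 := by
    rw [Complex.norm_def, Complex.normSq_mk, Real.sqrt_eq_one]
    linarith
  have h0 : (⟨x, y⟩ : ℂ) ≠ 0 := fun h0 => by rw [h0] at hn; simp at hn
  refine ⟨Complex.arg ⟨x, y⟩, ?_, ?_⟩
  · rw [Complex.cos_arg h0, hn, div_one]
  · rw [Complex.sin_arg, hn, div_one]

theorem star_eq_adjugate {U : Matrix (Fin 2) (Fin 2) ℂ} (hU : U ∈ su2) :
    star U = U.adjugate := by
  have h1 : U.adjugate * U = 1 := by rw [adjugate_mul, hU.2, one_smul]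
  have h2 := (Unitary.mem_iff.1 hU.1).2
  calc star U = U.adjugate * U * star U := by rw [h1, one_mul]
    _ = U.adjugate := by rw [mul_assoc, h2, mul_one]

theorem exists_conj_sigmaZ {K : Matrix (Fin 2) (Fin 2) ℂ} (hK : K.IsHermitian)
    (htr : K.trace = 0) : ∃ (y : ℝ) (S : Matrix (Fin 2) (Fin 2) ℂ),
      S ∈ unitary (Matrix (Fin 2) (Fin 2) ℂ) ∧ K = S * ((y : ℂ) • sigmaZ) * star S := by
  have htr2 := hK.trace_eq_sum_eigenvalues
  have htr0 : hK.eigenvalues 1 = -hK.eigenvalues 0 := by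
    rw [htr, Fin.sum_univ_two] at htr2
    have h2 : ((hK.eigenvalues 0 + hK.eigenvalues 1 : ℝ) : ℂ) = 0 := by
      rw [Complex.ofReal_add]
      exact htr2.symm
    have h3 : hK.eigenvalues 0 + hK.eigenvalues 1 = 0 := by exact_mod_cast h2
    linarith
  have hdiag : diagonal (RCLike.ofReal ∘ hK.eigenvalues : Fin 2 → ℂ)
      = (hK.eigenvalues 0 : ℂ) • sigmaZ := by
    ext i j
    fin_cases i <;> fin_cases j <;> simp [sigmaZ]
    rw [htr0, Complex.ofReal_neg]
  have hspec := hK.spectral_theorem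
  rw [Unitary.conjStarAlgAut_apply, hdiag] at hspec
  exact ⟨_, _, hK.eigenvectorUnitary.2, hspec⟩

/-- Diagonalisation in `SU(2)`. -/
theorem exists_conj_diagonal {U : Matrix (Fin 2) (Fin 2) ℂ} (hU : U ∈ su2) :
    ∃ (x y : ℝ) (S : Matrix (Fin 2) (Fin 2) ℂ), S ∈ unitary (Matrix (Fin 2) (Fin 2) ℂ) ∧
      U = S * ((x : ℂ) • 1 + (Complex.I * (y : ℂ)) • sigmaZ) * star S ∧ x ^ 2 + y ^ 2 = 1 := by
  have hadj := star_eq_adjugate hU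
  -- As `star U` is the adjugate, the Hermitian part of `U` is scalar. The skew part is `i` times a
  -- traceless Hermitian matrix, hence unitarily conjugate to a multiple of `Z`, and the determinant
  -- puts `(x, y)` on the unit circle.
  have hsum : U + star U = (U 0 0 + U 1 1) • 1 := by
    rw [hadj, adjugate_fin_two]
    ext i j
    fin_cases i <;> fin_cases j <;> simp [add_comm]
  have hreal : U 0 0 + U 1 1 = ((U 0 0 + U 1 1).re : ℂ) := by
    have e0 : star (U 0 0) = U 1 1 := by
      have := congrFun (congrFun hadj 0) 0
      rw [adjugate_fin_two] at this
      exact this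
    refine (Complex.conj_eq_iff_re.1 ?_).symm
    rw [← e0, starRingEnd_apply, star_add, star_star, add_comm]
  have hK : ((-(Complex.I / 2)) • (U - star U)).IsHermitian := by
    rw [IsHermitian, ← star_eq_conjTranspose, star_smul, star_sub, star_star]
    have : star (-(Complex.I / 2)) = Complex.I / 2 := by
      apply Complex.ext
      · simp
      · simp
        norm_num
    rw [this]
    module
  have htr : ((-(Complex.I / 2)) • (U - star U)).trace = 0 := by
    rw [trace_smul, trace_sub, hadj, adjugate_fin_two, trace_fin_two, trace_fin_two]
    simp [add_comm]
  obtain ⟨y, S, hS, hspec⟩ := exists_conj_sigmaZ hK htr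
  have hSS := (Unitary.mem_iff.1 hS).2
  have hUeq : U = S * ((((U 0 0 + U 1 1).re / 2 : ℝ) : ℂ) • 1 +
      (Complex.I * (y : ℂ)) • sigmaZ) * star S := by
    have h1 : U = (1 / 2 : ℂ) • (U + star U) + Complex.I • ((-(Complex.I / 2)) • (U - star U)) := by
      rw [smul_smul, show Complex.I * -(Complex.I / 2) = 1 / 2 by
        linear_combination (-1 / 2 : ℂ) * Complex.I_mul_I]
      module
    conv_lhs => rw [h1, hspec, hsum, hreal]
    rw [mul_add, add_mul, mul_smul_comm, mul_smul_comm, mul_smul_comm, mul_one, smul_mul_assoc,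
      smul_mul_assoc, smul_mul_assoc, hSS, smul_smul, smul_smul]
    congr 2
    push_cast
    ring
  refine ⟨_, _, S, hS, hUeq, ?_⟩
  have hdet := hU.2
  rw [hUeq, det_mul, det_mul, mul_right_comm, ← det_mul, hSS, det_one, one_mul, det_fin_two] at hdet
  generalize (U 0 0 + U 1 1).re / 2 = x at hdet
  simp [sigmaZ] at hdet
  have h2 : ((x ^ 2 + y ^ 2 : ℝ) : ℂ) = 1 := by
    push_cast
    linear_combination hdet + (y : ℂ) ^ 2 * Complex.I_sq
  exact_mod_cast h2

/-- In normal form `U = cis t (S Z S*)`, and `S Z S*` is Hermitian and traceless, so it generates a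
one-parameter group inside the closure. -/
theorem su2_subset_qubitClosure : su2 ⊆ (qubitClosure : Set (Matrix (Fin 2) (Fin 2) ℂ)) := by
  intro U hU
  obtain ⟨x, y, S, hS, rfl, hxy⟩ := exists_conj_diagonal hU
  obtain ⟨t, rfl, rfl⟩ := exists_cos_sin hxy
  have hSS := Unitary.mem_iff.1 hS
  have hP : (S * sigmaZ * star S) * (S * sigmaZ * star S) = 1 := by
    calc (S * sigmaZ * star S) * (S * sigmaZ * star S)
        = S * (sigmaZ * (star S * S) * sigmaZ) * star S := by noncomm_ring
      _ = 1 := by rw [hSS.1, mul_one, sigmaZ_mul_self, mul_one, hSS.2]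
  have hH : (S * sigmaZ * star S).IsHermitian :=
    isHermitian_mul_mul_conjTranspose S sigmaZ_conjTranspose
  have htr : (S * sigmaZ * star S) 0 0 + (S * sigmaZ * star S) 1 1 = 0 := by
    rw [← trace_fin_two, trace_mul_comm, ← mul_assoc, hSS.1, one_mul, trace_fin_two]
    simp [sigmaZ]
  have h := (traceless_mem_generators hH htr).2 t
  rw [exp_eq_cis hP] at h
  convert h using 1
  rw [cis, mul_add, add_mul, mul_smul_comm, mul_smul_comm, mul_one, smul_mul_assoc,
    smul_mul_assoc, hSS.2]

theorem isCompact_su2 : IsCompact su2 := by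
  have hp : ProperSpace (Matrix (Fin 2) (Fin 2) ℂ) := FiniteDimensional.proper ℂ _
  refine Metric.isCompact_of_isClosed_isBounded ?_ ?_
  · have h1 : IsClosed {U : Matrix (Fin 2) (Fin 2) ℂ | star U * U = 1} :=
      isClosed_eq (by fun_prop) continuous_const
    have h2 : IsClosed {U : Matrix (Fin 2) (Fin 2) ℂ | U * star U = 1} :=
      isClosed_eq (by fun_prop) continuous_const
    have h3 : IsClosed {U : Matrix (Fin 2) (Fin 2) ℂ | U.det = 1} :=
      isClosed_eq (Continuous.matrix_det continuous_id) continuous_const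
    exact (h1.inter h2).inter h3
  · refine (Metric.isBounded_closedBall (x := (0 : Matrix (Fin 2) (Fin 2) ℂ)) (r := 1)).subset ?_
    intro U hU
    rw [mem_closedBall_zero_iff]
    exact (CStarRing.norm_of_mem_unitary hU.1).le

/-- Every special unitary is within `ε` of a word of at most `l` one-qubit gates. -/
def Dense2 (l : ℕ) (ε : ℝ) : Prop :=
  ∀ U ∈ su2, ∃ A, QubitWord l A ∧ ‖A - U‖ ≤ ε

/-- Density provides a word for each unitary, and compactness of `SU(2)` bounds the lengths
uniformly. There is no control in terms of `ε`; this only starts the recursion. -/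
theorem exists_dense2 {ε : ℝ} (hε : 0 < ε) : ∃ l, Dense2 l ε := by
  have hword : ∀ A ∈ Submonoid.closure qubitGates, ∃ l, QubitWord l A := by
    intro A hA
    obtain ⟨w, hw, hp⟩ := Submonoid.exists_list_of_mem_closure hA
    exact ⟨w.length, w, hw, le_rfl, hp⟩
  have hcover : su2 ⊆ ⋃ A : Submonoid.closure qubitGates,
      Metric.ball (A : Matrix (Fin 2) (Fin 2) ℂ) ε := by
    intro U hU
    have h : U ∈ closure (Submonoid.closure qubitGates : Set (Matrix (Fin 2) (Fin 2) ℂ)) :=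
      su2_subset_qubitClosure hU
    obtain ⟨A, hA, hd⟩ := Metric.mem_closure_iff.1 h ε hε
    exact Set.mem_iUnion.2 ⟨⟨A, hA⟩, hd⟩
  obtain ⟨t, ht⟩ := isCompact_su2.elim_finite_subcover _ (fun _ => Metric.isOpen_ball) hcover
  choose! len hlen using hword
  refine ⟨t.sup fun A => len A, fun U hU => ?_⟩
  obtain ⟨A, hA⟩ := Set.mem_iUnion.1 (ht hU)
  obtain ⟨hAt, hd⟩ := Set.mem_iUnion.1 hA
  refine ⟨A, (hlen A A.2).mono (Finset.le_sup (f := fun A : Submonoid.closure qubitGates =>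
    len (A : Matrix (Fin 2) (Fin 2) ℂ)) hAt), ?_⟩
  rw [← dist_eq_norm, dist_comm]
  exact (Metric.mem_ball.1 hd).le

/-! ### The Solovay–Kitaev recursion -/

section Commutator

variable {R : Type*} [NormedRing R] [StarRing R]

/-- The group commutator of two unitaries. -/
def grpComm (V W : R) : R := V * W * star V * star W

/-- Near the identity the group commutator is quadratically small: its distance to `1` is governed
by the ring commutator of `V - 1` and `W - 1`. -/
theorem grpComm_sub_one {V W : R} (hV : V ∈ unitary R) (hW : W ∈ unitary R) :
    grpComm V W - 1 = ((V - 1) * (W - 1) - (W - 1) * (V - 1)) * (star V * star W) := by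
  have h1 := (Unitary.mem_iff.1 hV).2
  have h2 := (Unitary.mem_iff.1 hW).2
  have h3 : W * V * (star V * star W) = 1 := by
    rw [mul_assoc, ← mul_assoc V, h1, one_mul, h2]
  calc grpComm V W - 1 = V * W * star V * star W - W * V * (star V * star W) := by rw [h3, grpComm]
    _ = _ := by noncomm_ring

theorem norm_star_mul_star_sub_le [CStarRing R] [Nontrivial R] {V W V' W' : R} {δ : ℝ}
    (hV : V ∈ unitary R) (hW' : W' ∈ unitary R)
    (hVd : ‖V' - V‖ ≤ δ) (hWd : ‖W' - W‖ ≤ δ) :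
    ‖star V' * star W' - star V * star W‖ ≤ 2 * δ := by
  have e : star V' * star W' - star V * star W
      = star (V' - V) * star W' + star V * star (W' - W) := by
    rw [star_sub, star_sub]
    noncomm_ring
  rw [e]
  refine (norm_add_le _ _).trans ?_
  have h1 := norm_mul_le (star (V' - V)) (star W')
  have h2 := norm_mul_le (star V) (star (W' - W))
  rw [norm_star, norm_star, CStarRing.norm_of_mem_unitary hW', mul_one] at h1
  rw [norm_star, norm_star, CStarRing.norm_of_mem_unitary hV, one_mul] at h2
  linarith

/-- The gain behind Solovay–Kitaev: an error `δ` in `V` and `W` enters to first order only through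
the small factor `η`. -/
theorem norm_grpComm_sub_le [CStarRing R] [Nontrivial R] {V W V' W' : R} {δ η : ℝ}
    (hV : V ∈ unitary R) (hW : W ∈ unitary R) (hV' : V' ∈ unitary R) (hW' : W' ∈ unitary R)
    (hVd : ‖V' - V‖ ≤ δ) (hWd : ‖W' - W‖ ≤ δ) (hVη : ‖V - 1‖ ≤ η) (hWη : ‖W - 1‖ ≤ η) :
    ‖grpComm V' W' - grpComm V W‖ ≤ 4 * η * δ + 2 * δ ^ 2 + 4 * η ^ 2 * δ := by
  have hδ : 0 ≤ δ := (norm_nonneg _).trans hVd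
  have hη : 0 ≤ η := (norm_nonneg _).trans hVη
  set v := V - 1 with hv
  set w := W - 1 with hw
  set v' := V' - 1 with hv'
  set w' := W' - 1 with hw'
  have hvd : ‖v' - v‖ ≤ δ := by rwa [hv, hv', sub_sub_sub_cancel_right]
  have hwd : ‖w' - w‖ ≤ δ := by rwa [hw, hw', sub_sub_sub_cancel_right]
  have hvn : ‖v'‖ ≤ η + δ := by
    rw [show v' = v + (v' - v) by abel]
    exact (norm_add_le _ _).trans (add_le_add hVη hvd)
  have hwn : ‖w'‖ ≤ η + δ := by
    rw [show w' = w + (w' - w) by abel]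
    exact (norm_add_le _ _).trans (add_le_add hWη hwd)
  have e : grpComm V' W' - grpComm V W
      = ((v' - v) * w' + v * (w' - w) - ((w' - w) * v' + w * (v' - v))) * (star V' * star W')
        + (v * w - w * v) * (star V' * star W' - star V * star W) := by
    have e1 : grpComm V' W' - 1 = (v' * w' - w' * v') * (star V' * star W') :=
      grpComm_sub_one hV' hW'
    have e2 : grpComm V W - 1 = (v * w - w * v) * (star V * star W) := grpComm_sub_one hV hW
    rw [← sub_sub_sub_cancel_right _ _ (1 : R), e1, e2]
    noncomm_ring
  have hu : ‖star V' * star W'‖ ≤ 1 := by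
    refine (norm_mul_le _ _).trans ?_
    rw [norm_star, norm_star, CStarRing.norm_of_mem_unitary hV', CStarRing.norm_of_mem_unitary hW',
      one_mul]
  have hs := norm_star_mul_star_sub_le hV hW' hVd hWd
  have b1 : ‖(v' - v) * w'‖ ≤ δ * (η + δ) :=
    (norm_mul_le _ _).trans (mul_le_mul hvd hwn (norm_nonneg _) hδ)
  have b2 : ‖v * (w' - w)‖ ≤ η * δ :=
    (norm_mul_le _ _).trans (mul_le_mul hVη hwd (norm_nonneg _) hη)
  have b3 : ‖(w' - w) * v'‖ ≤ δ * (η + δ) :=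
    (norm_mul_le _ _).trans (mul_le_mul hwd hvn (norm_nonneg _) hδ)
  have b4 : ‖w * (v' - v)‖ ≤ η * δ :=
    (norm_mul_le _ _).trans (mul_le_mul hWη hvd (norm_nonneg _) hη)
  have b5 : ‖v * w‖ ≤ η * η := (norm_mul_le _ _).trans (mul_le_mul hVη hWη (norm_nonneg _) hη)
  have b6 : ‖w * v‖ ≤ η * η := (norm_mul_le _ _).trans (mul_le_mul hWη hVη (norm_nonneg _) hη)
  have c1 : ‖(v' - v) * w' + v * (w' - w) - ((w' - w) * v' + w * (v' - v))‖
      ≤ (δ * (η + δ) + η * δ) + (δ * (η + δ) + η * δ) :=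
    (norm_sub_le _ _).trans (add_le_add ((norm_add_le _ _).trans (add_le_add b1 b2))
      ((norm_add_le _ _).trans (add_le_add b3 b4)))
  have c2 : ‖v * w - w * v‖ ≤ η * η + η * η := (norm_sub_le _ _).trans (add_le_add b5 b6)
  rw [e]
  refine (norm_add_le _ _).trans ?_
  have d1 := (norm_mul_le ((v' - v) * w' + v * (w' - w) - ((w' - w) * v' + w * (v' - v)))
    (star V' * star W')).trans (mul_le_mul c1 hu (norm_nonneg _) (by positivity))
  have d2 := (norm_mul_le (v * w - w * v) (star V' * star W' - star V * star W)).trans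
    (mul_le_mul c2 hs (norm_nonneg _) (by positivity))
  nlinarith

theorem norm_conj_sub_one [CStarRing R] {S V : R} (hS : S ∈ unitary R) :
    ‖S * V * star S - 1‖ = ‖V - 1‖ := by
  have h : S * V * star S - 1 = S * (V - 1) * star S := by
    rw [mul_sub, sub_mul, mul_one, (Unitary.mem_iff.1 hS).2]
  rw [h, CStarRing.norm_mul_mem_unitary _ (Unitary.star_mem hS),
    CStarRing.norm_mem_unitary_mul _ hS]

end Commutator

theorem grpComm_conj {R : Type*} [NormedRing R] [StarRing R] {S V W : R} (hS : S ∈ unitary R) :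
    grpComm (S * V * star S) (S * W * star S) = S * grpComm V W * star S := by
  have h1 := (Unitary.mem_iff.1 hS).1
  have h : ∀ A B : R, S * A * star S * (S * B * star S) = S * (A * B) * star S := by
    intro A B
    calc S * A * star S * (S * B * star S) = S * A * (star S * S) * B * star S := by noncomm_ring
      _ = S * (A * B) * star S := by rw [h1]; noncomm_ring
  have h2 : ∀ A : R, star (S * A * star S) = S * star A * star S := by
    intro A
    rw [star_mul, star_mul, star_star, mul_assoc]
  rw [grpComm, h2, h2, h, h, h, grpComm]

theorem conj_mem_su2 {S V : Matrix (Fin 2) (Fin 2) ℂ}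
    (hS : S ∈ unitary (Matrix (Fin 2) (Fin 2) ℂ)) (hV : V ∈ su2) : S * V * star S ∈ su2 := by
  refine ⟨mul_mem (mul_mem hS hV.1) (Unitary.star_mem hS), ?_⟩
  rw [det_mul, det_mul, mul_right_comm, ← det_mul, (Unitary.mem_iff.1 hS).2, hV.2, det_one,
    one_mul]

theorem cis_neg_sigmaY_mem_su2 (θ : ℝ) : cis θ (-sigmaY) ∈ su2 := by
  have h1 : cis (Real.pi / 4) sigmaZ * sigmaX = (-sigmaY) * cis (Real.pi / 4) sigmaZ := by
    rw [cis_pi_div_four_mul sigmaZ_mul_self (by rw [sigmaX_mul_sigmaZ, neg_neg]),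
      sigmaZ_mul_sigmaX, smul_smul, Complex.I_mul_I, neg_one_smul]
  rw [← conj_cis h1 (cis_mul_cis_neg sigmaZ_mul_self _), ← star_cis sigmaZ_conjTranspose]
  exact conj_mem_su2 (cis_sigmaZ_mem_su2 _).1 (cis_sigmaX_mem_su2 θ)

theorem norm_involution_le {ι : Type*} [Fintype ι] [DecidableEq ι] [Nonempty ι]
    {A : Matrix ι ι ℂ} (hA : A * A = 1) (hH : Aᴴ = A) : ‖A‖ = 1 := by
  refine CStarRing.norm_of_mem_unitary ?_
  rw [Unitary.mem_iff, star_eq_conjTranspose, hH]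
  exact ⟨hA, hA⟩

theorem norm_cis_sub_one_le {ι : Type*} [Fintype ι] [DecidableEq ι] [Nonempty ι]
    {A : Matrix ι ι ℂ} (hA : A * A = 1) (hH : Aᴴ = A) {θ s : ℝ} (hs : |Real.sin θ| = s)
    (hc : 0 ≤ Real.cos θ) : ‖cis θ A - 1‖ ≤ 2 * s := by
  have e : cis θ A - 1 = ((Real.cos θ - 1 : ℝ) : ℂ) • (1 : Matrix ι ι ℂ)
      + (Complex.I * (Real.sin θ : ℂ)) • A := by
    rw [cis]
    push_cast
    module
  rw [e]
  refine (norm_add_le _ _).trans ?_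
  rw [norm_smul, norm_smul, norm_involution_le hA hH, norm_one, norm_mul, Complex.norm_I,
    Complex.norm_real, Complex.norm_real, Real.norm_eq_abs, Real.norm_eq_abs, hs]
  have hs0 : 0 ≤ s := hs ▸ abs_nonneg _
  have hs1 : s ≤ 1 := hs ▸ Real.abs_sin_le_one θ
  have h2 : s ^ 2 + Real.cos θ ^ 2 = 1 := by
    rw [← hs, sq_abs, Real.sin_sq_add_cos_sq]
  have h3 := Real.cos_le_one θ
  rw [abs_of_nonpos (by linarith)]
  nlinarith

/-- After diagonalising `Δ`, rotations about `X` and `-Y` by angles of sine about `√(|y|/2)` have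
ring commutator exactly `i y Z`. What remains is `|1 - x| ≤ y²` and the factor `star V * star W`,
which is within `4 s` of `1`. -/
theorem exists_grpComm {Δ : Matrix (Fin 2) (Fin 2) ℂ} (hΔ : Δ ∈ su2) {r : ℝ} (hr : 0 ≤ r)
    (hr1 : r ≤ 1) (h : ‖Δ - 1‖ ≤ r ^ 2) :
    ∃ V ∈ su2, ∃ W ∈ su2, ‖V - 1‖ ≤ 2 * r ∧ ‖W - 1‖ ≤ 2 * r ∧ ‖grpComm V W - Δ‖ ≤ 6 * r ^ 3 := by
  obtain ⟨x, y, S, hS, rfl, hxy⟩ := exists_conj_diagonal hΔ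
  rw [norm_conj_sub_one hS] at h
  have hD : (x : ℂ) • 1 + (Complex.I * (y : ℂ)) • sigmaZ - 1
      = diagonal ![(x - 1 : ℂ) + Complex.I * y, (x - 1 : ℂ) - Complex.I * y] := by
    ext i j
    fin_cases i <;> fin_cases j <;> simp [sigmaZ] <;> ring
  have h0 : ‖(x - 1 : ℂ) + Complex.I * y‖ ≤ r ^ 2 := by
    rw [hD, l2_opNorm_diagonal] at h
    exact (norm_le_pi_norm (![(x - 1 : ℂ) + Complex.I * y, (x - 1 : ℂ) - Complex.I * y]) 0).trans h
  have hy : |y| ≤ r ^ 2 := by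
    have := (Complex.abs_im_le_norm ((x - 1 : ℂ) + Complex.I * y)).trans h0
    simpa using this
  have hx : |x - 1| ≤ r ^ 2 := by
    have := (Complex.abs_re_le_norm ((x - 1 : ℂ) + Complex.I * y)).trans h0
    simpa using this
  have hx0 : 0 ≤ x := by
    have := (abs_le.1 hx).1
    nlinarith
  have hx1 : |1 - x| ≤ y ^ 2 := by
    rw [abs_le]
    constructor <;> nlinarith [sq_nonneg y]
  set s := Real.sqrt (|y| / 2) with hs
  have hs0 : 0 ≤ s := Real.sqrt_nonneg _
  have hs2 : s ^ 2 = |y| / 2 := Real.sq_sqrt (by positivity)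
  have hsr : s ≤ r := by
    rw [hs, Real.sqrt_le_left hr]
    linarith [abs_nonneg y]
  -- The sign of `y` is put into the second angle, so that `2 s sin b = y` in both cases.
  obtain ⟨b, hbs, hb, hcb⟩ : ∃ b, |Real.sin b| = s ∧ 2 * s * Real.sin b = y ∧ 0 ≤ Real.cos b := by
    have hsin : Real.sin (Real.arcsin s) = s := Real.sin_arcsin (by linarith) (by linarith)
    rcases le_total 0 y with hy0 | hy0
    · refine ⟨Real.arcsin s, by rw [hsin, abs_of_nonneg hs0], ?_, Real.cos_arcsin_nonneg s⟩
      rw [abs_of_nonneg hy0] at hs2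
      rw [hsin]
      linarith
    · refine ⟨-Real.arcsin s, by rw [Real.sin_neg, hsin, abs_neg, abs_of_nonneg hs0], ?_, ?_⟩
      · rw [abs_of_nonpos hy0] at hs2
        rw [Real.sin_neg, hsin]
        linarith
      · rw [Real.cos_neg]
        exact Real.cos_arcsin_nonneg s
  have hsin : Real.sin (Real.arcsin s) = s := Real.sin_arcsin (by linarith) (by linarith)
  set V := cis (Real.arcsin s) sigmaX with hV
  set W := cis b (-sigmaY) with hW
  have hVn : ‖V - 1‖ ≤ 2 * s := norm_cis_sub_one_le sigmaX_mul_self sigmaX_conjTranspose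
    (by rw [hsin, abs_of_nonneg hs0]) (Real.cos_arcsin_nonneg s)
  have hWn : ‖W - 1‖ ≤ 2 * s := norm_cis_sub_one_le (by rw [neg_mul_neg, sigmaY_mul_self])
    (by rw [conjTranspose_neg, sigmaY_conjTranspose]) hbs hcb
  have hVu : V ∈ su2 := cis_sigmaX_mem_su2 _
  have hWu : W ∈ su2 := cis_neg_sigmaY_mem_su2 _
  have hcomm : (V - 1) * (W - 1) - (W - 1) * (V - 1) = (Complex.I * (y : ℂ)) • sigmaZ := by
    have e : (V - 1) * (W - 1) - (W - 1) * (V - 1) = V * W - W * V := by noncomm_ring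
    rw [e, hV, hW, ← hb]
    simp only [cis, add_mul, mul_add, smul_mul_smul_comm, mul_one, one_mul, mul_neg, neg_mul,
      sigmaX_mul_sigmaY, sigmaY_mul_sigmaX, hsin]
    push_cast
    have hi := Complex.I_sq
    match_scalars <;> grind
  have hD : grpComm V W - ((x : ℂ) • 1 + (Complex.I * (y : ℂ)) • sigmaZ)
      = ((1 - x : ℝ) : ℂ) • 1 + (Complex.I * (y : ℂ)) • (sigmaZ * (star V * star W - 1)) := by
    have e := grpComm_sub_one hVu.1 hWu.1
    rw [hcomm] at e
    rw [eq_add_of_sub_eq e, mul_sub, mul_one, smul_sub, smul_mul_assoc]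
    push_cast
    module
  have hstar : ‖star V * star W - 1‖ ≤ 4 * s := by
    have := norm_star_mul_star_sub_le (V := (1 : Matrix (Fin 2) (Fin 2) ℂ)) (W := 1)
      (one_mem _) hWu.1 hVn hWn
    rw [star_one, mul_one] at this
    linarith
  refine ⟨S * V * star S, conj_mem_su2 hS hVu, S * W * star S, conj_mem_su2 hS hWu, ?_, ?_, ?_⟩
  · rw [norm_conj_sub_one hS]
    linarith
  · rw [norm_conj_sub_one hS]
    linarith
  · rw [grpComm_conj hS, ← sub_mul, ← mul_sub,
      CStarRing.norm_mul_mem_unitary _ (Unitary.star_mem hS),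
      CStarRing.norm_mem_unitary_mul _ hS, hD]
    refine (norm_add_le _ _).trans ?_
    have hz : ‖sigmaZ * (star V * star W - 1)‖ ≤ 4 * s := by
      refine (norm_mul_le _ _).trans ?_
      rw [norm_involution_le sigmaZ_mul_self sigmaZ_conjTranspose, one_mul]
      exact hstar
    rw [norm_smul, norm_smul, norm_one, mul_one, norm_mul, Complex.norm_I, one_mul,
      Complex.norm_real, Complex.norm_real, Real.norm_eq_abs, Real.norm_eq_abs]
    have h4 : |y| * ‖sigmaZ * (star V * star W - 1)‖ ≤ r ^ 2 * (4 * s) :=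
      mul_le_mul hy hz (norm_nonneg _) (by positivity)
    have h5 : y ^ 2 ≤ r ^ 2 * r ^ 2 := by
      rw [← sq_abs, sq]
      exact mul_le_mul hy hy (abs_nonneg _) (by positivity)
    have h6 : r ^ 2 * r ^ 2 ≤ r ^ 3 := by
      have := pow_nonneg hr 3
      nlinarith
    nlinarith [mul_nonneg (sq_nonneg r) (sub_nonneg.2 hsr)]

/-- The remainder `U * star A` is approximated by a commutator of approximated factors, four words
in addition to `A`. With `δ = r²` and `η = 2r` the errors are `8r³ + 18r⁴` from
`norm_grpComm_sub_le` and `6r³` from `exists_grpComm`. -/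
theorem Dense2.step {l : ℕ} {r : ℝ} (hr : 0 ≤ r) (hr1 : r ≤ 1) (h : Dense2 l (r ^ 2)) :
    Dense2 (5 * l) (32 * r ^ 3) := by
  intro U hU
  obtain ⟨A, hA, hAU⟩ := h U hU
  have hAs := hA.mem_su2
  have hΔ : U * star A ∈ su2 := mul_mem_su2 hU (star_mem_su2 hAs)
  have hAA := Unitary.mem_iff.1 hAs.1
  have hd : ‖U * star A - 1‖ ≤ r ^ 2 := by
    rw [← hAA.2, ← sub_mul, CStarRing.norm_mul_mem_unitary _ (Unitary.star_mem hAs.1),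
      norm_sub_rev]
    exact hAU
  obtain ⟨V, hV, W, hW, hVn, hWn, hVW⟩ := exists_grpComm hΔ hr hr1 hd
  obtain ⟨V', hV', hVd⟩ := h V hV
  obtain ⟨W', hW', hWd⟩ := h W hW
  have hc := norm_grpComm_sub_le hV.1 hW.1 hV'.mem_su2.1 hW'.mem_su2.1 hVd hWd hVn hWn
  refine ⟨grpComm V' W' * A, ?_, ?_⟩
  · exact ((((hV'.mul hW').mul hV'.star).mul hW'.star).mul hA).mono (by omega)
  · have e : grpComm V' W' * A - U = (grpComm V' W' - U * star A) * A := by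
      rw [sub_mul, mul_assoc U, hAA.1, mul_one]
    rw [e, CStarRing.norm_mul_mem_unitary _ hAs.1,
      ← sub_add_sub_cancel _ (grpComm V W)]
    refine (norm_add_le _ _).trans ?_
    have h4 : r ^ 4 ≤ r ^ 3 := pow_le_pow_of_le_one hr hr1 (by norm_num)
    nlinarith

/-- The accuracies solve the recursion exactly: `r ↦ 32 r³` becomes the cubing of the exponential,
that is, its exponent grows by `3/2` once squares are taken. -/
theorem exists_dense2_iterate : ∃ l₀ : ℕ, ∀ k : ℕ,
    Dense2 (5 ^ k * l₀) ((Real.exp (-((3 / 2 : ℝ) ^ k / 2)) / 32) ^ 2) := by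
  obtain ⟨l₀, hl⟩ := exists_dense2 (ε := (Real.exp (-((3 / 2 : ℝ) ^ 0 / 2)) / 32) ^ 2) (by positivity)
  refine ⟨l₀, fun k => ?_⟩
  induction k with
  | zero => simpa using hl
  | succ k ih =>
    have h1 : Real.exp (-((3 / 2 : ℝ) ^ k / 2)) / 32 ≤ 1 := by
      have : Real.exp (-((3 / 2 : ℝ) ^ k / 2)) ≤ 1 :=
        Real.exp_le_one_iff.2 (neg_nonpos.2 (by positivity))
      linarith
    have h2 := ih.step (by positivity) h1
    have e1 : 5 * (5 ^ k * l₀) = 5 ^ (k + 1) * l₀ := by ring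
    have e2 : Real.exp (-((3 / 2 : ℝ) ^ (k + 1) / 2)) ^ 2
        = Real.exp (-((3 / 2 : ℝ) ^ k / 2)) ^ 3 := by
      rw [← Real.exp_nat_mul, ← Real.exp_nat_mul]
      congr 1
      push_cast
      ring
    have e3 : 32 * (Real.exp (-((3 / 2 : ℝ) ^ k / 2)) / 32) ^ 3
        = (Real.exp (-((3 / 2 : ℝ) ^ (k + 1) / 2)) / 32) ^ 2 := by
      rw [div_pow (Real.exp _), div_pow (Real.exp (-((3 / 2 : ℝ) ^ (k + 1) / 2))), e2]
      ring
    rwa [e1, e3] at h2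

/-- The Solovay–Kitaev theorem for the one-qubit gates. -/
theorem solovay_kitaev : ∃ K : ℕ, ∀ δ : ℝ, 0 < δ → δ ≤ 1 → ∃ l : ℕ,
    (l : ℝ) ≤ K * (1 + Real.log (1 / δ)) ^ 4 ∧ Dense2 l δ := by
  obtain ⟨l₀, hl⟩ := exists_dense2_iterate
  refine ⟨6 * l₀, fun δ hδ hδ1 => ?_⟩
  have hlog : 0 ≤ Real.log (1 / δ) := Real.log_nonneg (by rw [le_div_iff₀ hδ]; linarith)
  set L := 1 + Real.log (1 / δ) with hL
  -- `(3/2)^m ≤ L < (3/2)^(m+1)`: the upper bound makes `exp (-(3/2)^(m+1))` at most `δ`, and the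
  -- lower one bounds the length. The power 4 comes from `5 ≤ (3/2)^4 ≤ 6`.
  obtain ⟨m, hm1, hm2⟩ := exists_nat_pow_near (x := L) (y := (3 / 2 : ℝ)) (by linarith) (by norm_num)
  refine ⟨5 ^ (m + 1) * l₀, ?_, ?_⟩
  · have h1 : (5 : ℝ) ^ (m + 1) ≤ 6 * L ^ 4 := by
      calc (5 : ℝ) ^ (m + 1) ≤ ((3 / 2 : ℝ) ^ 4) ^ (m + 1) := by gcongr; norm_num
        _ = (3 / 2 : ℝ) ^ 4 * ((3 / 2 : ℝ) ^ m) ^ 4 := by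
          rw [pow_succ ((3 / 2 : ℝ) ^ 4), ← pow_mul, ← pow_mul, mul_comm 4 m, mul_comm]
        _ ≤ 6 * L ^ 4 := by
          gcongr
          norm_num
    push_cast
    calc (5 : ℝ) ^ (m + 1) * l₀ ≤ 6 * L ^ 4 * l₀ := by gcongr
      _ = 6 * l₀ * L ^ 4 := by ring
  · intro U hU
    obtain ⟨A, hA, hd⟩ := hl (m + 1) U hU
    refine ⟨A, hA, hd.trans ?_⟩
    rw [div_pow, ← Real.exp_nat_mul]
    have e : ((2 : ℕ) : ℝ) * -((3 / 2 : ℝ) ^ (m + 1) / 2) = -((3 / 2 : ℝ) ^ (m + 1)) := by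
      push_cast
      ring
    rw [e]
    have h1 : Real.exp (-((3 / 2 : ℝ) ^ (m + 1))) ≤ δ := by
      rw [← Real.exp_log hδ]
      refine Real.exp_le_exp.2 ?_
      rw [one_div, Real.log_inv] at hL
      linarith
    have h2 := Real.exp_pos (-((3 / 2 : ℝ) ^ (m + 1)))
    linarith

theorem exists_phase_mem_su2 {A : Matrix (Fin 2) (Fin 2) ℂ}
    (hA : A ∈ unitary (Matrix (Fin 2) (Fin 2) ℂ)) : ∃ c : ℂ, ‖c‖ = 1 ∧ c • A ∈ su2 := by
  have hd : ‖A.det‖ = 1 := CStarRing.norm_of_mem_unitary (Matrix.det_of_mem_unitary hA)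
  -- In size two a scalar enters the determinant squared, so `c` is a square root of the inverse
  -- determinant.
  obtain ⟨c, hc⟩ := IsAlgClosed.exists_pow_nat_eq (A.det)⁻¹ (n := 2) (by norm_num)
  have hcn : ‖c‖ = 1 := by
    have : ‖c‖ ^ 2 = 1 := by rw [← norm_pow, hc, norm_inv, hd, inv_one]
    exact (pow_eq_one_iff_of_nonneg (norm_nonneg c) two_ne_zero).1 this
  have hcc : c * star c = 1 := by
    have := Complex.mul_conj c
    rw [Complex.normSq_eq_norm_sq, hcn] at this
    simpa using this
  have hd0 : A.det ≠ 0 := fun h => by simp [h] at hd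
  refine ⟨c, hcn, ?_, ?_⟩
  · rw [Unitary.mem_iff] at hA ⊢
    rw [star_smul, smul_mul_smul_comm, smul_mul_smul_comm, hA.1, hA.2, hcc, mul_comm, hcc,
      one_smul]
    exact ⟨rfl, rfl⟩
  · rw [det_smul, Fintype.card_fin, hc, inv_mul_cancel₀ hd0]

/-! ### Controlled operations -/

section Controlled

variable {R : Type*} [Ring R] [Algebra ℂ R]

/-- The operation that applies the involution `X` on the `-1` eigenspace of the involution `Z`. -/
def ctrl (Z X : R) : R := (1 / 2 : ℂ) • (1 + Z + X - Z * X)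

theorem ctrl_comm {Z X : R} (h : Commute Z X) : ctrl Z X = ctrl X Z := by
  rw [ctrl, ctrl, h.eq]
  congr 2
  abel

theorem ctrl_mul_self {Z X : R} (hZ : Z * Z = 1) (hX : X * X = 1) (h : Commute Z X) :
    ctrl Z X * ctrl Z X = 1 := by
  have e1 : Z * (Z * X) = X := by rw [← mul_assoc, hZ, one_mul]
  have e2 : X * (Z * X) = Z := by rw [h.eq, ← mul_assoc, hX, one_mul]
  have e3 : Z * X * Z = X := by rw [h.eq, mul_assoc, hZ, mul_one]
  have e4 : Z * X * X = Z := by rw [mul_assoc, hX, mul_one]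
  have e5 : Z * X * (Z * X) = 1 := mul_self_of_commute hZ hX h
  have e6 : X * Z = Z * X := h.eq.symm
  rw [ctrl, smul_mul_smul_comm]
  simp only [add_mul, mul_add, sub_mul, mul_sub, one_mul, mul_one, hZ, hX, e1, e2, e3, e4, e5, e6]
  module

/-- `P` exchanges the eigenspaces of `Z`, so `X` is applied on exactly one side of `P`, and the
discrepancy is a factor `X`. -/
theorem ctrl_mul_of_anticommute {Z X P : R} (hX : X * X = 1) (h : Commute Z X)
    (hPZ : Z * P = -(P * Z)) (hPX : Commute X P) : ctrl Z X * P = P * X * ctrl Z X := by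
  have e1 : Z * X * P = -(P * Z * X) := by rw [mul_assoc, hPX.eq, ← mul_assoc, hPZ, neg_mul]
  have e2 : P * X * Z = P * Z * X := by rw [mul_assoc, ← h.eq, ← mul_assoc]
  have e3 : P * X * X = P := by rw [mul_assoc, hX, mul_one]
  have e4 : P * X * (Z * X) = P * Z := by
    rw [h.eq, mul_assoc, ← mul_assoc X X, hX, one_mul]
  simp only [ctrl, smul_mul_assoc, mul_smul_comm, add_mul, mul_add, sub_mul, mul_sub, one_mul,
    mul_one, e1, e2, e3, e4, hPZ, hPX.eq]
  module

theorem Commute.ctrl_left {Z X P : R} (hZ : Commute Z P) (hX : Commute X P) :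
    Commute (ctrl Z X) P :=
  (((((Commute.one_left P).add_left hZ).add_left hX).sub_left (hZ.mul_left hX))).smul_left _

theorem mul_ctrl {U Z X X' : R} (hZ : U * Z = Z * U) (hX : U * X = X' * U) :
    U * ctrl Z X = ctrl Z X' * U := by
  simp only [ctrl, smul_mul_assoc, mul_smul_comm, add_mul, mul_add, sub_mul, mul_sub, one_mul,
    mul_one, hZ, hX]
  rw [← mul_assoc, hZ, mul_assoc, hX, mul_assoc]

end Controlled

theorem cnotOp_eq_ctrl {N : ℕ} (i j : Fin N) : cnotOp i j = ctrl (opZ i) (opX j) := rfl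

theorem cnotOp_mul_self {N : ℕ} {i j : Fin N} (h : i ≠ j) : cnotOp i j * cnotOp i j = 1 :=
  ctrl_mul_self (opZ_mul_self i) (opX_mul_self j) (onSite_commute h _ _)

theorem cnotOp_mul_opX {N : ℕ} {i j : Fin N} (h : i ≠ j) :
    cnotOp i j * opX i = opX i * opX j * cnotOp i j := by
  refine ctrl_mul_of_anticommute (opX_mul_self j) (onSite_commute h _ _) ?_
    (onSite_commute h.symm _ _)
  rw [opX_mul_opZ, neg_neg]

theorem cnotOp_commute_opX {N : ℕ} {i j : Fin N} (h : i ≠ j) : Commute (cnotOp i j) (opX j) :=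
  Commute.ctrl_left (onSite_commute h _ _) (Commute.refl _)

theorem cnotOp_star {N : ℕ} {i j : Fin N} (h : i ≠ j) : star (cnotOp i j) = cnotOp i j := by
  have hz : star (opZ i) = opZ i := by
    rw [star_eq_conjTranspose, onSite_conjTranspose, sigmaZ_conjTranspose]
  have hx : star (opX j) = opX j := by
    rw [star_eq_conjTranspose, onSite_conjTranspose, sigmaX_conjTranspose]
  rw [cnotOp, star_smul, star_sub, star_add, star_add, star_mul, hz, hx, star_one,
    (onSite_commute h sigmaZ sigmaX).eq]
  simp

theorem cnotOp_mem_unitary {N : ℕ} {i j : Fin N} (h : i ≠ j) : cnotOp i j ∈ unitary (Op N) := by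
  rw [Unitary.mem_iff, cnotOp_star h]
  exact ⟨cnotOp_mul_self h, cnotOp_mul_self h⟩

theorem onSite_mem_unitary {N : ℕ} (j : Fin N) {A : Matrix (Fin 2) (Fin 2) ℂ}
    (hA : A ∈ unitary (Matrix (Fin 2) (Fin 2) ℂ)) : onSite j A ∈ unitary (Op N) :=
  Unitary.map_mem (siteHom j) hA

/-- Hadamards exchange `X` and `Z`, and `ctrl` is symmetric in its two involutions. The global
Hadamard layer thus swaps control and target. -/
theorem cnotOp_reverse {N : ℕ} {i j : Fin N} (h : i ≠ j) :
    uniform N hGate * cnotOp i j = cnotOp j i * uniform N hGate := by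
  rw [cnotOp_eq_ctrl j i, ctrl_comm (onSite_commute h.symm _ _)]
  have hz := uniform_mul_onSite (N := N) hGate_mul_sigmaZ i
  have hx := uniform_mul_onSite (N := N) hGate_mul_sigmaX j
  simp only [cnotOp, ctrl, smul_mul_assoc, mul_smul_comm, add_mul, mul_add, sub_mul, mul_sub,
    one_mul, mul_one, hz, hx]
  rw [← mul_assoc, hz, mul_assoc, hx, mul_assoc]

theorem logReach_cnotOp_adjacent {n : ℕ} {k l : Fin n} (h : l.1 = k.1 + 1 ∨ k.1 = l.1 + 1) :
    LogReach n (1816 * n) (cnotOp k l) := by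
  have hn := l.2
  have hkl : k ≠ l := fun h' => by rw [h'] at h; omega
  rcases h with h | h
  · exact (logReach_cnotOp h).mono (by omega)
  · have h2 := ((logReach_had n).mul (logReach_cnotOp h)).mul (logReach_had n)
    rw [cnotOp_reverse hkl.symm, mul_assoc, uniform_mul, hGate_mul_self, uniform_one, mul_one] at h2
    exact h2.mono (by omega)

/-- Moving the target of a controlled-NOT gate from `a` to `b`. -/
theorem cnotOp_move {N : ℕ} {i a b : Fin N} (hia : i ≠ a) (hib : i ≠ b) (hab : a ≠ b) :
    cnotOp b a * cnotOp a b * cnotOp i a * (cnotOp a b * cnotOp b a) = cnotOp i b := by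
  -- Two of the three CNOTs of a swap already carry `X_a` to `X_b`, and they do not touch `Z_i`.
  have h1 : cnotOp b a * cnotOp a b * opX a = opX b * (cnotOp b a * cnotOp a b) := by
    rw [mul_assoc, cnotOp_mul_opX hab, ← mul_assoc, ← mul_assoc, (cnotOp_commute_opX hab.symm).eq,
      mul_assoc (opX a), cnotOp_mul_opX hab.symm, ← mul_assoc, ← mul_assoc,
      (onSite_commute hab sigmaX sigmaX).eq, mul_assoc (opX b) (opX a), opX_mul_self, mul_one,
      mul_assoc]
  have h2 : cnotOp b a * cnotOp a b * opZ i = opZ i * (cnotOp b a * cnotOp a b) :=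
    ((Commute.ctrl_left (onSite_commute hib.symm _ _) (onSite_commute hia.symm _ _)).mul_left
      (Commute.ctrl_left (onSite_commute hia.symm _ _) (onSite_commute hib.symm _ _))).eq
  rw [cnotOp_eq_ctrl i a, mul_ctrl h2 h1, mul_assoc]
  have h3 : cnotOp b a * cnotOp a b * (cnotOp a b * cnotOp b a) = 1 := by
    rw [mul_assoc, ← mul_assoc (cnotOp a b), cnotOp_mul_self hab, one_mul,
      cnotOp_mul_self hab.symm]
  rw [h3, mul_one, cnotOp_eq_ctrl]

/-- Each further unit of distance moves the target one site at the price of four adjacent CNOTs. -/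
theorem logReach_cnotOp_distance {n : ℕ} (d : ℕ) : ∀ i j : Fin n,
    (j.1 = i.1 + 1 + d ∨ i.1 = j.1 + 1 + d) → LogReach n (1816 * n * (4 * d + 1)) (cnotOp i j) := by
  induction d with
  | zero =>
    intro i j h
    exact (logReach_cnotOp_adjacent h).mono (by omega)
  | succ d ih =>
    intro i j h
    obtain ⟨a, ha, haj⟩ : ∃ a : Fin n, (a.1 = i.1 + 1 + d ∨ i.1 = a.1 + 1 + d) ∧
        (a.1 = j.1 + 1 ∨ j.1 = a.1 + 1) := by
      have hi := i.2
      have hj := j.2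
      rcases h with h | h
      · exact ⟨⟨j.1 - 1, by omega⟩, by dsimp only; omega, by dsimp only; omega⟩
      · exact ⟨⟨j.1 + 1, by omega⟩, by dsimp only; omega, by dsimp only; omega⟩
    have hia : i ≠ a := fun h' => by rw [h'] at ha; omega
    have hij : i ≠ j := fun h' => by rw [h'] at h; omega
    have haj' : a ≠ j := fun h' => by rw [h'] at haj; omega
    have h1 := logReach_cnotOp_adjacent haj
    have h2 := logReach_cnotOp_adjacent haj.symm
    have h3 := ((h1.mul h2).mul (ih i a ha)).mul (h2.mul h1)
    rw [cnotOp_move hia hij haj'] at h3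
    refine h3.mono (le_of_eq ?_)
    ring

theorem logReach_cnotOp_pair {n : ℕ} {i j : Fin n} (h : i ≠ j) :
    LogReach n (7264 * n * n) (cnotOp i j) := by
  have hi := i.2
  have hj := j.2
  have hij : i.1 ≠ j.1 := fun h' => h (Fin.ext h')
  obtain ⟨d, hd⟩ : ∃ d, j.1 = i.1 + 1 + d ∨ i.1 = j.1 + 1 + d := by
    rcases lt_or_gt_of_ne hij with h' | h'
    · exact ⟨j.1 - i.1 - 1, by omega⟩
    · exact ⟨i.1 - j.1 - 1, by omega⟩
  refine (logReach_cnotOp_distance d i j hd).mono ?_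
  have h4 : 4 * d + 1 ≤ 4 * n := by omega
  calc 1816 * n * (4 * d + 1) ≤ 1816 * n * (4 * n) := Nat.mul_le_mul_left _ h4
    _ = 7264 * n * n := by ring

/-! ### Approximate simulation -/

theorem logReach_qubitWord {n l : ℕ} (k : Fin n) {A : Matrix (Fin 2) (Fin 2) ℂ}
    (hA : QubitWord l A) : LogReach n (l * (802 * n)) (onSite k A) := by
  obtain ⟨w, hw, hl, rfl⟩ := hA
  have h : LogReach n (w.length * (802 * n)) (onSite k w.prod) := by
    clear hl
    induction w with
    | nil =>
      rw [List.prod_nil, onSite_one, List.length_nil, zero_mul]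
      exact LogReach.one n
    | cons x w ih =>
      have h1 := ih fun g hg => hw g (List.mem_cons_of_mem x hg)
      have h2 : LogReach n (802 * n) (onSite k x) := by
        obtain ⟨m, rfl | rfl⟩ := hw x List.mem_cons_self
        · rw [onSite_cis]
          exact (logReach_zRot k m).mono (by omega)
        · rw [onSite_cis]
          exact logReach_xRot k m
      rw [List.prod_cons, ← onSite_mul, List.length_cons]
      refine (h2.mul h1).mono (le_of_eq ?_)
      ring
  exact h.mono (Nat.mul_le_mul_right _ hl)

/-- Up to a phase, `U` is within `δ` of a unitary generated by at most `m` global gates. -/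
def ApproxReach (n m : ℕ) (δ : ℝ) (U : Op n) : Prop :=
  ∃ W ∈ unitary (Op n), ∃ c : ℂ, ‖c‖ = 1 ∧ LogReach n m W ∧ ‖W - c • U‖ ≤ δ

theorem ApproxReach.mono {n m m' : ℕ} {δ : ℝ} {U : Op n} (h : ApproxReach n m δ U)
    (hm : m ≤ m') : ApproxReach n m' δ U := by
  obtain ⟨W, hW, c, hc, hr, hd⟩ := h
  exact ⟨W, hW, c, hc, hr.mono hm, hd⟩

theorem LogReach.approxReach {n m : ℕ} {U : Op n} (h : LogReach n m U) (hU : U ∈ unitary (Op n))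
    {δ : ℝ} (hδ : 0 ≤ δ) : ApproxReach n m δ U :=
  ⟨U, hU, 1, norm_one, h, by simpa using hδ⟩

/-- Errors add without amplification because the neighbouring factors are unitary. -/
theorem ApproxReach.mul {n a b : ℕ} {δ ε : ℝ} {U V : Op n} (hU : ApproxReach n a δ U)
    (hV : ApproxReach n b ε V) (hVu : V ∈ unitary (Op n)) :
    ApproxReach n (a + b) (δ + ε) (U * V) := by
  obtain ⟨W, hW, c, hc, hr, hd⟩ := hU
  obtain ⟨W', hW', c', hc', hr', hd'⟩ := hV
  refine ⟨W * W', mul_mem hW hW', c * c', by rw [norm_mul, hc, hc', one_mul], hr.mul hr', ?_⟩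
  have e : W * W' - (c * c') • (U * V) = W * (W' - c' • V) + c' • ((W - c • U) * V) := by
    rw [mul_sub, sub_mul, mul_smul_comm, smul_sub, smul_mul_assoc, smul_smul, mul_comm c c']
    abel
  rw [e]
  refine (norm_add_le _ _).trans ?_
  rw [CStarRing.norm_mem_unitary_mul _ hW, norm_smul, hc', one_mul,
    CStarRing.norm_mul_mem_unitary _ hVu]
  linarith

theorem approxReach_onSite {n l : ℕ} {δ : ℝ} (h : Dense2 l δ) (k : Fin n)
    {A : Matrix (Fin 2) (Fin 2) ℂ} (hA : A ∈ unitary (Matrix (Fin 2) (Fin 2) ℂ)) :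
    ApproxReach n (l * (802 * n)) δ (onSite k A) := by
  obtain ⟨c, hc, hcA⟩ := exists_phase_mem_su2 hA
  obtain ⟨B, hB, hd⟩ := h _ hcA
  refine ⟨onSite k B, onSite_mem_unitary k hB.mem_su2.1, c, hc, logReach_qubitWord k hB, ?_⟩
  rw [← onSite_smul, ← siteHom_apply, ← siteHom_apply, ← map_sub]
  exact (norm_onSite_le k _).trans hd

theorem circuitGate_mem_unitary {n : ℕ} {g : Op n} (hg : CircuitGate n g) : g ∈ unitary (Op n) := by
  cases hg with
  | single k A hA => exact onSite_mem_unitary k hA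
  | cnot i j h =>
    rw [onPair_cnot h]
    exact cnotOp_mem_unitary h

theorem circuit_mem_unitary {n : ℕ} {circuit : List (Op n)}
    (h : ∀ g ∈ circuit, CircuitGate n g) : circuit.prod ∈ unitary (Op n) :=
  Submonoid.list_prod_mem _ fun g hg => circuitGate_mem_unitary (h g hg)

theorem approxReach_circuitGate {n l : ℕ} {δ : ℝ} (hδ : 0 ≤ δ) (hl : Dense2 l δ) {g : Op n}
    (hg : CircuitGate n g) : ApproxReach n (l * (802 * n) + 7264 * n * n) δ g := by
  cases hg with
  | single k A hA => exact (approxReach_onSite hl k hA).mono (by omega)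
  | cnot i j h =>
    rw [onPair_cnot h]
    exact ((logReach_cnotOp_pair h).approxReach (cnotOp_mem_unitary h) hδ).mono (by omega)

theorem approxReach_circuit {n M : ℕ} {δ : ℝ} (circuit : List (Op n))
    (h : ∀ g ∈ circuit, CircuitGate n g) (hM : ∀ g, CircuitGate n g → ApproxReach n M δ g) :
    ApproxReach n (circuit.length * M) (circuit.length * δ) circuit.prod := by
  induction circuit with
  | nil =>
    rw [List.length_nil, List.prod_nil, zero_mul, Nat.cast_zero, zero_mul]
    exact (LogReach.one n).approxReach (one_mem _) le_rfl
  | cons g w ih =>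
    have hw : ∀ g ∈ w, CircuitGate n g := fun g' hg => h g' (List.mem_cons_of_mem g hg)
    have h1 := (hM g (h g List.mem_cons_self)).mul (ih hw) (circuit_mem_unitary hw)
    rw [List.prod_cons, List.length_cons]
    convert h1 using 1
    · ring
    · push_cast
      ring

/-! ### From the logical register to the chain -/

theorem norm_leftHom_le {n : ℕ} (U : Op n) : ‖leftHom n U‖ ≤ ‖U‖ :=
  NonUnitalStarAlgHom.norm_apply_le (leftHom n) U

theorem norm_rightHom_le {n : ℕ} (U : Op n) : ‖rightHom n U‖ ≤ ‖U‖ :=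
  NonUnitalStarAlgHom.norm_apply_le (rightHom n) U

/-- Replacing `U` by `V` in one half at a time gives two errors, since star homomorphisms are
contractive. -/
theorem norm_logical_sub_le {n : ℕ} {U V : Op n} (hU : ‖U‖ ≤ 1) (hV : ‖V‖ ≤ 1) :
    ‖logical U - logical V‖ ≤ 2 * ‖U - V‖ := by
  have e : logical U - logical V
      = leftHom n U * rightHom n (U - V) + leftHom n (U - V) * rightHom n V := by
    rw [logical_eq, logical_eq, map_sub, map_sub]
    noncomm_ring
  rw [e]
  refine (norm_add_le _ _).trans ?_
  have h1 : ‖leftHom n U * rightHom n (U - V)‖ ≤ 1 * ‖U - V‖ :=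
    (norm_mul_le _ _).trans (mul_le_mul ((norm_leftHom_le U).trans hU) (norm_rightHom_le _)
      (norm_nonneg _) zero_le_one)
  have h2 : ‖leftHom n (U - V) * rightHom n V‖ ≤ ‖U - V‖ * 1 :=
    (norm_mul_le _ _).trans (mul_le_mul (norm_leftHom_le _) ((norm_rightHom_le V).trans hV)
      (norm_nonneg _) (norm_nonneg _))
  linarith

theorem norm_encode {n : ℕ} (ψ : Config n → ℂ) :
    ‖WithLp.toLp 2 (encode ψ)‖ = ‖WithLp.toLp 2 ψ‖ ^ 2 := by
  have h : ‖WithLp.toLp 2 (encode ψ)‖ ^ 2 = (‖WithLp.toLp 2 ψ‖ ^ 2) ^ 2 := by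
    rw [EuclideanSpace.norm_sq_eq, EuclideanSpace.norm_sq_eq, sq (∑ i, _), Finset.sum_mul_sum,
      ← Fintype.sum_prod_type', ← Equiv.sum_comp (halves n)]
    refine Finset.sum_congr rfl fun t _ => ?_
    rw [halves_apply]
    change ‖ψ (leftHalf t) * ψ (rightHalf t)‖ ^ 2 = _
    rw [norm_mul, mul_pow]
  exact (pow_left_inj₀ (norm_nonneg _) (by positivity) two_ne_zero).1 h

theorem ApproxReach.exists_approximates {n m : ℕ} {δ ε : ℝ} {U : Op n} (h : ApproxReach n m δ U)
    (hU : U ∈ unitary (Op n)) (hδ : 2 * δ ≤ ε) :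
    ∃ (m' : ℕ) (L : Op (2 * n)), m' ≤ m ∧ GlobalWord (2 * n) m' L ∧ Approximates L U ε := by
  obtain ⟨W, hW, c, hc, ⟨k, hk, d, hd, hw⟩, hWU⟩ := h
  have hWn := (CStarRing.norm_of_mem_unitary hW).le
  have hUn : ‖c • U‖ ≤ 1 := by
    rw [norm_smul, hc, one_mul, CStarRing.norm_of_mem_unitary hU]
  have hnorm : ‖d • logical W - (d * c ^ 2) • logical U‖ ≤ ε := by
    rw [mul_smul, ← logical_smul, ← smul_sub, norm_smul, hd, one_mul]
    linarith [norm_logical_sub_le hWn hUn]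
  refine ⟨k, d • logical W, hk, hw, d * c ^ 2, by simp [hd, hc], hnorm, fun ψ hψ => ?_⟩
  rw [← mulVec_encode, ← smul_mulVec, ← sub_mulVec]
  have h1 := l2_opNorm_mulVec (d • logical W - (d * c ^ 2) • logical U)
    (WithLp.toLp 2 (encode ψ))
  refine h1.trans ?_
  rw [norm_encode, hψ, one_pow, mul_one]
  exact hnorm

/-- The dominant cost is `m` gates times a word length of order `x⁴` times an overhead of order `n`,
hence degree 6. -/
theorem efficient_simulation : ∃ C d : ℕ, ∀ (n : ℕ) (circuit : List (Op n)),
    (∀ g ∈ circuit, CircuitGate n g) → ∀ ε : ℝ, 0 < ε → ε < 1 →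
      ∃ (m : ℕ) (L : Op (2 * n)),
        (m : ℝ) ≤ C * ((n : ℝ) + circuit.length + Real.log (1 / ε)) ^ d ∧
        GlobalWord (2 * n) m L ∧ Approximates L circuit.prod ε := by
  obtain ⟨K, hK⟩ := solovay_kitaev
  refine ⟨802 * K * 16 + 7264, 6, fun n circuit hcirc ε hε hε1 => ?_⟩
  have hlog : 0 < Real.log (1 / ε) := Real.log_pos (by rw [lt_div_iff₀ hε]; linarith)
  set m := circuit.length with hm
  -- The accuracy `ε / (2 m)` per gate requires `m > 0`; the empty circuit needs no global gate. A
  -- nonempty circuit also forces `n ≥ 1`.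
  rcases Nat.eq_zero_or_pos m with hm0 | hm0
  · have hnil : circuit = [] := List.length_eq_zero_iff.1 hm0
    have h := (LogReach.one n).approxReach (one_mem _) le_rfl
    obtain ⟨k, L, hk, hw, hL⟩ := h.exists_approximates (one_mem _) (ε := ε) (by linarith)
    refine ⟨k, L, ?_, hw, ?_⟩
    · rw [Nat.le_zero.1 hk, Nat.cast_zero]
      positivity
    · rw [hnil, List.prod_nil]
      exact hL
  have hm1 : (1 : ℝ) ≤ m := by exact_mod_cast hm0
  have hn1 : (1 : ℝ) ≤ n := by
    have : 0 < n := by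
      obtain ⟨g, w, hgw⟩ := List.exists_cons_of_length_pos hm0
      have := hcirc g (by rw [hgw]; exact List.mem_cons_self)
      cases this with
      | single k A hA => exact k.pos
      | cnot i j h => exact i.pos
    exact_mod_cast this
  have hδ : 0 < ε / (2 * m) := by positivity
  obtain ⟨l, hl, hD⟩ := hK (ε / (2 * m)) hδ (by
    rw [div_le_one (by positivity)]
    linarith)
  have h := approxReach_circuit circuit hcirc fun g hg => approxReach_circuitGate hδ.le hD hg
  obtain ⟨k, L, hk, hw, hL⟩ := h.exists_approximates (circuit_mem_unitary hcirc) (ε := ε)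
    (le_of_eq (by rw [← hm]; field_simp))
  refine ⟨k, L, ?_, hw, hL⟩
  set x : ℝ := (n : ℝ) + m + Real.log (1 / ε) with hx
  have hlx : 1 + Real.log (1 / (ε / (2 * m))) ≤ 2 * x := by
    have e : 1 / (ε / (2 * m)) = (2 * m) * (1 / ε) := by field_simp
    rw [e, Real.log_mul (by positivity) (by positivity)]
    have := Real.log_le_sub_one_of_pos (show (0 : ℝ) < 2 * m by positivity)
    linarith
  have hl0 : 0 ≤ 1 + Real.log (1 / (ε / (2 * m))) := by
    have : 0 ≤ Real.log (1 / (ε / (2 * m))) := Real.log_nonneg (by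
      rw [le_div_iff₀ hδ, one_mul, div_le_one (by positivity)]
      linarith)
    linarith
  have hx1 : 1 ≤ x := by linarith
  have hl4 : (l : ℝ) ≤ K * (16 * x ^ 4) := by
    refine hl.trans (mul_le_mul_of_nonneg_left ?_ (Nat.cast_nonneg K))
    calc (1 + Real.log (1 / (ε / (2 * m)))) ^ 4 ≤ (2 * x) ^ 4 := pow_le_pow_left₀ hl0 hlx 4
      _ = 16 * x ^ 4 := by ring
  have hnx : (n : ℝ) ≤ x := by linarith
  have hmx : (m : ℝ) ≤ x := by linarith
  calc (k : ℝ) ≤ ((m * (l * (802 * n) + 7264 * n * n) : ℕ) : ℝ) := by exact_mod_cast hk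
    _ = m * (l * (802 * n) + 7264 * (n * n)) := by push_cast; ring
    _ ≤ x * (K * (16 * x ^ 4) * (802 * x) + 7264 * (x * x)) := by gcongr
    _ = 802 * K * 16 * x ^ 6 + 7264 * x ^ 3 := by ring
    _ ≤ 802 * K * 16 * x ^ 6 + 7264 * x ^ 6 := by
      gcongr
      norm_num
    _ = ((802 * K * 16 + 7264 : ℕ) : ℝ) * x ^ 6 := by push_cast; ring

/-! ### Density of circuits in the unitary group -/

/-- The closure of the set of products of circuit gates. -/
def circuitClosure (n : ℕ) : Submonoid (Op n) :=
  (Submonoid.closure {g | CircuitGate n g}).topologicalClosure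

theorem isClosed_circuitClosure (n : ℕ) : IsClosed (circuitClosure n : Set (Op n)) :=
  Submonoid.isClosed_topologicalClosure _

theorem CircuitGate.mem_circuitClosure {n : ℕ} {g : Op n} (h : CircuitGate n g) :
    g ∈ circuitClosure n :=
  Submonoid.le_topologicalClosure _ (Submonoid.subset_closure h)

theorem cnotOp_mem_circuitClosure {n : ℕ} {i j : Fin n} (h : i ≠ j) :
    cnotOp i j ∈ circuitClosure n := by
  rw [← onPair_cnot h]
  exact (CircuitGate.cnot i j h).mem_circuitClosure

theorem tens_mem_circuitClosure {n : ℕ} {u : Fin n → Matrix (Fin 2) (Fin 2) ℂ}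
    (h : ∀ j, u j ∈ unitary (Matrix (Fin 2) (Fin 2) ℂ)) : tens u ∈ circuitClosure n := by
  rw [← ofFn_prod_onSite]
  refine Submonoid.list_prod_mem _ fun g hg => ?_
  obtain ⟨j, rfl⟩ := (List.mem_ofFn' _ _).1 hg
  exact (CircuitGate.single j (u j) (h j)).mem_circuitClosure

theorem tens_star {n : ℕ} (u : Fin n → Matrix (Fin 2) (Fin 2) ℂ) :
    star (tens u) = tens (star u) := tens_conjTranspose u

theorem tens_mem_unitary {n : ℕ} {u : Fin n → Matrix (Fin 2) (Fin 2) ℂ}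
    (h : ∀ j, u j ∈ unitary (Matrix (Fin 2) (Fin 2) ℂ)) : tens u ∈ unitary (Op n) := by
  rw [Unitary.mem_iff, tens_star, ← map_mul, ← map_mul, ← map_one tens]
  exact ⟨congrArg tens (funext fun j => (h j).1), congrArg tens (funext fun j => (h j).2)⟩

/-- The tensor product of `σ^z` on the qubits in `s` and the identity on the others. -/
def zString {n : ℕ} (s : Finset (Fin n)) : Op n := tens fun j => if j ∈ s then sigmaZ else 1

theorem opX_mul_zString {n : ℕ} {s : Finset (Fin n)} {i : Fin n} (hi : i ∈ s) :
    opX i * zString s = -(zString s * opX i) := by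
  have h : (Pi.mulSingle i sigmaX * fun j => if j ∈ s then sigmaZ else 1 :
      Fin n → Matrix (Fin 2) (Fin 2) ℂ) = fun j => (Pi.mulSingle i (-1) : Fin n → ℂ) j •
        ((fun j => if j ∈ s then sigmaZ else 1) * Pi.mulSingle i sigmaX :
          Fin n → Matrix (Fin 2) (Fin 2) ℂ) j := by
    funext j
    rcases eq_or_ne j i with rfl | hj
    · simp [hi, sigmaX_mul_sigmaZ]
    · simp [hj]
  rw [zString, opX, onSite_eq_tens, ← map_mul, ← map_mul, h, tens_smul]
  simp

theorem zString_mul_opZ {n : ℕ} {s : Finset (Fin n)} {a : Fin n} (ha : a ∉ s) :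
    zString s * opZ a = zString (Finset.cons a s ha) := by
  rw [zString, zString, opZ, onSite_eq_tens, ← map_mul]
  congr 1
  funext j
  rcases eq_or_ne j a with rfl | hj
  · simp [ha]
  · simp [hj]

theorem opZ_commute_zString {n : ℕ} (s : Finset (Fin n)) (a : Fin n) :
    Commute (opZ a) (zString s) := by
  rw [zString, opZ, onSite_eq_tens]
  refine Commute.map (funext fun j => ?_) tens
  rcases eq_or_ne j a with rfl | hj
  · by_cases h : j ∈ s <;> simp [h]
  · simp [hj]

/-- CNOT conjugation carries `Z` on its target to `Z` on both qubits. Taking the target inside `s`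
and the control at the new qubit lengthens the string by one. -/
theorem zString_mem_generators {n : ℕ} {s : Finset (Fin n)} (hs : s.Nonempty) :
    zString s ∈ generators (circuitClosure n : Set (Op n)) := by
  induction hs using Finset.Nonempty.cons_induction with
  | singleton a =>
    have h : zString {a} = opZ a := by
      rw [zString, opZ, onSite_eq_tens]
      congr 1
      funext j
      rcases eq_or_ne j a with rfl | hj
      · simp
      · simp [hj]
    rw [h]
    refine mem_generators_of_cis (opZ_mul_self a)
      ((onSite_conjTranspose a _).trans (by rw [sigmaZ_conjTranspose])) fun t => ?_
    rw [← onSite_cis]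
    exact (CircuitGate.single a _
      (cis_mem_unitary sigmaZ_mul_self sigmaZ_conjTranspose t)).mem_circuitClosure
  | cons a s ha hs ih =>
    obtain ⟨i, hi⟩ := hs
    have hai : a ≠ i := fun h => ha (h ▸ hi)
    have hc := cnotOp_mem_circuitClosure hai
    have h := conj_mem_generators ih hc (by rwa [cnotOp_star hai]) (cnotOp_mem_unitary hai)
    have hcomm : Commute (opX i) (opZ a) := onSite_commute hai.symm _ _
    rwa [cnotOp_star hai, cnotOp_eq_ctrl, ctrl_comm hcomm.symm,
      ctrl_mul_of_anticommute (opZ_mul_self a) hcomm (opX_mul_zString hi)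
        (opZ_commute_zString s a), mul_assoc, ctrl_mul_self (opX_mul_self i) (opZ_mul_self a) hcomm,
      mul_one, zString_mul_opZ ha] at h

/-- The Pauli matrices, with the identity. -/
def pauli : Fin 4 → Matrix (Fin 2) (Fin 2) ℂ := ![1, sigmaX, sigmaY, sigmaZ]

theorem pauli_conjTranspose (k : Fin 4) : (pauli k)ᴴ = pauli k := by
  fin_cases k
  · exact conjTranspose_one
  · exact sigmaX_conjTranspose
  · exact sigmaY_conjTranspose
  · exact sigmaZ_conjTranspose

theorem exists_conj_eq_pauli (k : Fin 4) : ∃ u ∈ unitary (Matrix (Fin 2) (Fin 2) ℂ),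
    u * (if k ≠ 0 then sigmaZ else 1) * star u = pauli k := by
  have key : ∀ u ∈ unitary (Matrix (Fin 2) (Fin 2) ℂ), ∀ A B, u * A = B * u →
      u * A * star u = B := fun u hu A B h => by rw [h, mul_assoc, hu.2, mul_one]
  have hH : hGate ∈ unitary (Matrix (Fin 2) (Fin 2) ℂ) := by
    have hs : star hGate = hGate := by
      rw [star_eq_conjTranspose, hGate, conjTranspose_smul, conjTranspose_add,
        sigmaX_conjTranspose, sigmaZ_conjTranspose, Complex.star_def, Complex.conj_ofReal]
    rw [Unitary.mem_iff, hs]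
    exact ⟨hGate_mul_self, hGate_mul_self⟩
  have hY : cis (Real.pi / 4) sigmaX * sigmaZ = sigmaY * cis (Real.pi / 4) sigmaX := by
    rw [cis_pi_div_four_mul sigmaX_mul_self sigmaX_mul_sigmaZ, sigmaX_mul_sigmaZ,
      sigmaZ_mul_sigmaX, smul_neg, smul_smul, Complex.I_mul_I, neg_smul, one_smul, neg_neg]
  fin_cases k
  · exact ⟨1, one_mem _, by simp [pauli]⟩
  · exact ⟨hGate, hH, by simpa [pauli] using key _ hH _ _ hGate_mul_sigmaZ⟩
  · have hu := cis_mem_unitary sigmaX_mul_self sigmaX_conjTranspose (Real.pi / 4)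
    exact ⟨_, hu, by simpa [pauli] using key _ hu _ _ hY⟩
  · exact ⟨1, one_mem _, by simp [pauli]⟩

/-- A global phase is a one-qubit gate, which requires at least one qubit. -/
theorem one_mem_generators {n : ℕ} [NeZero n] :
    (1 : Op n) ∈ generators (circuitClosure n : Set (Op n)) := by
  refine mem_generators_of_cis (one_mul 1) isHermitian_one fun t => ?_
  rw [← onSite_one 0, ← onSite_cis]
  exact (CircuitGate.single 0 _ (cis_mem_unitary (one_mul 1) (star_one _) t)).mem_circuitClosure

/-- A Pauli string is a local unitary conjugate of the `Z` string on its support. Only the identity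
has empty support and needs `one_mem_generators`. -/
theorem tens_pauli_mem_generators {n : ℕ} [NeZero n] (p : Fin n → Fin 4) :
    tens (fun j => pauli (p j)) ∈ generators (circuitClosure n : Set (Op n)) := by
  choose u hu hup using exists_conj_eq_pauli
  have hz : zString (Finset.univ.filter fun j => p j ≠ 0) ∈
      generators (circuitClosure n : Set (Op n)) := by
    rcases Finset.eq_empty_or_nonempty (Finset.univ.filter fun j => p j ≠ 0) with h | h
    · have e : zString (∅ : Finset (Fin n)) = 1 := map_one tens
      rw [h, e]
      exact one_mem_generators
    · exact zString_mem_generators h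
  have hv : ∀ j, u (p j) ∈ unitary (Matrix (Fin 2) (Fin 2) ℂ) := fun j => hu _
  have h := conj_mem_generators hz (tens_mem_circuitClosure hv)
    (by
      rw [tens_star]
      exact tens_mem_circuitClosure fun j => Unitary.star_mem (hv j)) (tens_mem_unitary hv)
  rw [tens_star, zString, ← map_mul, ← map_mul] at h
  convert h using 2
  funext j
  simp [← hup (p j)]

theorem exists_eq_sum_pauli (A : Matrix (Fin 2) (Fin 2) ℂ) :
    ∃ c : Fin 4 → ℂ, A = ∑ k, c k • pauli k := by
  refine ⟨![(A 0 0 + A 1 1) / 2, (A 0 1 + A 1 0) / 2, Complex.I * (A 0 1 - A 1 0) / 2,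
    (A 0 0 - A 1 1) / 2], ?_⟩
  have hI : ∀ z : ℂ, Complex.I * z / 2 * Complex.I = -z / 2 := fun z => by
    linear_combination z / 2 * Complex.I_mul_I
  ext i j
  fin_cases i <;> fin_cases j <;>
    simp [Fin.sum_univ_four, pauli, sigmaX, sigmaY, sigmaZ, hI] <;> ring

theorem tens_sum_smul {n : ℕ} (c : Fin n → Fin 4 → ℂ) (σ : Fin 4 → Matrix (Fin 2) (Fin 2) ℂ) :
    tens (fun j => ∑ k, c j k • σ k) =
      ∑ p : Fin n → Fin 4, (∏ j, c j (p j)) • tens fun j => σ (p j) := by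
  ext s t
  simp only [tens_apply, Matrix.sum_apply, Matrix.smul_apply, smul_eq_mul,
    Finset.prod_univ_sum, Fintype.piFinset_univ, Finset.prod_mul_distrib]

/-- Matrix units are tensor products of one-qubit matrix units, each a combination of Pauli
matrices; expanding the product gives Pauli strings. -/
theorem mem_span_tens_pauli {n : ℕ} (A : Op n) :
    A ∈ Submodule.span ℂ (Set.range fun p : Fin n → Fin 4 => tens fun j => pauli (p j)) := by
  rw [matrix_eq_sum_single A]
  refine Submodule.sum_mem _ fun s _ => Submodule.sum_mem _ fun t _ => ?_
  have h : single s t (A s t) =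
      A s t • tens fun j => single (s j) (t j) (1 : ℂ) := by
    ext s' t'
    rw [Matrix.smul_apply, tens_apply]
    by_cases hst : s = s' ∧ t = t'
    · obtain ⟨rfl, rfl⟩ := hst
      simp
    · rw [single_apply_of_ne _ _ _ _ _ hst]
      have : ∃ j, ¬(s j = s' j ∧ t j = t' j) := by
        by_contra! hc
        exact hst ⟨funext fun j => (hc j).1, funext fun j => (hc j).2⟩
      obtain ⟨j, hj⟩ := this
      have hz : single (s j) (t j) (1 : ℂ) (s' j) (t' j) = 0 := single_apply_of_ne _ _ _ _ _ hj
      exact (by rw [Finset.prod_eq_zero (Finset.mem_univ j) hz, smul_zero])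
  choose c hc using exists_eq_sum_pauli
  rw [h]
  refine Submodule.smul_mem _ _ ?_
  rw [show (fun j => single (s j) (t j) (1 : ℂ)) =
    fun j => ∑ k, c (single (s j) (t j) 1) k • pauli k from funext fun j => hc _, tens_sum_smul]
  exact Submodule.sum_mem _ fun p _ => Submodule.smul_mem _ _ (Submodule.subset_span ⟨p, rfl⟩)

/-- Pauli strings are Hermitian, so averaging an expansion of `H` with its adjoint makes the
coefficients real, as the real vector space of generators requires. -/
theorem isHermitian_mem_generators {n : ℕ} [NeZero n] {H : Op n} (hH : H.IsHermitian) :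
    H ∈ generators (circuitClosure n : Set (Op n)) := by
  obtain ⟨c, hc⟩ := (Submodule.mem_span_range_iff_exists_fun ℂ).1 (mem_span_tens_pauli H)
  have hre : H = ∑ p, (((c p).re : ℝ) : ℂ) • tens fun j => pauli (p j) := by
    have h1 : H = (1 / 2 : ℂ) • (H + Hᴴ) := by
      rw [hH.eq]
      module
    rw [h1, ← hc, conjTranspose_sum, ← Finset.sum_add_distrib, Finset.smul_sum]
    refine Finset.sum_congr rfl fun p _ => ?_
    rw [conjTranspose_smul, tens_conjTranspose]
    simp only [pauli_conjTranspose]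
    rw [← add_smul, smul_smul, Complex.re_eq_add_conj, Complex.star_def]
    congr 1
    ring
  rw [hre]
  exact sum_mem_generators (isClosed_circuitClosure n) _ _ fun p _ =>
    smul_mem_generators (tens_pauli_mem_generators p) _

theorem exists_circuit_near {n : ℕ} [NeZero n] {U : Op n} (hU : U ∈ unitary (Op n)) {δ : ℝ}
    (hδ : 0 < δ) : ∃ (circuit : List (Op n)) (c : ℂ), (∀ g ∈ circuit, CircuitGate n g) ∧
      ‖c‖ = 1 ∧ ‖circuit.prod - c • U‖ ≤ δ := by
  obtain ⟨c, H, hc, hH, he⟩ := exists_exp_of_unitary hU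
  have h := (isHermitian_mem_generators hH).2 1
  rw [Complex.ofReal_one, mul_one, ← he] at h
  obtain ⟨V, hV, hd⟩ := Metric.mem_closure_iff.1 h δ hδ
  obtain ⟨w, hw, rfl⟩ := Submonoid.exists_list_of_mem_closure hV
  refine ⟨w, c, hw, hc, ?_⟩
  rw [dist_eq_norm, norm_sub_rev] at hd
  exact hd.le

theorem exists_approxReach_circuit {n : ℕ} {circuit : List (Op n)}
    (h : ∀ g ∈ circuit, CircuitGate n g) {δ : ℝ} (hδ : 0 < δ) :
    ∃ m, ApproxReach n m δ circuit.prod := by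
  -- The added one keeps the denominator positive for the empty circuit.
  have hη : 0 < δ / (circuit.length + 1) := by positivity
  obtain ⟨l, hl⟩ := exists_dense2 hη
  obtain ⟨W, hW, c, hc, hr, hd⟩ := approxReach_circuit circuit h fun g hg =>
    approxReach_circuitGate hη.le hl hg
  refine ⟨_, W, hW, c, hc, hr, hd.trans ?_⟩
  rw [mul_div_assoc', div_le_iff₀ (by positivity)]
  linarith

theorem exists_approxReach {n : ℕ} {U : Op n} (hU : U ∈ unitary (Op n)) {δ : ℝ} (hδ : 0 < δ) :
    ∃ m, ApproxReach n m δ U := by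
  rcases Nat.eq_zero_or_pos n with rfl | hn
  -- Without qubits a unitary is a scalar of modulus one, which the free phase absorbs.
  · obtain ⟨z, hs⟩ : ∃ z : ℂ, U = z • 1 := by
      refine ⟨U default default, ?_⟩
      ext s t
      rw [Subsingleton.elim s default, Subsingleton.elim t default]
      simp
    have hz : ‖z‖ = 1 := by
      have := CStarRing.norm_of_mem_unitary hU
      rwa [hs, norm_smul, norm_one, mul_one] at this
    have hz0 : z ≠ 0 := norm_ne_zero_iff.1 (by rw [hz]; exact one_ne_zero)
    refine ⟨_, 1, one_mem _, z⁻¹, by rw [norm_inv, hz, inv_one], LogReach.one 0, ?_⟩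
    rw [hs, smul_smul, inv_mul_cancel₀ hz0, one_smul, sub_self, norm_zero]
    exact hδ.le
  · have : NeZero n := ⟨hn.ne'⟩
    obtain ⟨w, c, hw, hc, hd⟩ := exists_circuit_near hU (half_pos hδ)
    obtain ⟨m, W, hW, c', hc', hr, hd'⟩ := exists_approxReach_circuit hw (half_pos hδ)
    refine ⟨m, W, hW, c' * c, by rw [norm_mul, hc, hc', one_mul], hr, ?_⟩
    rw [show W - (c' * c) • U = (W - c' • w.prod) + c' • (w.prod - c • U) by
      rw [smul_sub, smul_smul]; abel]
    refine (norm_add_le _ _).trans ?_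
    rw [norm_smul, hc', one_mul]
    linarith

theorem exists_approximates_of_mem_unitary (n : ℕ) (U : Op n)
    (hU : U ∈ Matrix.unitaryGroup (Config n) ℂ) (ε : ℝ) (hε : 0 < ε) :
    ∃ (m : ℕ) (L : Op (2 * n)), GlobalWord (2 * n) m L ∧ Approximates L U ε := by
  obtain ⟨m, h⟩ := exists_approxReach hU (half_pos hε)
  obtain ⟨k, L, -, hw, hL⟩ := h.exists_approximates hU (le_of_eq (mul_div_cancel₀ ε two_ne_zero))
  exact ⟨k, L, hw, hL⟩

end GlobalIsing

end

theorem mainTheorem5 :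
    -- exact realisation of the logical gates, with an overhead linear in `n`
    (∃ C : ℕ, ∀ (n : ℕ) (U : GlobalIsing.Op n), GlobalIsing.ElementaryLogical n U →
      ∃ (m : ℕ) (L : GlobalIsing.Op (2 * n)), m ≤ C * n ∧
        GlobalIsing.GlobalWord (2 * n) m L ∧ GlobalIsing.Realises L U) ∧
    -- approximation of every unitary on `n` logical qubits
    (∀ (n : ℕ) (U : GlobalIsing.Op n),
      U ∈ Matrix.unitaryGroup (GlobalIsing.Config n) ℂ → ∀ ε : ℝ, 0 < ε →
        ∃ (m : ℕ) (L : GlobalIsing.Op (2 * n)),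
          GlobalIsing.GlobalWord (2 * n) m L ∧ GlobalIsing.Approximates L U ε) ∧
    -- efficient simulation of quantum circuits
    (∃ C d : ℕ, ∀ (n : ℕ) (circuit : List (GlobalIsing.Op n)),
      (∀ g ∈ circuit, GlobalIsing.CircuitGate n g) → ∀ ε : ℝ, 0 < ε → ε < 1 →
        ∃ (m : ℕ) (L : GlobalIsing.Op (2 * n)),
          (m : ℝ) ≤ C * ((n : ℝ) + circuit.length + Real.log (1 / ε)) ^ d ∧
          GlobalIsing.GlobalWord (2 * n) m L ∧
          GlobalIsing.Approximates L circuit.prod ε) :=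
  ⟨GlobalIsing.exact_realisation, GlobalIsing.exists_approximates_of_mem_unitary, GlobalIsing.efficient_simulation⟩
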